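/- A straight-line planar drawing of a graph places the vertices at distinct points of the plane and draws the edges as straight segments, so that no vertex lies on a non-incident edge and no two edges cross or overlap. A triangulation is a straight-line planar drawing of a maximal planar graph; its faces, including the outer face, are triangles, and a vertex not on the outer face is internal. Two drawings of the same maximal planar graph are topologically equivalent if they have the same circular order of edges around every vertex and the same outer face. A unidirectional morph between two drawings of a graph is a linear motion of all vertices (each at uniform speed along a segment) in which all vertices move parallel to one common line and every intermediate drawing is straight-line planar; a morph consisting of $m$ unidirectional morphs is given by $m+1$ straight-line planar drawings such that the linear motion between any two consecutive ones is a unidirectional morph. For an internal vertex $v$ of a triangulation, $\Delta(v)$ is the polygon formed by its neighbors. Contracting $v$ to a neighbor $u$ that lies in the kernel of $\Delta(v)$ (i.e. that sees the whole polygon) means moving $v$ along a segment to $u$, which leaves a drawing of the graph $G/uv$ with all other vertices fixed; the reverse is called uncontracting $v$. **Theorem.** Let $\Gamma_1$ and $\Gamma_2$ be two triangulations that are topologically equivalent drawings of an $n$-vertex maximal planar graph $G$. Suppose that there is a pseudomorph from $\Gamma_1$ to $\Gamma_2$ in which we contract an internal vertex $v$ of degree at most $5$ to a neighbor $u$, perform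 $k$ unidirectional morphs of $G/uv$, given by $k+1$ straight-line planar drawings $\Gamma'_1,\dots,\Gamma'_{k+1}$ of $G/uv$, and then uncontract $v$ from $u$. Then there is a morph $\mathcal M$ from $\Gamma_1$ to $\Gamma_2$ that consists of $k+2$ unidirectional morphs. It is obtained by giving $v$ a position in each of the drawings $\Gamma'_1,\dots,\Gamma'_{k+1}$: the $k+3$ drawings that define $\mathcal M$ are $\Gamma_1$, then $\Gamma'_1,\dots,\Gamma'_{k+1}$ with $v$ and its edges added, then $\Gamma_2$. If $v$ has degree $5$, then moreover there is $\varepsilon>0$ such that, throughout the middle $k$ steps of $\mathcal M$, the distance from $v$ to $u$ is less than $\varepsilon$ while each line through an edge of $\Delta(v)$ not incident to $u$ has distance at least $\varepsilon$ from $u$; so $v$ stays in a circular sector at $u$, the part inside the kernel of $\Delta(v)$ of the disk of radius $\varepsilon$ around $u$. Furthermore, there is an algorithm on the real RAM that, given the sequence of $k+1$ drawings that define the pseudomorph (together with $G$, $u$, $v$ and the positions of $v$ in $\Gamma_1$ and $\Gamma_2$), modifies it in place to obtain the sequence of drawings that define such a morph $\mathcal M$, in $O(k+n)$ time. -/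

import Mathlib

/-! ## Straight-line drawings in the plane (identified with `ℂ`) -/

/-- A straight-line drawing is given by its vertex positions `p : V → ℂ`. It is planar if distinct
vertices are at distinct points, no vertex lies on a non-incident edge, and the open segments that
represent two different edges do not meet. -/
structure IsPlanarDrawing {V : Type*} (G : SimpleGraph V) (p : V → ℂ) : Prop where
  injective : Function.Injective p
  vertex_edge : ∀ x y w, G.Adj x y → w ≠ x → w ≠ y → p w ∉ segment ℝ (p x) (p y)
  edge_edge : ∀ x y x' y', G.Adj x y → G.Adj x' y' → s(x, y) ≠ s(x', y') →
    Disjoint (openSegment ℝ (p x) (p y)) (openSegment ℝ (p x') (p y'))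

/-- The points of the plane covered by the drawing: all vertices and all edges. -/
def drawingSet {V : Type*} (G : SimpleGraph V) (p : V → ℂ) : Set ℂ :=
  Set.range p ∪ {z | ∃ x y, G.Adj x y ∧ z ∈ segment ℝ (p x) (p y)}

/-- The face of the drawing that contains the point `z` (for `z` not on the drawing). -/
def faceOf {V : Type*} (G : SimpleGraph V) (p : V → ℂ) (z : ℂ) : Set ℂ :=
  connectedComponentIn (drawingSet G p)ᶜ z

/-- The outer (unbounded) face. -/
def outerFace {V : Type*} (G : SimpleGraph V) (p : V → ℂ) : Set ℂ :=
  {z | z ∉ drawingSet G p ∧ ¬ Bornology.IsBounded (faceOf G p z)}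

/-- The vertex `w` is on the boundary of the outer face; the other vertices are internal. -/
def IsBoundaryVertex {V : Type*} (G : SimpleGraph V) (p : V → ℂ) (w : V) : Prop :=
  p w ∈ closure (outerFace G p)

/-- A triangulation: a straight-line planar drawing in which every face, including the outer face,
is a triangle, i.e. every face is the interior or the exterior of a triangle `x y w` of `G`.
(For a simple graph on at least three vertices this says that the graph is maximal planar.) -/
structure IsTriangulation {V : Type*} (G : SimpleGraph V) (p : V → ℂ) : Prop where
  planar : IsPlanarDrawing G p
  faces : ∀ z, z ∉ drawingSet G p → ∃ x y w, G.Adj x y ∧ G.Adj y w ∧ G.Adj w x ∧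
    (faceOf G p z = interior (convexHull ℝ {p x, p y, p w}) ∨
      faceOf G p z = (convexHull ℝ {p x, p y, p w})ᶜ)

/-- The determinant of two plane vectors. -/
def cross (z w : ℂ) : ℝ := z.re * w.im - z.im * w.re

/-- The vectors `x, y, z` point in three different directions, in this counterclockwise cyclic
order. The three counterclockwise angles from `x` to `y`, from `y` to `z` and from `z` to `x` add
up to a full turn exactly in this case, and then at least two of them are less than `π`. -/
def CcwOrder (x y z : ℂ) : Prop :=
  (0 < cross x y ∧ 0 < cross y z) ∨ (0 < cross y z ∧ 0 < cross z x) ∨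
    (0 < cross z x ∧ 0 < cross x y)

/-- Topological equivalence of two drawings of a maximal planar graph: the same circular order of
the edges around every vertex, and the same outer face. -/
structure TopologicallyEquivalent {V : Type*} (G : SimpleGraph V) (p q : V → ℂ) : Prop where
  rotation : ∀ u x y z, G.Adj u x → G.Adj u y → G.Adj u z →
    (CcwOrder (p x - p u) (p y - p u) (p z - p u) ↔
      CcwOrder (q x - q u) (q y - q u) (q z - q u))
  outer : ∀ w, IsBoundaryVertex G p w ↔ IsBoundaryVertex G q w

/-! ## Morphs -/

/-- The drawing at time `t` of the linear morph from `p` to `q`. -/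
noncomputable def linearMorph {V : Type*} (p q : V → ℂ) (t : ℝ) : V → ℂ :=
  fun w => AffineMap.lineMap (p w) (q w) t

/-- All vertices move parallel to one line, with unit direction vector `l`. -/
def IsUnidirectional {V : Type*} (p q : V → ℂ) : Prop :=
  ∃ l : ℂ, ‖l‖ = 1 ∧ ∀ w, ∃ c : ℝ, q w = p w + c • l

/-- The drawings `D 0, …, D m` define a (straight-line planarity preserving) morph that consists
of `m` unidirectional morphs. -/
structure IsUnidirectionalMorph {V : Type*} (G : SimpleGraph V) {m : ℕ}
    (D : Fin (m + 1) → V → ℂ) : Prop where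
  planar : ∀ i, IsPlanarDrawing G (D i)
  unidirectional : ∀ i : Fin m, IsUnidirectional (D i.castSucc) (D i.succ)
  planar_during : ∀ i : Fin m, ∀ t ∈ Set.Icc (0 : ℝ) 1,
    IsPlanarDrawing G (linearMorph (D i.castSucc) (D i.succ) t)

/-! ## Contractions and pseudomorphs -/

/-- The graph obtained by contracting the edge `v u`; the new vertex keeps the name `u`. -/
def contractGraph {V : Type*} (G : SimpleGraph V) (v u : V) : SimpleGraph {w : V // w ≠ v} where
  Adj x y := x ≠ y ∧ (G.Adj x y ∨ (x.1 = u ∧ G.Adj v y) ∨ (y.1 = u ∧ G.Adj v x))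
  symm := ⟨by
    rintro x y ⟨hne, h | h | h⟩
    · exact ⟨hne.symm, Or.inl h.symm⟩
    · exact ⟨hne.symm, Or.inr (Or.inr h)⟩
    · exact ⟨hne.symm, Or.inr (Or.inl h)⟩⟩
  loopless := ⟨fun _ h => h.1 rfl⟩

/-- The vertices `x, y, z` span a bounded triangular face. -/
def IsFaceTriangle {V : Type*} (G : SimpleGraph V) (p : V → ℂ) (x y z : V) : Prop :=
  G.Adj x y ∧ G.Adj y z ∧ G.Adj z x ∧
    Disjoint (interior (convexHull ℝ {p x, p y, p z})) (drawingSet G p)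

/-- For an internal vertex `v` of a triangulation: the closed region bounded by the polygon
`Δ(v)` that is formed by the neighbors of `v`. It is the union of the triangular faces at `v`. -/
def linkRegion {V : Type*} (G : SimpleGraph V) (p : V → ℂ) (v : V) : Set ℂ :=
  {z | ∃ x y, IsFaceTriangle G p v x y ∧ z ∈ convexHull ℝ {p v, p x, p y}}

/-- The kernel of a polygonal region: the points from which the whole region is visible. -/
def kernel (R : Set ℂ) : Set ℂ := {z | z ∈ R ∧ ∀ y ∈ R, segment ℝ z y ⊆ R}

/-- Contracting the internal vertex `v` to its neighbor `u`, which must be in the kernel of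
`Δ(v)`, turns the drawing `p` of `G` into the drawing `q` of the contracted graph. -/
structure IsContraction {V : Type*} (G : SimpleGraph V) (p : V → ℂ) (v u : V)
    (q : {w : V // w ≠ v} → ℂ) : Prop where
  internal : ¬ IsBoundaryVertex G p v
  adj : G.Adj v u
  mem_kernel : p u ∈ kernel (linkRegion G p v)
  fixed : ∀ w : {w : V // w ≠ v}, q w = p w

/-- A pseudomorph from `p` to `q`: contract `v` to `u` in `p`, perform the `k` unidirectional
morphs defined by the drawings `D 0, …, D k` of the contracted graph, and reverse the contraction
of `v` to `u` in `q`. -/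
structure IsPseudomorph {V : Type*} (G : SimpleGraph V) (p q : V → ℂ) (v u : V) {k : ℕ}
    (D : Fin (k + 1) → {w : V // w ≠ v} → ℂ) : Prop where
  contract : IsContraction G p v u (D 0)
  morph : IsUnidirectionalMorph (contractGraph G v u) D
  uncontract : IsContraction G q v u (D (Fin.last k))

/-- In the drawing `r`, the vertex `v` is at distance less than `ε` from `u`, and `ε` is at most
the distance from `u` to each line through an edge of `Δ(v)` that is not incident to `u`. Then the
kernel of `Δ(v)` cuts a circular sector out of the disk of radius `ε` around `u`, and in a planar
drawing `v` lies inside this sector. The faces at `v` are those of the drawing `p`. -/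
def InSector {V : Type*} (G : SimpleGraph V) (p : V → ℂ) (v u : V) (ε : ℝ) (r : V → ℂ) : Prop :=
  dist (r v) (r u) < ε ∧
    ∀ x y, IsFaceTriangle G p v x y → x ≠ u → y ≠ u →
      ∀ z ∈ affineSpan ℝ {r x, r y}, ε ≤ dist z (r u)

/-- The drawings `M 0, …, M (k + 2)` convert the pseudomorph from `p` to `q` into a morph of
`k + 2` unidirectional morphs, by giving `v` a position in each of the drawings `D 0, …, D k`. If
`v` has degree 5, then `v` stays in a small sector at `u` from `M 1` to `M (k + 1)`. -/
structure IsConversion {V : Type*} (G : SimpleGraph V) (p q : V → ℂ) (v u : V) {k : ℕ}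
    (D : Fin (k + 1) → {w : V // w ≠ v} → ℂ) (M : Fin (k + 2 + 1) → V → ℂ) : Prop where
  first : M 0 = p
  last : M (Fin.last (k + 2)) = q
  morph : IsUnidirectionalMorph G M
  extends_drawings : ∀ (i : Fin (k + 1)) (w : {w : V // w ≠ v}), M i.succ.castSucc w = D i w
  sector : (G.neighborSet v).ncard = 5 → ∃ ε : ℝ, 0 < ε ∧
    (∀ i : Fin (k + 1), InSector G p v u ε (M i.succ.castSucc)) ∧
    ∀ i : Fin k, ∀ t ∈ Set.Icc (0 : ℝ) 1, InSector G p v u ε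
      (linearMorph (M i.castSucc.succ.castSucc) (M i.succ.succ.castSucc) t)

/-! ## A real RAM -/

namespace RealRAM

/-- The machine has registers and random access memory for natural numbers (used as indices) and
for real numbers. A program mentions only finitely many registers. -/
structure State where
  nreg : ℕ → ℕ
  rreg : ℕ → ℝ
  nmem : ℕ → ℕ
  rmem : ℕ → ℝ

/-- Instructions; `d` is the destination register. The arithmetic of natural numbers consists of
addition and (truncated) subtraction, that of real numbers of the four field operations. There is
no conversion of real numbers into natural numbers. -/
inductive Instr where
  | natConst (d c : ℕ)
  | natAdd (d x y : ℕ)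
  | natSub (d x y : ℕ)
  | natLoad (d x : ℕ)
  | natStore (x y : ℕ)
  | realConst (d : ℕ) (c : ℤ)
  | realAdd (d x y : ℕ)
  | realSub (d x y : ℕ)
  | realMul (d x y : ℕ)
  | realDiv (d x y : ℕ)
  | realLoad (d x : ℕ)
  | realStore (x y : ℕ)

/-- Division by zero is illegal: it gets the machine stuck. -/
def Instr.Legal (s : State) : Instr → Prop
  | .realDiv _ _ y => s.rreg y ≠ 0
  | _ => True

/-- The effect of an instruction. Loads read the memory cell whose address is in the natural
number register `x`; stores write the contents of register `y` to that cell. -/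
noncomputable def Instr.run (s : State) : Instr → State
  | .natConst d c => { s with nreg := Function.update s.nreg d c }
  | .natAdd d x y => { s with nreg := Function.update s.nreg d (s.nreg x + s.nreg y) }
  | .natSub d x y => { s with nreg := Function.update s.nreg d (s.nreg x - s.nreg y) }
  | .natLoad d x => { s with nreg := Function.update s.nreg d (s.nmem (s.nreg x)) }
  | .natStore x y => { s with nmem := Function.update s.nmem (s.nreg x) (s.nreg y) }
  | .realConst d c => { s with rreg := Function.update s.rreg d (c : ℝ) }
  | .realAdd d x y => { s with rreg := Function.update s.rreg d (s.rreg x + s.rreg y) }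
  | .realSub d x y => { s with rreg := Function.update s.rreg d (s.rreg x - s.rreg y) }
  | .realMul d x y => { s with rreg := Function.update s.rreg d (s.rreg x * s.rreg y) }
  | .realDiv d x y => { s with rreg := Function.update s.rreg d (s.rreg x / s.rreg y) }
  | .realLoad d x => { s with rreg := Function.update s.rreg d (s.rmem (s.nreg x)) }
  | .realStore x y => { s with rmem := Function.update s.rmem (s.nreg x) (s.rreg y) }

/-- Tests compare two registers. -/
inductive Test where
  | natLt (x y : ℕ)
  | realLt (x y : ℕ)

/-- The truth of a test in a state. -/
def Test.Holds (s : State) : Test → Prop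
  | .natLt x y => s.nreg x < s.nreg y
  | .realLt x y => s.rreg x < s.rreg y

/-- Programs, with structured control flow. -/
inductive Prog where
  | skip
  | instr (i : Instr)
  | seq (P Q : Prog)
  | ite (b : Test) (P Q : Prog)
  | loop (b : Test) (P : Prog)

/-- `Exec P s s' t`: the program `P`, started in state `s`, halts in state `s'` after `t` steps.
Each instruction and each evaluation of a test takes one step. -/
inductive Exec : Prog → State → State → ℕ → Prop where
  | skip (s : State) : Exec .skip s s 0
  | instr (i : Instr) (s : State) (h : i.Legal s) : Exec (.instr i) s (i.run s) 1
  | seq {P Q : Prog} {s s' s'' : State} {t t' : ℕ} (hP : Exec P s s' t) (hQ : Exec Q s' s'' t') :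
      Exec (.seq P Q) s s'' (t + t')
  | ite_true {b : Test} {P Q : Prog} {s s' : State} {t : ℕ} (hb : b.Holds s)
      (hP : Exec P s s' t) : Exec (.ite b P Q) s s' (t + 1)
  | ite_false {b : Test} {P Q : Prog} {s s' : State} {t : ℕ} (hb : ¬ b.Holds s)
      (hQ : Exec Q s s' t) : Exec (.ite b P Q) s s' (t + 1)
  | loop_false {b : Test} {P : Prog} {s : State} (hb : ¬ b.Holds s) : Exec (.loop b P) s s 1
  | loop_true {b : Test} {P : Prog} {s s' s'' : State} {t t' : ℕ} (hb : b.Holds s)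
      (hP : Exec P s s' t) (hL : Exec (.loop b P) s' s'' t') :
      Exec (.loop b P) s s'' (t + t' + 1)

/-- The point `z` is stored as vertex `w` of drawing number `j`. The drawings, each consisting of
`n` points given by their two coordinates, are stored one after the other in the real memory. -/
def StoresPoint (s : State) (n j w : ℕ) (z : ℂ) : Prop :=
  s.rmem (2 * (n * j + w)) = z.re ∧ s.rmem (2 * (n * j + w) + 1) = z.im

/-- The natural number memory holds `n` and adjacency lists of the graph `G`, in any order: cell
`4 + 2 * w` has the address of the list of the neighbors of `w`, cell `5 + 2 * w` its length. -/
def StoresGraph (s : State) {n : ℕ} (G : SimpleGraph (Fin n)) : Prop :=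
  s.nmem 0 = n ∧ ∀ w : Fin n, ∃ L : List (Fin n), L.Nodup ∧ (∀ x, x ∈ L ↔ G.Adj w x) ∧
    s.nmem (5 + 2 * (w : ℕ)) = L.length ∧
    ∀ j : Fin L.length, s.nmem (s.nmem (4 + 2 * (w : ℕ)) + (j : ℕ)) = ((L.get j : Fin n) : ℕ)

/-- The input: the graph, `k`, `v` and `u`, the drawings `D 0, …, D k` of the contracted graph in
the places `1, …, k + 1`, and the initial and final position of `v`. Nothing is known about the
other memory cells and the registers. -/
structure IsInput {n : ℕ} (G : SimpleGraph (Fin n)) (p q : Fin n → ℂ) (v u : Fin n) {k : ℕ}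
    (D : Fin (k + 1) → {w : Fin n // w ≠ v} → ℂ) (s : State) : Prop where
  graph : StoresGraph s G
  steps : s.nmem 1 = k
  vertex : s.nmem 2 = (v : ℕ)
  target : s.nmem 3 = (u : ℕ)
  drawings : ∀ (i : Fin (k + 1)) (w : {w : Fin n // w ≠ v}),
    StoresPoint s n ((i : ℕ) + 1) ((w : Fin n) : ℕ) (D i w)
  initial_position : StoresPoint s n 0 (v : ℕ) (p v)
  final_position : StoresPoint s n (k + 2) (v : ℕ) (q v)

/-- The output: the drawings `M 0, …, M (k + 2)` in the places `0, …, k + 2`. -/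
def IsOutput {n k : ℕ} (M : Fin (k + 2 + 1) → Fin n → ℂ) (s : State) : Prop :=
  ∀ (j : Fin (k + 2 + 1)) (w : Fin n), StoresPoint s n (j : ℕ) (w : ℕ) (M j w)

end RealRAM

/-! The vertex `v` is kept so close to `u` that only the two link edges at `u` matter. Let σ map
each neighbor of `v` to the next one counterclockwise. If neither `x` nor `σ x` is `u`, then `u, x,
σ x` form a triangle of the contracted graph. It is positively oriented at first because `u` lies in
the kernel, and planarity preserves this throughout (`orient_pos_of_pseudomorph`). With `a = σ u`
and `σ b = u`, a nearby `v` therefore sees the link correctly as soon as `r = v - u` is left of `a -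
u` and right of `b - u`: an open cone, invariant under positive scaling.

In one unidirectional step, `r` has to be moved parallel to the common direction into the next cone.
This is a system of two linear inequalities in one unknown, and it is solvable because the edges
from `u` to `a` and to `b` never overlap (`nextPosition_spec`). Determinants of vectors that move
parallel to one line are affine in time (`cross_affine`), so conditions at the two ends of a step
hold during the step (`IsClose.of_linearMorph`). The vectors `r i` are computed without regard to
their size. A single factor `1 / B ^ 3` then shrinks them all, where `B` bounds their norms, the
link edge lengths and the inverse areas over all drawings. In the first and last step only `v`
moves, and the conditions on its position are convex. Topological equivalence makes σ the successor
in the second triangulation too.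

Positive orientation of the triangles `v, x, σ x` does not by itself give planarity: the link might
wind several times, or other parts of the drawing might lie inside it. For degree at most five, any
two neighbors are at most two steps apart on the link, so two of them can never be seen in the same
direction. Connectedness of the time interval then keeps the link star-shaped around `v`, and keeps
the rest of the drawing outside, since nothing can cross a link edge in a planar drawing of the
contracted graph (`isLinkDrawing_of_continuous`). These invariants imply planarity
(`IsLinkDrawing.isPlanarDrawing`).

The algorithm makes two passes. The first computes the `r i` and accumulates `B`, with the memory
slots of `v` as storage; the second replaces each `r i` by `u + r i / B ^ 3`. Its neighbors `a` and
`b` are found by searching the at most five neighbors in the first drawing. Correctness and running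
time are proved for a small structured language that compiles to the machine (`achieves_program`).
-/

/-- Twice the signed area of the triangle `p q r`. -/
def orient (p q r : ℂ) : ℝ := cross (q - p) (r - p)

/-! ### Determinants, orientations and triangles. -/

theorem orient_rotate (p q r : ℂ) : orient q r p = orient p q r := by
  simp [orient, cross]; ring

theorem orient_swap (p q r : ℂ) : orient p r q = -orient p q r := by
  simp [orient, cross]; ring

theorem cross_swap (a b : ℂ) : cross b a = -cross a b := by
  simp [cross]; ring

theorem continuous_cross {X : Type*} [TopologicalSpace X] {f g : X → ℂ} (hf : Continuous f)
    (hg : Continuous g) : Continuous fun x => cross (f x) (g x) := by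
  unfold cross
  have h1 := Complex.continuous_re.comp hf
  have h2 := Complex.continuous_im.comp hf
  have h3 := Complex.continuous_re.comp hg
  have h4 := Complex.continuous_im.comp hg
  exact (h1.mul h4).sub (h2.mul h3)

theorem continuous_orient {X : Type*} [TopologicalSpace X] {f g h : X → ℂ} (hf : Continuous f)
    (hg : Continuous g) (hh : Continuous h) : Continuous fun x => orient (f x) (g x) (h x) :=
  continuous_cross (hg.sub hf) (hh.sub hf)

theorem cross_smul_left (c : ℝ) (a b : ℂ) : cross (c • a) b = c * cross a b := by
  simp [cross]; ring

theorem cross_smul_right (c : ℝ) (a b : ℂ) : cross a (c • b) = c * cross a b := by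
  simp [cross]; ring

theorem cross_self_eq (a : ℂ) : cross a a = 0 := by simp [cross]; ring

theorem exists_smul_of_cross_eq_zero {a b : ℂ} (ha : a ≠ 0) (h : cross a b = 0) :
    ∃ c : ℝ, b = c • a := by
  have hn : a.re * a.re + a.im * a.im ≠ 0 := by
    intro h0
    apply ha
    apply Complex.ext
    · simp; nlinarith [mul_self_nonneg a.re, mul_self_nonneg a.im]
    · simp; nlinarith [mul_self_nonneg a.re, mul_self_nonneg a.im]
  unfold cross at h
  refine ⟨(a.re * b.re + a.im * b.im) / (a.re * a.re + a.im * a.im), ?_⟩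
  apply Complex.ext
  · rw [Complex.smul_re, smul_eq_mul, div_mul_eq_mul_div, eq_div_iff hn]; linear_combination -a.im * h
  · rw [Complex.smul_im, smul_eq_mul, div_mul_eq_mul_div, eq_div_iff hn]; linear_combination a.re * h

/-- The Grassmann–Plücker relation. -/
theorem cross_plucker (a b c d : ℂ) :
    cross a b * cross c d - cross a c * cross b d + cross a d * cross b c = 0 := by
  unfold cross; ring

theorem abs_cross_le (a b : ℂ) : |cross a b| ≤ ‖a‖ * ‖b‖ := by
  apply abs_le_of_sq_le_sq _ (by positivity)
  have h1 : ‖a‖ ^ 2 = a.re ^ 2 + a.im ^ 2 := by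
    rw [← Complex.normSq_eq_norm_sq, Complex.normSq_apply]; ring
  have h2 : ‖b‖ ^ 2 = b.re ^ 2 + b.im ^ 2 := by
    rw [← Complex.normSq_eq_norm_sq, Complex.normSq_apply]; ring
  rw [mul_pow, h1, h2]; unfold cross
  -- The difference of the two sides is the square of the scalar product.
  nlinarith [sq_nonneg (a.re * b.re + a.im * b.im)]

theorem sub_smul_mem_segment {p q : ℂ} {c : ℝ} (h0 : 0 ≤ c) (h1 : c ≤ 1) {z : ℂ}
    (h : z - p = c • (q - p)) : z ∈ segment ℝ p q := by
  rw [segment_eq_image']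
  exact ⟨c, ⟨h0, h1⟩, by simp only; rw [← h]; ring⟩

theorem sub_smul_mem_openSegment {p q : ℂ} {c : ℝ} (h0 : 0 < c) (h1 : c < 1) {z : ℂ}
    (h : z - p = c • (q - p)) : z ∈ openSegment ℝ p q := by
  rw [openSegment_eq_image']
  exact ⟨c, ⟨h0, h1⟩, by simp only; rw [← h]; ring⟩

theorem exists_of_mem_segment {p q z : ℂ} (h : z ∈ segment ℝ p q) :
    ∃ c : ℝ, 0 ≤ c ∧ c ≤ 1 ∧ z - p = c • (q - p) := by
  rw [segment_eq_image'] at h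
  obtain ⟨c, ⟨h0, h1⟩, rfl⟩ := h
  exact ⟨c, h0, h1, by simp⟩

theorem exists_of_mem_openSegment {p q z : ℂ} (h : z ∈ openSegment ℝ p q) :
    ∃ c : ℝ, 0 < c ∧ c < 1 ∧ z - p = c • (q - p) := by
  rw [openSegment_eq_image'] at h
  obtain ⟨c, ⟨h0, h1⟩, rfl⟩ := h
  exact ⟨c, h0, h1, by simp⟩

/-- A point on the boundary line `q r` that sees the sides at `p` correctly lies on `q r`. -/
theorem mem_segment_of_orient_eq_zero {p q r z : ℂ} (h : 0 < orient p q r)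
    (h1 : 0 ≤ orient p q z) (h2 : 0 ≤ orient p z r) (h3 : orient q r z = 0) :
    z ∈ segment ℝ q r := by
  have hne : r - q ≠ 0 := by
    intro h0
    have : r = q := sub_eq_zero.1 h0
    subst this
    simp [orient, cross] at h
    linarith
  obtain ⟨c, hc⟩ := exists_smul_of_cross_eq_zero hne h3
  have hz : z = q + c • (r - q) := by rw [← hc]; ring
  have e1 : orient p q z = c * orient p q r := by
    rw [hz]; simp [orient, cross]; ring
  have e2 : orient p z r = (1 - c) * orient p q r := by
    rw [hz]; simp [orient, cross]; ring
  rw [e1] at h1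
  rw [e2] at h2
  refine sub_smul_mem_segment ?_ ?_ hc
  · exact nonneg_of_mul_nonneg_left h1 h
  · linarith [nonneg_of_mul_nonneg_left h2 h]

/-- The three determinants, divided by `orient p q r`, are the barycentric coordinates of `z`. -/
theorem mem_convexHull_triple_iff {p q r z : ℂ} (h : 0 < orient p q r) :
    z ∈ convexHull ℝ {p, q, r} ↔
      0 ≤ orient p q z ∧ 0 ≤ orient p z r ∧ 0 ≤ orient q r z := by
  constructor
  · intro hz
    have hc : Convex ℝ {z | 0 ≤ orient p q z ∧ 0 ≤ orient p z r ∧ 0 ≤ orient q r z} := by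
      intro z hz w hw a b ha hb hab
      obtain rfl : b = 1 - a := by linarith
      obtain ⟨h1, h2, h3⟩ := hz
      obtain ⟨k1, k2, k3⟩ := hw
      refine ⟨?_, ?_, ?_⟩
      · have : orient p q (a • z + (1 - a) • w) = a * orient p q z + (1 - a) * orient p q w := by
          simp [orient, cross]; ring
        rw [this]; positivity
      · have : orient p (a • z + (1 - a) • w) r = a * orient p z r + (1 - a) * orient p w r := by
          simp [orient, cross]; ring
        rw [this]; positivity
      · have : orient q r (a • z + (1 - a) • w) = a * orient q r z + (1 - a) * orient q r w := by
          simp [orient, cross]; ring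
        rw [this]; positivity
    refine convexHull_min ?_ hc hz
    have hh := h
    unfold orient cross at hh
    simp only [Complex.sub_re, Complex.sub_im] at hh
    intro w hw
    simp only [Set.mem_insert_iff, Set.mem_singleton_iff] at hw
    rcases hw with rfl | rfl | rfl <;>
      (simp only [Set.mem_ofPred_eq, orient, cross, Complex.sub_re, Complex.sub_im]
       refine ⟨?_, ?_, ?_⟩ <;> linarith)
  · rintro ⟨h1, h2, h3⟩
    have hsum : orient p q z + orient p z r + orient q r z = orient p q r := by
      simp [orient, cross]; ring
    rw [convexHull_insert (by simp), convexHull_pair]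
    have hz : z = (orient q r z / orient p q r) • p + (orient p z r / orient p q r) • q +
        (orient p q z / orient p q r) • r := by
      have hne := h.ne'
      apply Complex.ext
      · simp only [Complex.add_re, Complex.smul_re, smul_eq_mul]
        field_simp
        simp [orient, cross]; ring
      · simp only [Complex.add_im, Complex.smul_im, smul_eq_mul]
        field_simp
        simp [orient, cross]; ring
    have : z ∈ convexHull ℝ ({p, q, r} : Set ℂ) := by
      have hcv := convex_convexHull ℝ ({p, q, r} : Set ℂ)
      rw [hz]
      have hp : p ∈ convexHull ℝ ({p, q, r} : Set ℂ) := subset_convexHull _ _ (by simp)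
      have hq : q ∈ convexHull ℝ ({p, q, r} : Set ℂ) := subset_convexHull _ _ (by simp)
      have hr : r ∈ convexHull ℝ ({p, q, r} : Set ℂ) := subset_convexHull _ _ (by simp)
      have := hcv.sum_mem (t := (Finset.univ : Finset (Fin 3)))
        (w := ![orient q r z / orient p q r, orient p z r / orient p q r,
          orient p q z / orient p q r]) (z := ![p, q, r])
        (by intro i _; fin_cases i <;> simp <;> positivity)
        (by simp [Fin.sum_univ_three]; field_simp; linarith)
        (by intro i _; fin_cases i <;> simpa)
      simpa [Fin.sum_univ_three] using this
    rwa [convexHull_insert (by simp), convexHull_pair] at this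

/-- From an interior point one can move a little in any direction and stay in the triangle; a
suitable direction lowers the chosen determinant by a positive amount, so it was positive before. -/
theorem mem_interior_triple_iff {p q r z : ℂ} (h : 0 < orient p q r) :
    z ∈ interior (convexHull ℝ {p, q, r}) ↔
      0 < orient p q z ∧ 0 < orient p z r ∧ 0 < orient q r z := by
  constructor
  · intro hz
    have key : ∀ d : ℂ, ∃ τ > (0 : ℝ), z + τ • d ∈ convexHull ℝ ({p, q, r} : Set ℂ) := by
      intro d
      have hcont : Continuous fun τ : ℝ => z + τ • d := by fun_prop
      have hev : ∀ᶠ τ : ℝ in nhds 0, z + τ • d ∈ interior (convexHull ℝ ({p, q, r} : Set ℂ)) := by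
        apply hcont.continuousAt.eventually_mem
        simpa using isOpen_interior.mem_nhds hz
      obtain ⟨ε, hε, hb⟩ := Metric.eventually_nhds_iff.1 hev
      refine ⟨ε / 2, by positivity, interior_subset (hb ?_)⟩
      simp [abs_of_pos hε]; linarith
    refine ⟨?_, ?_, ?_⟩
    · obtain ⟨τ, hτ, hm⟩ := key (p - r)
      have := ((mem_convexHull_triple_iff h).1 hm).1
      have e : orient p q (z + τ • (p - r)) = orient p q z - τ * orient p q r := by
        simp [orient, cross]; ring
      have := mul_pos hτ h
      linarith
    · obtain ⟨τ, hτ, hm⟩ := key (p - q)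
      have := ((mem_convexHull_triple_iff h).1 hm).2.1
      have e : orient p (z + τ • (p - q)) r = orient p z r - τ * orient p q r := by
        simp [orient, cross]; ring
      have := mul_pos hτ h
      linarith
    · obtain ⟨τ, hτ, hm⟩ := key (q - p)
      have := ((mem_convexHull_triple_iff h).1 hm).2.2
      have e : orient q r (z + τ • (q - p)) = orient q r z - τ * orient p q r := by
        simp [orient, cross]; ring
      have := mul_pos hτ h
      linarith
  · intro hz
    have ho : IsOpen {z | 0 < orient p q z ∧ 0 < orient p z r ∧ 0 < orient q r z} := by
      have c1 : Continuous fun z => orient p q z :=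
        continuous_orient continuous_const continuous_const continuous_id
      have c2 : Continuous fun z => orient p z r :=
        continuous_orient continuous_const continuous_id continuous_const
      have c3 : Continuous fun z => orient q r z :=
        continuous_orient continuous_const continuous_const continuous_id
      exact (isOpen_lt continuous_const c1).inter
        ((isOpen_lt continuous_const c2).inter (isOpen_lt continuous_const c3))
    refine interior_maximal (fun w hw => ?_) ho hz
    exact (mem_convexHull_triple_iff h).2 ⟨hw.1.le, hw.2.1.le, hw.2.2.le⟩

theorem convexHull_triple_swap (p q r : ℂ) :
    convexHull ℝ ({p, q, r} : Set ℂ) = convexHull ℝ {p, r, q} := by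
  rw [Set.pair_comm]

theorem convexHull_triple_rotate (p q r : ℂ) :
    convexHull ℝ ({p, q, r} : Set ℂ) = convexHull ℝ {q, r, p} := by
  rw [Set.insert_comm, Set.pair_comm p r]

/-- A point of a triangle that is not in its interior lies on one of its sides. -/
theorem mem_segment_of_mem_triple {p q r z : ℂ} (h : 0 < orient p q r)
    (hz : z ∈ convexHull ℝ {p, q, r}) (hi : z ∉ interior (convexHull ℝ {p, q, r})) :
    z ∈ segment ℝ p q ∨ z ∈ segment ℝ p r ∨ z ∈ segment ℝ q r := by
  obtain ⟨h1, h2, h3⟩ := (mem_convexHull_triple_iff h).1 hz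
  rw [mem_interior_triple_iff h] at hi
  have r1 := orient_rotate p q r
  have r2 := orient_rotate q r p
  by_cases k3 : orient q r z = 0
  · exact Or.inr (Or.inr (mem_segment_of_orient_eq_zero h h1 h2 k3))
  by_cases k2 : orient p z r = 0
  · refine Or.inr (Or.inl ?_)
    rw [segment_symm]
    refine mem_segment_of_orient_eq_zero (p := q) (by rw [r1]; exact h) h3 ?_ ?_
    · rw [orient_rotate]; exact h1
    · rw [← orient_rotate]; exact k2
  by_cases k1 : orient p q z = 0
  · left
    refine mem_segment_of_orient_eq_zero (p := r) (by rw [← r1, ← r2] at h; exact h) ?_ ?_ k1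
    · rw [← orient_rotate]; exact h2
    · rw [orient_rotate]; exact h3
  exfalso
  exact hi ⟨h1.lt_of_ne' k1, h2.lt_of_ne' k2, h3.lt_of_ne' k3⟩

/-! ### Consequences of planarity around one vertex. -/

section Planar

variable {V : Type*} {G : SimpleGraph V} {p : V → ℂ}

/-- Of two edges in the same direction, the shorter one would end on the longer one. -/
theorem IsPlanarDrawing.sub_ne_smul_sub (h : IsPlanarDrawing G p) {v x y : V} (hx : G.Adj v x)
    (hy : G.Adj v y) (hxy : x ≠ y) {c : ℝ} (hc : 0 < c) : p y - p v ≠ c • (p x - p v) := by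
  intro he
  rcases le_total c 1 with h1 | h1
  · exact h.vertex_edge v x y hx hy.ne' hxy.symm (sub_smul_mem_segment hc.le h1 he)
  · refine h.vertex_edge v y x hy hx.ne' hxy
      (sub_smul_mem_segment (c := c⁻¹) (by positivity) (inv_le_one_of_one_le₀ h1) ?_)
    rw [he, smul_smul, inv_mul_cancel₀ hc.ne', one_smul]

/-- On a line, one of the three vertices would see the other two in the same direction. -/
theorem IsPlanarDrawing.orient_ne_zero (h : IsPlanarDrawing G p) {x y w : V} (hxy : G.Adj x y)
    (hyw : G.Adj y w) (hwx : G.Adj w x) : orient (p x) (p y) (p w) ≠ 0 := by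
  intro h0
  have hne : p y - p x ≠ 0 := sub_ne_zero.2 fun he => hxy.ne' (h.injective he)
  obtain ⟨c, hc⟩ := exists_smul_of_cross_eq_zero hne h0
  rcases lt_trichotomy c 0 with h1 | h1 | h1
  · refine h.sub_ne_smul_sub hxy.symm hyw hwx.ne' (c := 1 - c) (by linarith) ?_
    have : p w = p x + c • (p y - p x) := by rw [← hc]; ring
    rw [this]
    apply Complex.ext <;> simp <;> ring
  · rw [h1, zero_smul, sub_eq_zero] at hc
    exact hwx.ne (h.injective hc)
  · exact h.sub_ne_smul_sub hxy hwx.symm hyw.ne h1 hc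

/-- The triangle `v x y` is a bounded face, with its vertices in counterclockwise order. -/
def IsCcwFace (G : SimpleGraph V) (p : V → ℂ) (v x y : V) : Prop :=
  IsFaceTriangle G p v x y ∧ 0 < orient (p v) (p x) (p y)

theorem mem_drawingSet_of_mem_segment {x y : V} (h : G.Adj x y) {z : ℂ}
    (hz : z ∈ segment ℝ (p x) (p y)) : z ∈ drawingSet G p :=
  Or.inr ⟨x, y, h, hz⟩

theorem IsFaceTriangle.swap {v x y : V} (h : IsFaceTriangle G p v x y) :
    IsFaceTriangle G p v y x := by
  obtain ⟨h1, h2, h3, h4⟩ := h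
  exact ⟨h3.symm, h2.symm, h1.symm, by rwa [convexHull_triple_swap]⟩

theorem IsFaceTriangle.ccw_or (h : IsPlanarDrawing G p) {v x y : V}
    (hf : IsFaceTriangle G p v x y) : IsCcwFace G p v x y ∨ IsCcwFace G p v y x := by
  rcases (h.orient_ne_zero hf.1 hf.2.1 hf.2.2.1).lt_or_gt with h1 | h1
  · right
    refine ⟨hf.swap, ?_⟩
    rw [orient_swap]; linarith
  · exact Or.inl ⟨hf, h1⟩

theorem exists_pos_add_mul {A : ℝ} (hA : 0 < A) (E : ℝ) : ∃ τ : ℝ, 0 < τ ∧ τ ≤ 1 ∧ 0 < A + τ * E := by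
  have h0 : 0 ≤ |E| := abs_nonneg E
  refine ⟨A / (A + |E|), by positivity, (div_le_one (by positivity)).2 (by linarith), ?_⟩
  have h1 := neg_abs_le E
  have : A + A / (A + |E|) * E = A * (A + |E| + E) / (A + |E|) := by field_simp
  rw [this]
  have : 0 < A + |E| + E := by linarith
  positivity

/-- A short initial piece of the edge `v z` would lie in the interior of the face. -/
theorem IsCcwFace.not_mem_wedge {v x y : V} (hf : IsCcwFace G p v x y) {z : V} (hz : G.Adj v z)
    (h1 : 0 < orient (p v) (p x) (p z)) (h2 : 0 < orient (p v) (p z) (p y)) : False := by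
  obtain ⟨τ, h0, hle, hpos⟩ := exists_pos_add_mul hf.2
    (orient (p x) (p y) (p z) - orient (p v) (p x) (p y))
  have hd := hf.1.2.2.2
  have hint : p v + τ • (p z - p v) ∈ interior (convexHull ℝ {p v, p x, p y}) := by
    rw [mem_interior_triple_iff hf.2]
    refine ⟨?_, ?_, ?_⟩
    · have : orient (p v) (p x) (p v + τ • (p z - p v)) = τ * orient (p v) (p x) (p z) := by
        simp [orient, cross]; ring
      rw [this]; positivity
    · have : orient (p v) (p v + τ • (p z - p v)) (p y) = τ * orient (p v) (p z) (p y) := by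
        simp [orient, cross]; ring
      rw [this]; positivity
    · have : orient (p x) (p y) (p v + τ • (p z - p v)) = orient (p v) (p x) (p y) +
          τ * (orient (p x) (p y) (p z) - orient (p v) (p x) (p y)) := by
        simp [orient, cross]; ring
      rwa [this]
  exact Set.disjoint_left.1 hd hint
    (mem_drawingSet_of_mem_segment hz (sub_smul_mem_segment h0.le hle (by simp)))

theorem IsPlanarDrawing.eq_of_orient_eq_zero (h : IsPlanarDrawing G p) {v x y z : V}
    (hx : G.Adj v x) (hz : G.Adj v z) (h0 : 0 < orient (p v) (p x) (p y))
    (h1 : orient (p v) (p x) (p z) = 0) (h2 : 0 ≤ orient (p v) (p z) (p y)) : z = x := by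
  by_contra hzx
  have hne : p x - p v ≠ 0 := sub_ne_zero.2 fun he => hx.ne' (h.injective he)
  obtain ⟨c, hc⟩ := exists_smul_of_cross_eq_zero hne h1
  have hc0 : c ≠ 0 := by
    rintro rfl
    rw [zero_smul, sub_eq_zero] at hc
    exact hz.ne' (h.injective hc)
  have e : orient (p v) (p z) (p y) = c * orient (p v) (p x) (p y) := by
    unfold orient; rw [hc, cross_smul_left]
  rw [e] at h2
  exact h.sub_ne_smul_sub hx hz (Ne.symm hzx) ((nonneg_of_mul_nonneg_left h2 h0).lt_of_ne' hc0) hc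

theorem IsPlanarDrawing.eq_of_orient_eq_zero' (h : IsPlanarDrawing G p) {v x y z : V}
    (hy : G.Adj v y) (hz : G.Adj v z) (h0 : 0 < orient (p v) (p x) (p y))
    (h1 : 0 ≤ orient (p v) (p x) (p z)) (h2 : orient (p v) (p z) (p y) = 0) : z = y := by
  by_contra hzy
  have hne : p y - p v ≠ 0 := sub_ne_zero.2 fun he => hy.ne' (h.injective he)
  have h2' : cross (p y - p v) (p z - p v) = 0 := by
    rw [cross_swap]; exact neg_eq_zero.2 h2
  obtain ⟨c, hc⟩ := exists_smul_of_cross_eq_zero hne h2'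
  have hc0 : c ≠ 0 := by
    rintro rfl
    rw [zero_smul, sub_eq_zero] at hc
    exact hz.ne' (h.injective hc)
  have e : orient (p v) (p x) (p z) = c * orient (p v) (p x) (p y) := by
    unfold orient; rw [hc, cross_smul_right]
  rw [e] at h1
  exact h.sub_ne_smul_sub hy hz (Ne.symm hzy) ((nonneg_of_mul_nonneg_left h1 h0).lt_of_ne' hc0) hc

/-- Emptiness of the face excludes the open wedge, and planarity excludes a further neighbor on its
boundary rays. This is what makes the ends of a face consecutive neighbors of `v`. -/
theorem IsCcwFace.eq_or_eq (h : IsPlanarDrawing G p) {v x y z : V} (hf : IsCcwFace G p v x y)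
    (hz : G.Adj v z) (h1 : 0 ≤ orient (p v) (p x) (p z)) (h2 : 0 ≤ orient (p v) (p z) (p y)) :
    z = x ∨ z = y := by
  rcases h1.eq_or_lt with k1 | k1
  · exact Or.inl (h.eq_of_orient_eq_zero hf.1.1 hz hf.2 k1.symm h2)
  rcases h2.eq_or_lt with k2 | k2
  · exact Or.inr (h.eq_of_orient_eq_zero' hf.1.2.2.1.symm hz hf.2 h1 k2.symm)
  exact (hf.not_mem_wedge hz k1 k2).elim

/-- Of two candidates, one lies in the closed wedge belonging to the other. -/
theorem IsCcwFace.right_unique (h : IsPlanarDrawing G p) {v x y y' : V} (hf : IsCcwFace G p v x y)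
    (hf' : IsCcwFace G p v x y') : y = y' := by
  rcases le_total 0 (orient (p v) (p y) (p y')) with h1 | h1
  · rcases hf'.eq_or_eq h hf.1.2.2.1.symm hf.2.le h1 with h2 | h2
    · exact (hf.1.2.1.ne h2.symm).elim
    · exact h2
  · rw [← neg_nonneg, ← orient_swap] at h1
    rcases hf.eq_or_eq h hf'.1.2.2.1.symm hf'.2.le h1 with h2 | h2
    · exact (hf'.1.2.1.ne h2.symm).elim
    · exact h2.symm

theorem IsCcwFace.left_unique (h : IsPlanarDrawing G p) {v x x' y : V} (hf : IsCcwFace G p v x y)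
    (hf' : IsCcwFace G p v x' y) : x = x' := by
  rcases le_total 0 (orient (p v) (p x) (p x')) with h1 | h1
  · rcases hf.eq_or_eq h hf'.1.1 h1 hf'.2.le with h2 | h2
    · exact h2.symm
    · exact (hf'.1.2.1.ne h2).elim
  · rw [← neg_nonneg, ← orient_swap] at h1
    rcases hf'.eq_or_eq h hf.1.1 h1 hf.2.le with h2 | h2
    · exact h2
    · exact (hf.1.2.1.ne h2).elim

theorem IsCcwFace.mem_segment {v x y : V} (hf : IsCcwFace G p v x y) {z : ℂ}
    (hz : z ∈ convexHull ℝ {p v, p x, p y}) (hd : z ∈ drawingSet G p) :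
    z ∈ segment ℝ (p v) (p x) ∨ z ∈ segment ℝ (p v) (p y) ∨ z ∈ segment ℝ (p x) (p y) :=
  mem_segment_of_mem_triple hf.2 hz fun hi => Set.disjoint_left.1 hf.1.2.2.2 hi hd

theorem IsFaceTriangle.mem_segment (h : IsPlanarDrawing G p) {v x y : V}
    (hf : IsFaceTriangle G p v x y) {z : ℂ}
    (hz : z ∈ convexHull ℝ {p v, p x, p y}) (hd : z ∈ drawingSet G p) :
    z ∈ segment ℝ (p v) (p x) ∨ z ∈ segment ℝ (p v) (p y) ∨ z ∈ segment ℝ (p x) (p y) := by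
  rcases hf.ccw_or h with h1 | h1
  · exact h1.mem_segment hz hd
  · rw [convexHull_triple_swap] at hz
    have := h1.mem_segment hz hd
    rw [segment_symm ℝ (p y)] at this
    tauto

theorem IsPlanarDrawing.eq_of_mem_segment (h : IsPlanarDrawing G p) {x y w : V} (hxy : G.Adj x y)
    (hw : p w ∈ segment ℝ (p x) (p y)) : w = x ∨ w = y := by
  by_contra hh
  rw [not_or] at hh
  exact h.vertex_edge x y w hxy hh.1 hh.2 hw

/-- An interior point of one edge lies on another edge only if the edges are equal. -/
theorem IsPlanarDrawing.eq_of_mem_openSegment (h : IsPlanarDrawing G p) {x y x' y' : V}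
    (hxy : G.Adj x y) (hxy' : G.Adj x' y') {z : ℂ} (hz : z ∈ openSegment ℝ (p x) (p y))
    (hz' : z ∈ segment ℝ (p x') (p y')) : s(x, y) = s(x', y') := by
  by_contra hne
  have hnv : ∀ w, G.Adj x y → z ≠ p w := by
    rintro w - rfl
    rcases h.eq_of_mem_segment hxy (openSegment_subset_segment _ _ _ hz) with rfl | rfl
    · exact hxy.ne (h.injective (left_mem_openSegment_iff.1 hz))
    · exact hxy.ne (h.injective (right_mem_openSegment_iff.1 hz))
  have := mem_openSegment_of_ne_left_right (hnv x' hxy).symm (hnv y' hxy).symm hz'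
  exact Set.disjoint_left.1 (h.edge_edge x y x' y' hxy hxy' hne) hz this

end Planar

/-! ### Existence of a face to the left of each edge at an internal vertex. -/

section Faces

variable {V : Type*} {G : SimpleGraph V} {p : V → ℂ}

theorem isClosed_segment_complex (x y : ℂ) : IsClosed (segment ℝ x y) := by
  rw [← convexHull_pair]
  exact (Set.toFinite _).isClosed_convexHull ℝ

/-- The part of the drawing that consists of the vertices and edges that avoid `v`. -/
def drawingWithout (G : SimpleGraph V) (p : V → ℂ) (v : V) : Set ℂ :=
  (⋃ (w : V) (_ : w ≠ v), {p w}) ∪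
    ⋃ (x : V) (y : V) (_ : G.Adj x y ∧ x ≠ v ∧ y ≠ v), segment ℝ (p x) (p y)

theorem isClosed_drawingWithout [Finite V] (v : V) : IsClosed (drawingWithout G p v) := by
  refine IsClosed.union ?_ ?_
  · exact isClosed_iUnion_of_finite fun w => isClosed_iUnion_of_finite fun _ => isClosed_singleton
  · exact isClosed_iUnion_of_finite fun x => isClosed_iUnion_of_finite fun y =>
      isClosed_iUnion_of_finite fun _ => isClosed_segment_complex _ _

theorem IsPlanarDrawing.not_mem_drawingWithout (h : IsPlanarDrawing G p) (v : V) :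
    p v ∉ drawingWithout G p v := by
  rintro (hm | hm)
  · simp only [Set.mem_iUnion, Set.mem_singleton_iff] at hm
    obtain ⟨w, hw, he⟩ := hm
    exact hw (h.injective he).symm
  · simp only [Set.mem_iUnion] at hm
    obtain ⟨x, y, ⟨hxy, hx, hy⟩, he⟩ := hm
    exact h.vertex_edge x y v hxy hx.symm hy.symm he

theorem mem_drawingSet_cases {z : ℂ} (v : V) (hz : z ∈ drawingSet G p) :
    z ∈ drawingWithout G p v ∨ z = p v ∨ ∃ y, G.Adj v y ∧ z ∈ segment ℝ (p v) (p y) := by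
  rcases hz with ⟨w, rfl⟩ | ⟨x, y, hxy, hz⟩
  · by_cases hw : w = v
    · subst hw; simp
    · left; left
      simp only [Set.mem_iUnion]
      exact ⟨w, hw, rfl⟩
  · by_cases hx : x = v
    · subst hx; exact Or.inr (Or.inr ⟨y, hxy, hz⟩)
    by_cases hy : y = v
    · subst hy
      rw [segment_symm] at hz
      exact Or.inr (Or.inr ⟨x, hxy.symm, hz⟩)
    left; right
    simp only [Set.mem_iUnion]
    exact ⟨x, y, ⟨hxy, hx, hy⟩, hz⟩

/-- There is a point in every neighborhood of `v` just to the left of the edge `v x`. -/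
theorem IsPlanarDrawing.exists_direction [Finite V] (h : IsPlanarDrawing G p) {v x : V}
    (hx : G.Adj v x) : ∃ w : ℂ, 0 < cross (p x - p v) w ∧
      ∀ y, G.Adj v y → 0 < orient (p v) (p x) (p y) → cross (p y - p v) w < 0 := by
  set e := p x - p v with he
  have hne : e ≠ 0 := sub_ne_zero.2 fun h0 => hx.ne' (h.injective h0)
  -- The direction is `e` turned slightly to the left. The condition for each of the finitely many
  -- neighbors strictly left of `v x` is open and holds at `η = 0`.
  have hev : ∀ᶠ η : ℝ in nhdsWithin 0 (Set.Ioi 0), ∀ y : V, 0 < orient (p v) (p x) (p y) →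
      cross (p y - p v) (e + η • (Complex.I * e)) < 0 := by
    rw [Filter.eventually_all]
    intro y
    by_cases hy : 0 < orient (p v) (p x) (p y)
    · have hcont : Continuous fun η : ℝ => cross (p y - p v) (e + η • (Complex.I * e)) :=
        continuous_cross continuous_const (by fun_prop)
      have h0 : cross (p y - p v) (e + (0 : ℝ) • (Complex.I * e)) < 0 := by
        rw [zero_smul, add_zero, cross_swap]; exact neg_lt_zero.2 hy
      have := hcont.continuousAt.eventually_lt continuousAt_const h0
      exact Filter.Eventually.filter_mono nhdsWithin_le_nhds (this.mono fun _ h _ => h)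
    · exact Filter.Eventually.of_forall fun _ h => absurd h hy
  obtain ⟨η, h1, h2⟩ := (hev.and self_mem_nhdsWithin).exists
  refine ⟨e + η • (Complex.I * e), ?_, fun y _ hy => h1 y hy⟩
  have : cross e (e + η • (Complex.I * e)) = η * (e.re * e.re + e.im * e.im) := by
    simp [cross]; ring
  rw [this]
  have hn : 0 < e.re * e.re + e.im * e.im := by
    rw [← Complex.normSq_apply]; exact Complex.normSq_pos.2 hne
  exact mul_pos h2 hn

theorem unbounded_compl_triangle (a b c : ℂ) :
    ¬ Bornology.IsBounded (convexHull ℝ ({a, b, c} : Set ℂ))ᶜ := by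
  intro hb
  have h1 : Bornology.IsBounded (convexHull ℝ ({a, b, c} : Set ℂ)) :=
    (Set.toFinite _).isCompact_convexHull ℝ |>.isBounded
  have := h1.union hb
  rw [Set.union_compl_self] at this
  exact NormedSpace.unbounded_univ ℝ ℂ this

/-- The direction `w` lies in the wedge of the face and just to the left of `x`. If `b` were not
`x`, then `x` would be strictly between `b` and `w`, hence inside the wedge, by the Plücker
relation. -/
theorem eq_of_wedge {v x b g : V} {w : ℂ} (h : IsPlanarDrawing G p) (hx : G.Adj v x)
    (hf : IsCcwFace G p v b g) (hw : 0 < cross (p x - p v) w)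
    (hwy : ∀ y, G.Adj v y → 0 < orient (p v) (p x) (p y) → cross (p y - p v) w < 0)
    (h1 : 0 < cross (p b - p v) w) (h2 : 0 < cross w (p g - p v)) : b = x := by
  by_contra hbx
  have hb := hf.1.1
  have k1 : orient (p v) (p x) (p b) ≤ 0 := by
    by_contra hh
    exact absurd (hwy b hb (not_le.1 hh)) (not_lt.2 h1.le)
  have k2 : orient (p v) (p x) (p b) ≠ 0 := by
    intro h0
    have hne : p x - p v ≠ 0 := sub_ne_zero.2 fun h0 => hx.ne' (h.injective h0)
    obtain ⟨c, hc⟩ := exists_smul_of_cross_eq_zero hne h0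
    rw [hc, cross_smul_left] at h1
    exact h.sub_ne_smul_sub hx hb (Ne.symm hbx) (pos_of_mul_pos_left h1 hw.le) hc
  have k3 : 0 < orient (p v) (p b) (p x) := by
    rw [orient_swap]; exact neg_pos.2 (k1.lt_of_ne k2)
  refine hf.not_mem_wedge hx k3 ?_
  have hp := cross_plucker (p b - p v) (p x - p v) w (p g - p v)
  have h3 := hf.2
  unfold orient at k3 h3 ⊢
  have : cross (p b - p v) w * cross (p x - p v) (p g - p v) =
      cross (p b - p v) (p x - p v) * cross w (p g - p v) +
      cross (p b - p v) (p g - p v) * cross (p x - p v) w := by linarith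
  have : 0 < cross (p b - p v) w * cross (p x - p v) (p g - p v) := by rw [this]; positivity
  exact pos_of_mul_pos_right this h1.le

/-- Points close to `v` in a direction just to the left of `v x` form a segment that misses the
drawing, so they belong to one face. As `v` is internal, this face is the interior of a triangle;
`v` is a corner of it, and `eq_of_wedge` identifies the next corner as `x`. -/
theorem IsTriangulation.exists_ccwFace [Finite V] (hT : IsTriangulation G p) {v x : V}
    (hv : ¬ IsBoundaryVertex G p v) (hx : G.Adj v x) : ∃ y, IsCcwFace G p v x y := by
  have h := hT.planar
  obtain ⟨w, hw, hwy⟩ := h.exists_direction hx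
  have hcont : Continuous fun τ : ℝ => p v + τ • w := by fun_prop
  have hev : ∀ᶠ τ : ℝ in nhds 0, p v + τ • w ∈ (drawingWithout G p v)ᶜ := by
    apply hcont.continuousAt.eventually_mem
    rw [zero_smul, add_zero]
    exact (isClosed_drawingWithout v).isOpen_compl.mem_nhds (h.not_mem_drawingWithout v)
  obtain ⟨τ₁, hτ₁, hb⟩ := Metric.eventually_nhds_iff.1 hev
  have hnot : ∀ τ ∈ Set.Ioo (0 : ℝ) τ₁, p v + τ • w ∉ drawingSet G p := by
    rintro τ ⟨h0, h1⟩ hm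
    have hsp : ∀ y, G.Adj v y → p v + τ • w ∉ segment ℝ (p v) (p y) := by
      intro y hy hs
      obtain ⟨c, hc0, -, hc⟩ := exists_of_mem_segment hs
      rw [add_sub_cancel_left] at hc
      have e1 : τ * cross (p x - p v) w = c * orient (p v) (p x) (p y) := by
        rw [← cross_smul_right, hc, cross_smul_right]; rfl
      have hpos : 0 < c * orient (p v) (p x) (p y) := by rw [← e1]; positivity
      have := hwy y hy (pos_of_mul_pos_right hpos hc0)
      have e2 : τ * cross (p y - p v) w = 0 := by
        rw [← cross_smul_right, hc, cross_smul_right, cross_self_eq, mul_zero]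
      rcases mul_eq_zero.1 e2 with e3 | e3 <;> linarith
    rcases mem_drawingSet_cases v hm with h2 | h2 | ⟨y, hy, h2⟩
    · refine hb ?_ h2
      simpa [abs_of_pos h0] using h1
    · exact hsp x hx (by rw [h2]; exact left_mem_segment ℝ _ _)
    · exact hsp y hy h2
  set S : Set ℂ := (fun τ : ℝ => p v + τ • w) '' Set.Ioo 0 τ₁ with hS
  have hSc : IsPreconnected S := isPreconnected_Ioo.image _ hcont.continuousOn
  have hSd : S ⊆ (drawingSet G p)ᶜ := by
    rintro _ ⟨τ, hτ, rfl⟩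
    exact hnot τ hτ
  have hvS : p v ∈ closure S := by
    have h1 : (0 : ℝ) ∈ closure (Set.Ioo 0 τ₁) := by
      rw [closure_Ioo hτ₁.ne]; exact ⟨le_rfl, hτ₁.le⟩
    have := image_closure_subset_closure_image hcont ⟨0, h1, rfl⟩
    simpa only [zero_smul, add_zero] using this
  have hmid : τ₁ / 2 ∈ Set.Ioo 0 τ₁ := ⟨by linarith, by linarith⟩
  set z := p v + (τ₁ / 2) • w with hz
  have hzS : z ∈ S := ⟨τ₁ / 2, hmid, rfl⟩
  have hSF : S ⊆ faceOf G p z := hSc.subset_connectedComponentIn hzS hSd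
  have hFd : faceOf G p z ⊆ (drawingSet G p)ᶜ := connectedComponentIn_subset _ _
  obtain ⟨a, b, c, hab, hbc, hca, hF | hF⟩ := hT.faces z (hnot _ hmid)
  swap
  -- The exterior of a triangle is unbounded, and `p v` is in its closure, which would make `v` a
  -- boundary vertex.
  · exfalso
    apply hv
    refine closure_mono (fun y hy => ?_) hvS
    refine ⟨hSd hy, ?_⟩
    have : faceOf G p y = faceOf G p z := (connectedComponentIn_eq (hSF hy)).symm
    rw [this, hF]
    exact unbounded_compl_triangle _ _ _
  have hzF : z ∈ faceOf G p z := hSF hzS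
  have hvF : p v ∈ convexHull ℝ {p a, p b, p c} := by
    have h1 : p v ∈ closure (faceOf G p z) := closure_mono hSF hvS
    rw [hF] at h1
    have hcl : IsClosed (convexHull ℝ {p a, p b, p c}) := (Set.toFinite _).isClosed_convexHull ℝ
    exact closure_minimal interior_subset hcl h1
  have core : ∀ b g, G.Adj v b → G.Adj b g → G.Adj g v →
      faceOf G p z = interior (convexHull ℝ {p v, p b, p g}) → 0 < orient (p v) (p b) (p g) →
      ∃ y, IsCcwFace G p v x y := by
    intro b g h1 h2 h3 h4 h5
    have hf : IsCcwFace G p v b g := by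
      refine ⟨⟨h1, h2, h3, ?_⟩, h5⟩
      rw [← h4]
      exact Set.disjoint_left.2 fun y hy => hFd hy
    rw [h4, mem_interior_triple_iff h5] at hzF
    obtain ⟨k1, k2, -⟩ := hzF
    have h0 : 0 < τ₁ / 2 := hmid.1
    have e1 : orient (p v) (p b) z = τ₁ / 2 * cross (p b - p v) w := by
      rw [← cross_smul_right, hz, orient, add_sub_cancel_left]
    have e2 : orient (p v) z (p g) = τ₁ / 2 * cross w (p g - p v) := by
      rw [← cross_smul_left, hz, orient, add_sub_cancel_left]
    rw [e1] at k1
    rw [e2] at k2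
    have := eq_of_wedge h hx hf hw hwy (pos_of_mul_pos_right k1 h0.le)
      (pos_of_mul_pos_right k2 h0.le)
    subst this
    exact ⟨g, hf⟩
  have core' : ∀ b g, G.Adj v b → G.Adj b g → G.Adj g v →
      faceOf G p z = interior (convexHull ℝ {p v, p b, p g}) → ∃ y, IsCcwFace G p v x y := by
    intro b g h1 h2 h3 h4
    rcases (h.orient_ne_zero h1 h2 h3).lt_or_gt with h5 | h5
    · refine core g b h3.symm h2.symm h1.symm ?_ ?_
      · rw [convexHull_triple_swap]; exact h4
      · rw [orient_swap]; linarith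
    · exact core b g h1 h2 h3 h4 h5
  -- The face avoids the drawing, so `p v` is on a side of its triangle; by planarity it is a
  -- corner.
  have hvert : v = a ∨ v = b ∨ v = c := by
    have hnint : p v ∉ interior (convexHull ℝ {p a, p b, p c}) := fun hm =>
      hFd (hF ▸ hm) (Or.inl ⟨v, rfl⟩)
    rcases (h.orient_ne_zero hab hbc hca).lt_or_gt with h5 | h5
    · rw [convexHull_triple_swap] at hvF hnint
      rcases mem_segment_of_mem_triple (by rw [orient_swap]; linarith) hvF hnint with h6 | h6 | h6
      · have := h.eq_of_mem_segment hca.symm h6; tauto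
      · have := h.eq_of_mem_segment hab h6; tauto
      · have := h.eq_of_mem_segment hbc.symm h6; tauto
    · rcases mem_segment_of_mem_triple h5 hvF hnint with h6 | h6 | h6
      · have := h.eq_of_mem_segment hab h6; tauto
      · have := h.eq_of_mem_segment hca.symm h6; tauto
      · have := h.eq_of_mem_segment hbc h6; tauto
  rcases hvert with rfl | rfl | rfl
  · exact core' b c hab hbc hca hF
  · refine core' c a hbc hca hab ?_
    rw [← convexHull_triple_rotate]; exact hF
  · refine core' a b hca hab hbc ?_
    rw [convexHull_triple_rotate]; exact hF

end Faces

/-! ### The link of `v` and its cyclic order. -/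

section Link

variable {V : Type*} {G : SimpleGraph V} {p q : V → ℂ}

/-- A neighbor in the kernel lies on the inner side of every edge of the link polygon. -/
theorem IsCcwFace.orient_nonneg_of_mem_kernel [Finite V] (h : IsPlanarDrawing G p) {v x y u : V}
    (hf : IsCcwFace G p v x y) (hu : p u ∈ kernel (linkRegion G p v)) :
    0 ≤ orient (p u) (p x) (p y) := by
  rw [← orient_rotate]
  by_contra hneg
  rw [not_le] at hneg
  -- If `u` were strictly beyond the line `x y`, then going from the midpoint of this edge towards
  -- `u` would leave the face `v x y` at once, although all these points are visible from `u`.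
  set m := p x + (1 / 2 : ℝ) • (p y - p x) with hm
  have hmo : m ∈ openSegment ℝ (p x) (p y) :=
    sub_smul_mem_openSegment (c := 1 / 2) (by norm_num) (by norm_num) (by rw [hm]; ring)
  have hms : m ∈ segment ℝ (p x) (p y) := openSegment_subset_segment _ _ _ hmo
  have hmc : m ∈ convexHull ℝ {p v, p x, p y} := by
    refine segment_subset_convexHull ?_ ?_ hms <;> simp
  have hcont : Continuous fun τ : ℝ => m + τ • (p u - m) := by fun_prop
  -- Triangles at `v` that miss `m` stay away from a neighborhood of `m`, so a nearby point of the
  -- link region lies in a face that contains `m`. Planarity shows that this face is `v x y` itself.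
  set K : Set ℂ := ⋃ (a : V) (b : V) (_ : m ∉ convexHull ℝ {p v, p a, p b}),
    convexHull ℝ {p v, p a, p b} with hK
  have hKc : IsClosed K := isClosed_iUnion_of_finite fun a => isClosed_iUnion_of_finite fun b =>
    isClosed_iUnion_of_finite fun _ => (Set.toFinite _).isClosed_convexHull ℝ
  have hmK : m ∉ K := by
    simp only [hK, Set.mem_iUnion, not_exists]
    exact fun a b h => h
  have hev : ∀ᶠ τ : ℝ in nhdsWithin 0 (Set.Ioi 0), m + τ • (p u - m) ∈ Kᶜ := by
    refine Filter.Eventually.filter_mono nhdsWithin_le_nhds ?_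
    apply hcont.continuousAt.eventually_mem
    rw [zero_smul, add_zero]
    exact hKc.isOpen_compl.mem_nhds hmK
  have hev1 : ∀ᶠ τ : ℝ in nhdsWithin 0 (Set.Ioi 0), τ < 1 :=
    Filter.Eventually.filter_mono nhdsWithin_le_nhds (eventually_lt_nhds one_pos)
  obtain ⟨τ, ⟨hτK, hτ1⟩, hτ0⟩ := ((hev.and hev1).and self_mem_nhdsWithin).exists
  have hτ0 : 0 < τ := hτ0
  have hR : m + τ • (p u - m) ∈ linkRegion G p v := by
    refine hu.2 m ⟨x, y, hf.1, hmc⟩ ?_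
    rw [segment_symm]
    exact sub_smul_mem_segment hτ0.le hτ1.le (by ring)
  obtain ⟨a, b, hab, hc⟩ := hR
  have hmab : m ∈ convexHull ℝ {p v, p a, p b} := by
    by_contra hh
    apply hτK
    simp only [hK, Set.mem_iUnion]
    exact ⟨a, b, hh, hc⟩
  have hvx : v ≠ x := hf.1.1.ne
  have hvy : v ≠ y := hf.1.2.2.1.ne'
  have hset : convexHull ℝ {p v, p a, p b} = convexHull ℝ {p v, p x, p y} := by
    rcases hab.mem_segment h hmab (mem_drawingSet_of_mem_segment hf.1.2.1 hms) with h1 | h1 | h1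
    · have := h.eq_of_mem_openSegment hf.1.2.1 hab.1 hmo h1
      rw [Sym2.eq_iff] at this
      rcases this with ⟨h2, -⟩ | ⟨-, h2⟩
      · exact (hvx h2.symm).elim
      · exact (hvy h2.symm).elim
    · have := h.eq_of_mem_openSegment hf.1.2.1 hab.2.2.1.symm hmo h1
      rw [Sym2.eq_iff] at this
      rcases this with ⟨h2, -⟩ | ⟨-, h2⟩
      · exact (hvx h2.symm).elim
      · exact (hvy h2.symm).elim
    · have := h.eq_of_mem_openSegment hf.1.2.1 hab.2.1 hmo h1
      rw [Sym2.eq_iff] at this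
      rcases this with ⟨h2, h3⟩ | ⟨h2, h3⟩
      · rw [h2, h3]
      · rw [h2, h3, convexHull_triple_swap]
  rw [hset, mem_convexHull_triple_iff hf.2] at hc
  have e : orient (p x) (p y) (m + τ • (p u - m)) = τ * orient (p x) (p y) (p u) := by
    rw [hm]; simp [orient, cross]; ring
  have := hc.2.2
  rw [e] at this
  have := mul_neg_of_pos_of_neg hτ0 hneg
  linarith

theorem CcwOrder.asymm {a b c : ℂ} (h : CcwOrder a b c) : ¬ CcwOrder a c b := by
  intro h'
  unfold CcwOrder at h h'
  rw [cross_swap c a, cross_swap b c, cross_swap a b] at h'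
  rcases h with h | h | h <;> rcases h' with h' | h' | h' <;> linarith [h.1, h.2, h'.1, h'.2]

theorem IsCcwFace.ccwOrder (h : IsPlanarDrawing G p) {v x y z : V} (hf : IsCcwFace G p v x y)
    (hz : G.Adj v z) (hzx : z ≠ x) (hzy : z ≠ y) :
    CcwOrder (p x - p v) (p y - p v) (p z - p v) := by
  by_cases h1 : 0 ≤ orient (p v) (p x) (p z)
  · by_cases h2 : 0 ≤ orient (p v) (p z) (p y)
    · rcases hf.eq_or_eq h hz h1 h2 with h3 | h3 <;> contradiction
    · left
      refine ⟨hf.2, ?_⟩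
      rw [cross_swap]
      exact neg_pos.2 (not_le.1 h2)
  · right; right
    refine ⟨?_, hf.2⟩
    rw [cross_swap]
    exact neg_pos.2 (not_le.1 h1)

/-- Let `z` be the successor of `x` in `q`. If `z ≠ y`, then the face in `p` gives the order `x, y,
z` and the face in `q` gives `x, z, y`, against the equality of the rotations. -/
theorem TopologicallyEquivalent.orient_pos [Finite V] (hpq : TopologicallyEquivalent G p q)
    (hp : IsTriangulation G p) (hq : IsTriangulation G q) {v x y : V}
    (hv : ¬ IsBoundaryVertex G q v) (hf : IsCcwFace G p v x y) :
    0 < orient (q v) (q x) (q y) := by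
  obtain ⟨z, hz⟩ := hq.exists_ccwFace hv hf.1.1
  by_cases hzy : z = y
  · subst hzy; exact hz.2
  have hvz := hz.1.2.2.1.symm
  have hvy := hf.1.2.2.1.symm
  have h1 := hf.ccwOrder hp.planar hvz hz.1.2.1.ne' hzy
  have h2 := hz.ccwOrder hq.planar hvy hf.1.2.1.ne' (Ne.symm hzy)
  exact (h2.asymm ((hpq.rotation v x y z hf.1.1 hvy hvz).1 h1)).elim

/-- `σ` maps each neighbor of `v` to the next one on a closed walk around `v`, and this walk is so
short that any two neighbors of `v` have distance at most two on it. -/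
structure IsShortLink (G : SimpleGraph V) (v : V) (σ : V → V) : Prop where
  adj_next : ∀ x, G.Adj v x → G.Adj v (σ x)
  adj : ∀ x, G.Adj v x → G.Adj x (σ x)
  inj : ∀ x y, G.Adj v x → G.Adj v y → σ x = σ y → x = y
  next_next_ne : ∀ x, G.Adj v x → σ (σ x) ≠ x
  close : ∀ x y, G.Adj v x → G.Adj v y →
    y = x ∨ y = σ x ∨ y = σ (σ x) ∨ x = σ y ∨ x = σ (σ y)

/-- A pair violating `close` would give six distinct neighbors `x, σ x, σ (σ x), y, σ y, σ (σ y)`.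
This is where the bound on the degree enters the geometry. -/
theorem IsShortLink.of_faces [Finite V] (h : IsPlanarDrawing G p) {v : V} {σ : V → V}
    (hσ : ∀ x, G.Adj v x → IsCcwFace G p v x (σ x)) (hN : (G.neighborSet v).ncard ≤ 5) :
    IsShortLink G v σ := by
  have h1 : ∀ x, G.Adj v x → G.Adj v (σ x) := fun x hx => (hσ x hx).1.2.2.1.symm
  have h2 : ∀ x, G.Adj v x → G.Adj x (σ x) := fun x hx => (hσ x hx).1.2.1
  have h3 : ∀ x y, G.Adj v x → G.Adj v y → σ x = σ y → x = y := fun x y hx hy he =>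
    (hσ x hx).left_unique h (he ▸ hσ y hy)
  have h4 : ∀ x, G.Adj v x → σ (σ x) ≠ x := by
    intro x hx he
    have k1 := (hσ x hx).2
    have k2 := (hσ _ (h1 x hx)).2
    rw [he, orient_swap] at k2
    linarith
  refine ⟨h1, h2, h3, h4, ?_⟩
  intro x y hx hy
  by_contra hne
  simp only [not_or] at hne
  obtain ⟨n1, n2, n3, n4, n5⟩ := hne
  have hx1 := h1 x hx
  have hy1 := h1 y hy
  have m1 : σ x ≠ σ y := fun e => n1 (h3 x y hx hy e).symm
  have m2 : σ x ≠ σ (σ y) := fun e => n4 (h3 _ _ hx hy1 e)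
  have m3 : σ (σ x) ≠ σ y := fun e => n2 (h3 _ _ hx1 hy e).symm
  have m4 : σ (σ x) ≠ σ (σ y) := fun e => m1 (h3 _ _ hx1 hy1 e)
  have a1 := (h2 x hx).ne
  have a2 := (h2 _ hx1).ne
  have a3 := h4 x hx
  have b1 := (h2 y hy).ne
  have b2 := (h2 _ hy1).ne
  have b3 := h4 y hy
  classical
  have hc : ({x, σ x, σ (σ x), y, σ y, σ (σ y)} : Finset V).card = 6 := by
    rw [Finset.card_insert_of_notMem, Finset.card_insert_of_notMem, Finset.card_insert_of_notMem,
      Finset.card_insert_of_notMem, Finset.card_insert_of_notMem, Finset.card_singleton] <;>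
    simp only [Finset.mem_insert, Finset.mem_singleton, not_or] <;> tauto
  have hsub : ((({x, σ x, σ (σ x), y, σ y, σ (σ y)} : Finset V)) : Set V) ⊆ G.neighborSet v := by
    intro w hw
    simp only [Finset.coe_insert, Finset.coe_singleton, Set.mem_insert_iff,
      Set.mem_singleton_iff] at hw
    rcases hw with rfl | rfl | rfl | rfl | rfl | rfl
    · exact hx
    · exact hx1
    · exact h1 _ hx1
    · exact hy
    · exact hy1
    · exact h1 _ hy1
  have := Set.ncard_le_ncard hsub (Set.toFinite _)
  rw [Set.ncard_coe_finset, hc] at this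
  omega

theorem IsShortLink.exists_prev [Finite V] {v : V} {σ : V → V} (h : IsShortLink G v σ) {y : V}
    (hy : G.Adj v y) : ∃ x, G.Adj v x ∧ σ x = y := by
  let g : G.neighborSet v → G.neighborSet v := fun x => ⟨σ x, h.adj_next x x.2⟩
  have hg : Function.Injective g := fun x x' he =>
    Subtype.ext (h.inj x x' x.2 x'.2 (congrArg Subtype.val he))
  obtain ⟨x, hx⟩ := Finite.surjective_of_injective hg ⟨y, hy⟩
  exact ⟨x, x.2, congrArg Subtype.val hx⟩

end Link

/-! ### Star-shaped links, and their persistence under continuous motion. -/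

section Star

variable {V : Type*} {G : SimpleGraph V} {v : V} {σ : V → V}

/-- The closed wedge at `a` from `b` counterclockwise to `c`. -/
def InWedge (a b c z : ℂ) : Prop := 0 ≤ orient a b z ∧ 0 ≤ orient a z c

/-- The link polygon of `v` is star-shaped with respect to `v` and winds around `v` once. -/
structure IsStar (G : SimpleGraph V) (v : V) (σ : V → V) (f : V → ℂ) : Prop where
  pos : ∀ x, G.Adj v x → 0 < orient (f v) (f x) (f (σ x))
  sep : ∀ x y, G.Adj v x → G.Adj v y → InWedge (f v) (f x) (f (σ x)) (f y) → y = x ∨ y = σ x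

/-- If `z` were in no wedge, then either some neighbors are strictly on one side of the line through
`f v` and `z` and σ never leaves that side, or all neighbors are strictly on the other side. In both
cases the slope `d / s` increases strictly along σ on a finite set, which is impossible. -/
theorem exists_inWedge [Finite V] {f : V → ℂ} (hl : IsShortLink G v σ)
    (hpos : ∀ x, G.Adj v x → 0 < orient (f v) (f x) (f (σ x))) {u : V} (hu : G.Adj v u) (z : ℂ) :
    ∃ x, G.Adj v x ∧ InWedge (f v) (f x) (f (σ x)) z := by
  by_contra hno
  simp only [not_exists, not_and, InWedge, not_le] at hno
  set Z := z - f v with hZ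
  have hZ0 : Z ≠ 0 := by
    intro h0
    have hz : z = f v := sub_eq_zero.1 h0
    have := hno u hu (by rw [hz]; simp [orient, cross])
    rw [hz] at this
    simp [orient, cross] at this
  have hn : 0 < cross Z (Complex.I * Z) := by
    have : cross Z (Complex.I * Z) = Complex.normSq Z := by
      simp [cross, Complex.normSq_apply]
    rw [this]; exact Complex.normSq_pos.2 hZ0
  set s : V → ℝ := fun x => cross (f x - f v) Z with hs
  set d : V → ℝ := fun x => cross (f x - f v) (Complex.I * Z) with hd
  have hstep : ∀ x, G.Adj v x → 0 ≤ s x → 0 < s (σ x) := by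
    intro x hx h0
    have := hno x hx h0
    rw [hs]
    simp only
    rw [cross_swap]
    exact neg_pos.2 this
  have hslope : ∀ x, G.Adj v x → 0 < s x * s (σ x) → d x / s x < d (σ x) / s (σ x) := by
    intro x hx h0
    have hp := cross_plucker (f x - f v) (f (σ x) - f v) Z (Complex.I * Z)
    have h1 := mul_pos (hpos x hx) hn
    have e : orient (f v) (f x) (f (σ x)) * cross Z (Complex.I * Z) = s x * d (σ x) - d x * s (σ x) := by
      simp only [hs, hd, orient]; linarith
    rw [e] at h1
    have hx0 : s x ≠ 0 := left_ne_zero_of_mul h0.ne'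
    have hy0 : s (σ x) ≠ 0 := right_ne_zero_of_mul h0.ne'
    have e2 : d (σ x) / s (σ x) - d x / s x = (s x * d (σ x) - d x * s (σ x)) / (s x * s (σ x)) := by
      field_simp
    have : 0 < d (σ x) / s (σ x) - d x / s x := by rw [e2]; positivity
    linarith
  have hmain : ∀ O : Set V, O.Nonempty → (∀ x ∈ O, G.Adj v x ∧ σ x ∈ O ∧ 0 < s x * s (σ x)) →
      False := by
    intro O hO hcl
    obtain ⟨x, hx, hmax⟩ := Set.exists_max_image O (fun x => d x / s x) (Set.toFinite _) hO
    obtain ⟨h1, h2, h3⟩ := hcl x hx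
    exact absurd (hmax _ h2) (not_le.2 (hslope x h1 h3))
  by_cases hex : ∃ x, G.Adj v x ∧ 0 < s x
  · refine hmain {x | G.Adj v x ∧ 0 < s x} hex fun x hx => ?_
    have := hstep x hx.1 hx.2.le
    exact ⟨hx.1, ⟨hl.adj_next x hx.1, this⟩, mul_pos hx.2 this⟩
  · have hneg : ∀ x, G.Adj v x → s x < 0 := by
      intro x hx
      by_contra h0
      exact hex ⟨σ x, hl.adj_next x hx, hstep x hx (not_lt.1 h0)⟩
    refine hmain {x | G.Adj v x} ⟨u, hu⟩ fun x hx => ?_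
    have h1 := hl.adj_next x hx
    exact ⟨hx, h1, mul_pos_of_neg_of_neg (hneg x hx) (hneg _ h1)⟩

/-- Turning clockwise from the common direction `Z`, one of the start rays `X` and `Y` is met first,
and it lies in the other wedge. The Plücker relation turns this into signs; the case of `Z` on the
ray of `X` is separate because `cross X Z` is cancelled. -/
theorem wedge_start_mem {X X' Y Y' Z : ℂ} (hX : 0 < cross X X')
    (hZ : Z ≠ 0) (h1 : 0 ≤ cross X Z) (h2 : 0 ≤ cross Z X') (h3 : 0 ≤ cross Y Z)
    (h4 : 0 ≤ cross Z Y') (h : 0 ≤ cross X Y) :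
    (0 ≤ cross X Y ∧ 0 ≤ cross Y X') ∨ (0 ≤ cross Y X ∧ 0 ≤ cross X Y') := by
  rcases h1.eq_or_lt with h0 | h0
  · right
    have hX0 : X ≠ 0 := by rintro rfl; simp [cross] at hX
    obtain ⟨c, rfl⟩ := exists_smul_of_cross_eq_zero hX0 h0.symm
    rw [cross_smul_left] at h2 h4
    rw [cross_smul_right] at h3
    have hc : 0 < c := (nonneg_of_mul_nonneg_left h2 hX).lt_of_ne' (by rintro rfl; simp at hZ)
    exact ⟨nonneg_of_mul_nonneg_right h3 hc, nonneg_of_mul_nonneg_right h4 hc⟩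
  · left
    refine ⟨h, ?_⟩
    have hp := cross_plucker X Y Z X'
    have : 0 ≤ cross X Z * cross Y X' := by
      have e1 := mul_nonneg h h2
      have e2 := mul_nonneg hX.le h3
      linarith
    exact nonneg_of_mul_nonneg_right this h0

theorem wedge_start_mem_or {X X' Y Y' Z : ℂ} (hX : 0 < cross X X') (hY : 0 < cross Y Y')
    (hZ : Z ≠ 0) (h1 : 0 ≤ cross X Z) (h2 : 0 ≤ cross Z X') (h3 : 0 ≤ cross Y Z)
    (h4 : 0 ≤ cross Z Y') :
    (0 ≤ cross X Y ∧ 0 ≤ cross Y X') ∨ (0 ≤ cross Y X ∧ 0 ≤ cross X Y') := by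
  rcases le_total 0 (cross X Y) with h | h
  · exact wedge_start_mem hX hZ h1 h2 h3 h4 h
  · exact (wedge_start_mem hY hZ h3 h4 h1 h2 (by rw [cross_swap]; linarith)).symm

/-- A point on the ray from `a` through `b`, if it is in a wedge with side `b`. -/
theorem eq_add_smul_of_orient_eq_zero {a b c z : ℂ} (h : 0 < orient a b c)
    (h0 : orient a b z = 0) (h1 : 0 ≤ orient a z c) : ∃ r : ℝ, 0 ≤ r ∧ z - a = r • (b - a) := by
  have hb : b - a ≠ 0 := by intro h0; simp [orient, h0, cross] at h
  obtain ⟨r, hr⟩ := exists_smul_of_cross_eq_zero hb h0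
  refine ⟨r, ?_, hr⟩
  rw [orient, hr, cross_smul_left] at h1
  exact nonneg_of_mul_nonneg_left h1 h

theorem eq_add_smul_of_orient_eq_zero' {a b c z : ℂ} (h : 0 < orient a b c)
    (h0 : 0 ≤ orient a b z) (h1 : orient a z c = 0) : ∃ r : ℝ, 0 ≤ r ∧ z - a = r • (c - a) := by
  have hc : c - a ≠ 0 := by intro h0; simp [orient, h0, cross] at h
  have h1' : cross (c - a) (z - a) = 0 := by rw [cross_swap]; exact neg_eq_zero.2 h1
  obtain ⟨r, hr⟩ := exists_smul_of_cross_eq_zero hc h1'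
  refine ⟨r, ?_, hr⟩
  rw [orient, hr, cross_smul_right] at h0
  exact nonneg_of_mul_nonneg_left h0 h

theorem orient_of_sub_eq_smul {a b c z : ℂ} {r : ℝ} (hz : z - a = r • (b - a)) :
    orient b c z = (1 - r) * orient a b c := by
  have : z = a + r • (b - a) := by rw [← hz]; ring
  rw [this]; simp [orient, cross]; ring

/-- By `sep`, two wedges that share a direction are equal, or adjacent with `z` on the common ray.
In the first case `z` is on the link edge; in the second, it is at once not beyond and not before
the common corner, so it is this corner. -/
theorem IsStar.not_inside_outside {f : V → ℂ} (hs : IsStar G v σ f)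
    {x y : V} (hx : G.Adj v x) (hy : G.Adj v y) {z : ℂ} (hzx : z ∉ segment ℝ (f x) (f (σ x)))
    (h1 : InWedge (f v) (f x) (f (σ x)) z) (h2 : 0 ≤ orient (f x) (f (σ x)) z)
    (h3 : InWedge (f v) (f y) (f (σ y)) z) (h4 : orient (f y) (f (σ y)) z ≤ 0) : False := by
  by_cases hxy : y = x
  · subst hxy
    exact hzx (mem_segment_of_orient_eq_zero (hs.pos y hy) h1.1 h1.2 (le_antisymm h4 h2))
  have hZ : z - f v ≠ 0 := by
    intro h0
    rw [sub_eq_zero] at h0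
    have := hs.pos y hy
    rw [h0, orient_rotate] at h4
    linarith
  rcases wedge_start_mem_or (hs.pos x hx) (hs.pos y hy) hZ h1.1 h1.2 h3.1 h3.2 with h5 | h5
  · rcases hs.sep x y hx hy h5 with h6 | rfl
    · exact hxy h6
    have h0 : orient (f v) (f (σ x)) z = 0 := by
      refine le_antisymm ?_ h3.1
      have := h1.2
      rw [orient_swap] at this; linarith
    obtain ⟨r, hr0, hr⟩ := eq_add_smul_of_orient_eq_zero (hs.pos _ hy) h0 h3.2
    rw [orient_of_sub_eq_smul hr] at h4
    have k1 : 1 - r ≤ 0 := by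
      by_contra hh
      exact absurd h4 (not_le.2 (mul_pos (not_le.1 hh) (hs.pos _ hy)))
    have e : orient (f x) (f (σ x)) z = -orient (f (σ x)) (f x) z := by
      simp [orient, cross]; ring
    rw [e, orient_of_sub_eq_smul hr, orient_swap] at h2
    have k2 : 0 ≤ 1 - r := nonneg_of_mul_nonneg_left (by linarith) (hs.pos x hx)
    obtain rfl : r = 1 := by linarith
    rw [one_smul] at hr
    have : z = f (σ x) := sub_left_injective hr
    exact hzx (this ▸ right_mem_segment ℝ _ _)
  · rcases hs.sep y x hy hx h5 with h6 | rfl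
    · exact hxy h6.symm
    have h0 : orient (f v) (f (σ y)) z = 0 := by
      refine le_antisymm ?_ h1.1
      have := h3.2
      rw [orient_swap] at this; linarith
    obtain ⟨r, hr0, hr⟩ := eq_add_smul_of_orient_eq_zero (hs.pos _ hx) h0 h1.2
    rw [orient_of_sub_eq_smul hr] at h2
    have k1 : 0 ≤ 1 - r := nonneg_of_mul_nonneg_left h2 (hs.pos _ hx)
    have e : orient (f y) (f (σ y)) z = -orient (f (σ y)) (f y) z := by
      simp [orient, cross]; ring
    rw [e, orient_of_sub_eq_smul hr, orient_swap] at h4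
    have k2 : 1 - r ≤ 0 := by
      by_contra hh
      have := mul_pos (not_le.1 hh) (hs.pos y hy)
      linarith
    obtain rfl : r = 1 := by linarith
    rw [one_smul] at hr
    have : z = f (σ y) := sub_left_injective hr
    exact hzx (this ▸ left_mem_segment ℝ _ _)

/-- On a short link, no two neighbors are seen in the same direction. -/
theorem IsShortLink.sub_ne_smul_sub {f : V → ℂ} (hl : IsShortLink G v σ)
    (hpos : ∀ x, G.Adj v x → 0 < orient (f v) (f x) (f (σ x))) {x y : V} (hx : G.Adj v x)
    (hy : G.Adj v y) (hxy : y ≠ x) {c : ℝ} (hc : 0 < c) : f y - f v ≠ c • (f x - f v) := by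
  intro he
  have e1 : ∀ w, cross (f y - f v) w = c * cross (f x - f v) w := fun w => by
    rw [he, cross_smul_left]
  have hx1 := hl.adj_next x hx
  have hy1 := hl.adj_next y hy
  have px := hpos x hx
  have py := hpos y hy
  have px1 := hpos _ hx1
  have py1 := hpos _ hy1
  unfold orient at px py px1 py1
  have pxy : cross (f x - f v) (f y - f v) = 0 := by rw [he, cross_smul_right, cross_self_eq, mul_zero]
  -- Two consecutive turns of less than π each do not add up to a full turn.
  rcases hl.close x y hx hy with h | h | h | h | h
  · exact hxy h
  · rw [← h, pxy] at px; exact lt_irrefl _ px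
  · rw [← h, cross_swap, e1] at px1
    have := mul_pos hc px
    linarith
  · rw [← h, cross_swap, pxy, neg_zero] at py; exact lt_irrefl _ py
  · rw [← h, cross_swap] at py1
    rw [e1] at py
    have := pos_of_mul_pos_right py hc.le
    linarith

/-- If `P` held somewhere, then two closed sets that cover a connected interval and both meet it
would have to intersect in it. All invariants along motions are derived from this. -/
theorem not_of_isClosed_of_cover {P Q : ℝ → Prop} (hP : IsClosed {t | P t})
    (hQ : IsClosed {t | Q t}) (hc : ∀ t ∈ Set.Icc (0 : ℝ) 1, P t ∨ Q t)
    (hd : ∀ t ∈ Set.Icc (0 : ℝ) 1, P t → Q t → False) (h0 : ¬ P 0) :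
    ∀ t ∈ Set.Icc (0 : ℝ) 1, ¬ P t := by
  intro t ht hPt
  have h00 : (0 : ℝ) ∈ Set.Icc (0 : ℝ) 1 := ⟨le_rfl, zero_le_one⟩
  have hq0 := (hc 0 h00).resolve_left h0
  obtain ⟨s, hs, h1, h2⟩ := isPreconnected_closed_iff.1 (isPreconnected_Icc (a := (0 : ℝ)) (b := 1))
    _ _ hP hQ (fun s hs => hc s hs) ⟨t, ht, hPt⟩ ⟨0, h00, hq0⟩
  exact hd s hs h1 h2

/-- A neighbor could enter a foreign wedge only across a boundary ray, where it would be seen in the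
same direction as another neighbor; a short link excludes this. -/
theorem isStar_of_continuous {f : ℝ → V → ℂ} (hl : IsShortLink G v σ)
    (hf : ∀ w, Continuous fun t => f t w)
    (hpos : ∀ t ∈ Set.Icc (0 : ℝ) 1, ∀ x, G.Adj v x → 0 < orient (f t v) (f t x) (f t (σ x)))
    (h0 : IsStar G v σ (f 0)) : ∀ t ∈ Set.Icc (0 : ℝ) 1, IsStar G v σ (f t) := by
  intro t ht
  refine ⟨hpos t ht, ?_⟩
  intro x y hx hy hw
  by_contra hne
  rw [not_or] at hne
  have c1 : Continuous fun t => orient (f t v) (f t x) (f t y) :=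
    continuous_orient (hf _) (hf _) (hf _)
  have c2 : Continuous fun t => orient (f t v) (f t y) (f t (σ x)) :=
    continuous_orient (hf _) (hf _) (hf _)
  refine not_of_isClosed_of_cover (P := fun t => InWedge (f t v) (f t x) (f t (σ x)) (f t y))
    (Q := fun t => orient (f t v) (f t x) (f t y) ≤ 0 ∨ orient (f t v) (f t y) (f t (σ x)) ≤ 0)
    ?_ ?_ ?_ ?_ ?_ t ht hw
  · exact (isClosed_le continuous_const c1).inter (isClosed_le continuous_const c2)
  · exact (isClosed_le c1 continuous_const).union (isClosed_le c2 continuous_const)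
  · intro s _
    by_cases k1 : 0 ≤ orient (f s v) (f s x) (f s y)
    · by_cases k2 : 0 ≤ orient (f s v) (f s y) (f s (σ x))
      · exact Or.inl ⟨k1, k2⟩
      · exact Or.inr (Or.inr (not_le.1 k2).le)
    · exact Or.inr (Or.inl (not_le.1 k1).le)
  · intro s hs k1 k2
    have hyne : f s y - f s v ≠ 0 := by
      intro h0
      have := hpos s hs y hy
      simp [orient, h0, cross] at this
    rcases k2 with k2 | k2
    · obtain ⟨r, hr0, hr⟩ := eq_add_smul_of_orient_eq_zero (hpos s hs x hx)
        (le_antisymm k2 k1.1) k1.2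
      refine hl.sub_ne_smul_sub (hpos s hs) hx hy hne.1 (hr0.lt_of_ne' ?_) hr
      rintro rfl
      exact hyne (by rw [hr, zero_smul])
    · obtain ⟨r, hr0, hr⟩ := eq_add_smul_of_orient_eq_zero' (hpos s hs x hx)
        k1.1 (le_antisymm k2 k1.2)
      refine hl.sub_ne_smul_sub (hpos s hs) (hl.adj_next x hx) hy hne.2 (hr0.lt_of_ne' ?_) hr
      rintro rfl
      exact hyne (by rw [hr, zero_smul])
  · intro k
    rcases h0.sep x y hx hy k with h | h
    · exact hne.1 h
    · exact hne.2 h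

/-- The point `z` is outside the link polygon of `v`. -/
def IsOutside (G : SimpleGraph V) (v : V) (σ : V → V) (f : V → ℂ) (z : ℂ) : Prop :=
  ∀ x, G.Adj v x → ¬ (InWedge (f v) (f x) (f (σ x)) z ∧ 0 ≤ orient (f x) (f (σ x)) z)

/-- The wedges cover the plane, so at each time the point is inside or outside in the weak sense,
and both happen only on the link edges (`IsStar.not_inside_outside`), which the point avoids. -/
theorem isOutside_of_continuous [Finite V] {f : ℝ → V → ℂ} {z : ℝ → ℂ} (hl : IsShortLink G v σ)
    {u : V} (hu : G.Adj v u) (hf : ∀ w, Continuous fun t => f t w) (hz : Continuous z)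
    (hs : ∀ t ∈ Set.Icc (0 : ℝ) 1, IsStar G v σ (f t))
    (hzs : ∀ t ∈ Set.Icc (0 : ℝ) 1, ∀ x, G.Adj v x → z t ∉ segment ℝ (f t x) (f t (σ x)))
    (h0 : IsOutside G v σ (f 0) (z 0)) :
    ∀ t ∈ Set.Icc (0 : ℝ) 1, IsOutside G v σ (f t) (z t) := by
  have c1 : ∀ x, Continuous fun t => orient (f t v) (f t x) (z t) := fun x =>
    continuous_orient (hf _) (hf _) hz
  have c2 : ∀ x, Continuous fun t => orient (f t v) (z t) (f t (σ x)) := fun x =>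
    continuous_orient (hf _) hz (hf _)
  have c3 : ∀ x, Continuous fun t => orient (f t x) (f t (σ x)) (z t) := fun x =>
    continuous_orient (hf _) (hf _) hz
  have hcw : ∀ x, IsClosed {t | InWedge (f t v) (f t x) (f t (σ x)) (z t)} := fun x =>
    (isClosed_le continuous_const (c1 x)).inter (isClosed_le continuous_const (c2 x))
  have key := not_of_isClosed_of_cover
    (P := fun t => ∃ x, ∃ _ : G.Adj v x, InWedge (f t v) (f t x) (f t (σ x)) (z t) ∧
      0 ≤ orient (f t x) (f t (σ x)) (z t))
    (Q := fun t => ∃ x, ∃ _ : G.Adj v x, InWedge (f t v) (f t x) (f t (σ x)) (z t) ∧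
      orient (f t x) (f t (σ x)) (z t) ≤ 0) ?_ ?_ ?_ ?_ ?_
  · intro t ht x hx h
    exact key t ht ⟨x, hx, h⟩
  · simp only [Set.ofPred_exists]
    exact isClosed_iUnion_of_finite fun x => isClosed_iUnion_of_finite fun _ =>
      (hcw x).inter (isClosed_le continuous_const (c3 x))
  · simp only [Set.ofPred_exists]
    exact isClosed_iUnion_of_finite fun x => isClosed_iUnion_of_finite fun _ =>
      (hcw x).inter (isClosed_le (c3 x) continuous_const)
  · intro t ht
    obtain ⟨x, hx, hw⟩ := exists_inWedge hl (hs t ht).pos hu (z t)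
    rcases le_total 0 (orient (f t x) (f t (σ x)) (z t)) with h | h
    · exact Or.inl ⟨x, hx, hw, h⟩
    · exact Or.inr ⟨x, hx, hw, h⟩
  · rintro t ht ⟨x, hx, h1, h2⟩ ⟨y, hy, h3, h4⟩
    exact (hs t ht).not_inside_outside hx hy (hzs t ht x hx) h1 h2 h3 h4
  · rintro ⟨x, hx, h⟩
    exact h0 x hx h

end Star

/-! ### Planarity of a drawing of `G` from its link at `v` and a drawing of the contracted graph. -/

section LinkDrawing

variable {V : Type*} {G : SimpleGraph V} {v u : V} {σ : V → V} {f : V → ℂ}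

/-- The link polygon of `v` is star-shaped around `v`, and the remaining drawing is outside it. -/
structure IsLinkDrawing (G : SimpleGraph V) (v : V) (σ : V → V) (f : V → ℂ) : Prop where
  star : IsStar G v σ f
  vertices : ∀ w, w ≠ v → ¬ G.Adj v w → IsOutside G v σ f (f w)
  edges : ∀ a b, G.Adj a b → a ≠ v → b ≠ v → (∀ x, G.Adj v x → s(a, b) ≠ s(x, σ x)) →
    ∀ z ∈ openSegment ℝ (f a) (f b), IsOutside G v σ f z

theorem contractGraph_adj_of_adj {a b : V} (ha : a ≠ v) (hb : b ≠ v) (h : G.Adj a b) :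
    (contractGraph G v u).Adj ⟨a, ha⟩ ⟨b, hb⟩ :=
  ⟨fun he => h.ne (congrArg Subtype.val he), Or.inl h⟩

theorem contractGraph_adj_target {x : V} (hu : G.Adj v u) (hx : G.Adj v x) (hxu : x ≠ u) :
    (contractGraph G v u).Adj ⟨u, hu.ne'⟩ ⟨x, hx.ne'⟩ :=
  ⟨fun he => hxu (congrArg Subtype.val he).symm, Or.inr (Or.inl ⟨rfl, hx⟩)⟩

/-- A point of the drawing in a closed face triangle lies on one of its sides, and planarity then
identifies the vertex or edge that contains it. -/
theorem IsLinkDrawing.of_faces (h : IsPlanarDrawing G f)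
    (hσ : ∀ x, G.Adj v x → IsCcwFace G f v x (σ x)) : IsLinkDrawing G v σ f := by
  refine ⟨⟨fun x hx => (hσ x hx).2, fun x y hx hy hw => (hσ x hx).eq_or_eq h hy hw.1 hw.2⟩, ?_, ?_⟩
  · rintro w hwv hw x hx ⟨h1, h2⟩
    have hf := hσ x hx
    have hσx := hf.1.2.2.1.symm
    rcases hf.mem_segment ((mem_convexHull_triple_iff hf.2).2 ⟨h1.1, h1.2, h2⟩)
      (Or.inl ⟨w, rfl⟩) with h3 | h3 | h3
    · rcases h.eq_of_mem_segment hx h3 with rfl | rfl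
      · exact hwv rfl
      · exact hw hx
    · rcases h.eq_of_mem_segment hσx h3 with rfl | rfl
      · exact hwv rfl
      · exact hw hσx
    · rcases h.eq_of_mem_segment hf.1.2.1 h3 with rfl | rfl
      · exact hw hx
      · exact hw hσx
  · rintro a b hab ha hb hl z hz x hx ⟨h1, h2⟩
    have hf := hσ x hx
    have hσx := hf.1.2.2.1.symm
    rcases hf.mem_segment ((mem_convexHull_triple_iff hf.2).2 ⟨h1.1, h1.2, h2⟩)
      (mem_drawingSet_of_mem_segment hab (openSegment_subset_segment _ _ _ hz)) with h3 | h3 | h3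
    · have := h.eq_of_mem_openSegment hab hx hz h3
      rw [Sym2.eq_iff] at this
      rcases this with h4 | h4
      · exact ha h4.1
      · exact hb h4.2
    · have := h.eq_of_mem_openSegment hab hσx hz h3
      rw [Sym2.eq_iff] at this
      rcases this with h4 | h4
      · exact ha h4.1
      · exact hb h4.2
    · exact hl x hx (h.eq_of_mem_openSegment hab hf.1.2.1 hz h3)

theorem IsOutside.not_mem_segment (hs : IsStar G v σ f) {z : ℂ} (hz : IsOutside G v σ f z) {x : V}
    (hx : G.Adj v x) : z ∉ segment ℝ (f v) (f x) := by
  intro hm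
  obtain ⟨c, h0, h1, hc⟩ := exists_of_mem_segment hm
  have hp := hs.pos x hx
  refine hz x hx ⟨⟨?_, ?_⟩, ?_⟩
  · rw [orient, hc, cross_smul_right, cross_self_eq, mul_zero]
  · rw [orient, hc, cross_smul_left]; exact mul_nonneg h0 hp.le
  · rw [orient_of_sub_eq_smul hc]; exact mul_nonneg (by linarith) hp.le

theorem IsStar.ne (hs : IsStar G v σ f) {x : V} (hx : G.Adj v x) : f x ≠ f v := by
  intro h0
  have := hs.pos x hx
  simp [orient, h0, cross] at this

theorem IsLinkDrawing.apply_ne (h : IsLinkDrawing G v σ f) {u w : V} (hu : G.Adj v u)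
    (hw : w ≠ v) : f w ≠ f v := by
  by_cases hx : G.Adj v w
  · exact h.star.ne hx
  · intro h0
    refine (h.vertices w hw hx).not_mem_segment h.star hu ?_
    rw [h0]; exact left_mem_segment ℝ _ _

theorem orient_eq_zero_of_mem_segment {a b z : ℂ} (hz : z ∈ segment ℝ a b) : orient a b z = 0 := by
  obtain ⟨c, -, -, hc⟩ := exists_of_mem_segment hz
  rw [orient, hc, cross_smul_right, cross_self_eq, mul_zero]

theorem orient_smul_right {a b c z : ℂ} {r : ℝ} (hz : z - a = r • (c - a)) :
    orient a b z = r * orient a b c := by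
  rw [orient, hz, cross_smul_right]; rfl

theorem orient_smul_left {a b c z : ℂ} {r : ℝ} (hz : z - a = r • (b - a)) :
    orient a z c = r * orient a b c := by
  rw [orient, hz, cross_smul_left]; rfl

theorem IsLinkDrawing.not_mem_segment_left (h : IsLinkDrawing G v σ f) (hl : IsShortLink G v σ)
    {y w : V} (hy : G.Adj v y) (hwv : w ≠ v) (hwy : w ≠ y) : f w ∉ segment ℝ (f v) (f y) := by
  intro hm
  by_cases hw : G.Adj v w
  · obtain ⟨c, h0, -, hc⟩ := exists_of_mem_segment hm
    refine hl.sub_ne_smul_sub h.star.pos hy hw hwy (h0.lt_of_ne' ?_) hc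
    rintro rfl
    rw [zero_smul, sub_eq_zero] at hc
    exact h.star.ne hw hc
  · exact (h.vertices w hwv hw).not_mem_segment h.star hy hm

theorem IsLinkDrawing.disjoint_spokes (h : IsLinkDrawing G v σ f) (hl : IsShortLink G v σ)
    {y y' : V} (hy : G.Adj v y) (hy' : G.Adj v y') (hne : y ≠ y') :
    Disjoint (openSegment ℝ (f v) (f y)) (openSegment ℝ (f v) (f y')) := by
  rw [Set.disjoint_left]
  intro z h1 h2
  obtain ⟨c, c0, -, hc⟩ := exists_of_mem_openSegment h1
  obtain ⟨d, d0, -, hd⟩ := exists_of_mem_openSegment h2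
  refine hl.sub_ne_smul_sub h.star.pos hy hy' hne.symm (c := c / d) (by positivity) ?_
  rw [hc] at hd
  rw [div_eq_inv_mul, mul_smul, hd, smul_smul, inv_mul_cancel₀ d0.ne', one_smul]

/-- Edges off the link are outside, while spokes are inside. If a spoke meets the link edge of `x`,
then its end `y` is in the wedge of `x`, so it is an end of that edge; but interior points of such a
spoke are strictly on the side of `v`. -/
theorem IsLinkDrawing.disjoint_spoke (h : IsLinkDrawing G v σ f)
    {y a b : V} (hy : G.Adj v y) (hab : G.Adj a b) (ha : a ≠ v) (hb : b ≠ v) :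
    Disjoint (openSegment ℝ (f v) (f y)) (openSegment ℝ (f a) (f b)) := by
  rw [Set.disjoint_left]
  intro z h1 h2
  by_cases hlink : ∀ x, G.Adj v x → s(a, b) ≠ s(x, σ x)
  · exact (h.edges a b hab ha hb hlink z h2).not_mem_segment h.star hy
      (openSegment_subset_segment _ _ _ h1)
  push Not at hlink
  obtain ⟨x, hx, he⟩ := hlink
  have h3 : z ∈ segment ℝ (f x) (f (σ x)) := by
    rw [Sym2.eq_iff] at he
    rcases he with ⟨rfl, rfl⟩ | ⟨rfl, rfl⟩
    · exact openSegment_subset_segment _ _ _ h2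
    · rw [segment_symm]; exact openSegment_subset_segment _ _ _ h2
  obtain ⟨c, c0, c1, hc⟩ := exists_of_mem_openSegment h1
  have hp := h.star.pos x hx
  have hmem := segment_subset_convexHull (s := {f v, f x, f (σ x)}) (by simp) (by simp) h3
  rw [mem_convexHull_triple_iff hp] at hmem
  have h0 := orient_eq_zero_of_mem_segment h3
  obtain ⟨k1, k2, -⟩ := hmem
  rw [orient_smul_right hc] at k1
  rw [orient_smul_left hc] at k2
  rcases h.star.sep x y hx hy ⟨nonneg_of_mul_nonneg_right k1 c0, nonneg_of_mul_nonneg_right k2 c0⟩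
    with rfl | rfl
  · rw [orient_of_sub_eq_smul hc] at h0
    have : 0 < (1 - c) * orient (f v) (f y) (f (σ y)) := mul_pos (by linarith) hp
    linarith
  · have e : orient (f x) (f (σ x)) z = -orient (f (σ x)) (f x) z := by
      simp [orient, cross]; ring
    rw [e, orient_of_sub_eq_smul hc, orient_swap] at h0
    have : 0 < (1 - c) * orient (f v) (f x) (f (σ x)) := mul_pos (by linarith) hp
    linarith

/-- Only conditions that involve `v` or an edge at `v` need the link; all others are inherited from
the contracted graph. -/
theorem IsLinkDrawing.isPlanarDrawing (h : IsLinkDrawing G v σ f) (hl : IsShortLink G v σ)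
    (hu : G.Adj v u)
    (hD : IsPlanarDrawing (contractGraph G v u) fun w : {w : V // w ≠ v} => f w) :
    IsPlanarDrawing G f := by
  have hinj : Function.Injective f := by
    intro a b hab
    by_cases ha : a = v
    · by_contra hne
      rw [ha] at hab hne
      exact h.apply_ne hu (Ne.symm hne) hab.symm
    by_cases hb : b = v
    · rw [hb] at hab
      exact (h.apply_ne hu ha hab).elim
    have := @hD.injective ⟨a, ha⟩ ⟨b, hb⟩ hab
    exact congrArg Subtype.val this
  refine ⟨hinj, ?_, ?_⟩
  · intro x y w hxy hwx hwy hm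
    by_cases hx : x = v
    · subst hx
      exact h.not_mem_segment_left hl hxy hwx hwy hm
    by_cases hy : y = v
    · subst hy
      rw [segment_symm] at hm
      exact h.not_mem_segment_left hl hxy.symm hwy hwx hm
    by_cases hw : w = v
    · subst hw
      by_cases hlink : ∀ z, G.Adj w z → s(x, y) ≠ s(z, σ z)
      · have ho := mem_openSegment_of_ne_left_right (fun e => hwx (hinj e).symm)
          (fun e => hwy (hinj e).symm) hm
        exact (h.edges x y hxy hx hy hlink _ ho).not_mem_segment h.star hu (left_mem_segment ℝ _ _)
      push Not at hlink
      obtain ⟨z, hz, he⟩ := hlink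
      have h3 : f w ∈ segment ℝ (f z) (f (σ z)) := by
        rw [Sym2.eq_iff] at he
        rcases he with ⟨rfl, rfl⟩ | ⟨rfl, rfl⟩
        · exact hm
        · rw [segment_symm]; exact hm
      have h0 := orient_eq_zero_of_mem_segment h3
      rw [orient_rotate] at h0
      exact (h.star.pos z hz).ne' h0
    exact hD.vertex_edge ⟨x, hx⟩ ⟨y, hy⟩ ⟨w, hw⟩ (contractGraph_adj_of_adj hx hy hxy)
      (fun e => hwx (congrArg Subtype.val e)) (fun e => hwy (congrArg Subtype.val e)) hm
  · have key : ∀ y a b, G.Adj v y → G.Adj a b → s(v, y) ≠ s(a, b) →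
        Disjoint (openSegment ℝ (f v) (f y)) (openSegment ℝ (f a) (f b)) := by
      intro y a b hy hab hne
      by_cases ha : a = v
      · subst ha
        exact h.disjoint_spokes hl hy hab (by rintro rfl; exact hne rfl)
      by_cases hb : b = v
      · subst hb
        rw [openSegment_symm ℝ (f a)]
        exact h.disjoint_spokes hl hy hab.symm (by rintro rfl; exact hne Sym2.eq_swap)
      exact h.disjoint_spoke hy hab ha hb
    intro x y a b hxy hab hne
    by_cases hx : x = v
    · subst hx
      exact key y a b hxy hab hne
    by_cases hy : y = v
    · subst hy
      rw [openSegment_symm ℝ (f x)]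
      exact key x a b hxy.symm hab (by rwa [Sym2.eq_swap])
    by_cases ha : a = v
    · subst ha
      exact (key b x y hab hxy hne.symm).symm
    by_cases hb : b = v
    · subst hb
      rw [openSegment_symm ℝ (f a)]
      exact (key a x y hab.symm hxy (by rw [Sym2.eq_swap]; exact hne.symm)).symm
    refine hD.edge_edge ⟨x, hx⟩ ⟨y, hy⟩ ⟨a, ha⟩ ⟨b, hb⟩ (contractGraph_adj_of_adj hx hy hxy)
      (contractGraph_adj_of_adj ha hb hab) fun e => hne ?_
    exact congrArg (Sym2.map Subtype.val) e

/-- Link edges are edges of the contracted graph, so at no time can another vertex, or an interior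
point of another edge, lie on them. Hence nothing enters the link polygon. -/
theorem isLinkDrawing_of_continuous [Finite V] {f : ℝ → V → ℂ} (hl : IsShortLink G v σ)
    (hu : G.Adj v u) (hf : ∀ w, Continuous fun t => f t w)
    (hpos : ∀ t ∈ Set.Icc (0 : ℝ) 1, ∀ x, G.Adj v x → 0 < orient (f t v) (f t x) (f t (σ x)))
    (hD : ∀ t ∈ Set.Icc (0 : ℝ) 1,
      IsPlanarDrawing (contractGraph G v u) fun w : {w : V // w ≠ v} => f t w)
    (h0 : IsLinkDrawing G v σ (f 0)) : ∀ t ∈ Set.Icc (0 : ℝ) 1, IsLinkDrawing G v σ (f t) := by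
  have hs := isStar_of_continuous hl hf hpos h0.star
  intro t ht
  refine ⟨hs t ht, ?_, ?_⟩
  · intro w hwv hw
    refine isOutside_of_continuous hl hu hf (hf w) hs ?_ (h0.vertices w hwv hw) t ht
    intro s hs' x hx
    have hσx := hl.adj_next x hx
    refine (hD s hs').vertex_edge ⟨x, hx.ne'⟩ ⟨σ x, hσx.ne'⟩ ⟨w, hwv⟩
      (contractGraph_adj_of_adj _ _ (hl.adj x hx)) ?_ ?_
    · intro e
      have : w = x := congrArg Subtype.val e
      exact hw (this ▸ hx)
    · intro e
      have : w = σ x := congrArg Subtype.val e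
      exact hw (this ▸ hσx)
  · intro a b hab ha hb hlink z hz
    obtain ⟨c, c0, c1, hc⟩ := exists_of_mem_openSegment hz
    -- The point of the moving edge with fixed ratio `c` is followed back to time 0.
    have hz' : z = f t a + c • (f t b - f t a) := by rw [← hc]; ring
    have hmem : ∀ s, f s a + c • (f s b - f s a) ∈ openSegment ℝ (f s a) (f s b) := fun s =>
      sub_smul_mem_openSegment c0 c1 (by ring)
    rw [hz']
    refine isOutside_of_continuous (z := fun s => f s a + c • (f s b - f s a)) hl hu hf
      ((hf a).add (((hf b).sub (hf a)).const_smul c)) hs ?_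
      (h0.edges a b hab ha hb hlink _ (hmem 0)) t ht
    intro s hs' x hx hm
    have hσx := hl.adj_next x hx
    have := (hD s hs').eq_of_mem_openSegment (x := ⟨a, ha⟩) (y := ⟨b, hb⟩) (x' := ⟨x, hx.ne'⟩)
      (y' := ⟨σ x, hσx.ne'⟩) (contractGraph_adj_of_adj _ _ hab)
      (contractGraph_adj_of_adj _ _ (hl.adj x hx)) (hmem s) hm
    exact hlink x hx (congrArg (Sym2.map Subtype.val) this)

end LinkDrawing

/-! ### One step of the relative position: two linear inequalities in one unknown. -/

section NextPosition

/-- A solution `γ` of `0 < A₀ + γ * A₁` and `0 < B₀ + γ * B₁`, under suitable assumptions. -/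
noncomputable def shiftAmount (A₀ A₁ B₀ B₁ : ℝ) : ℝ :=
  if A₁ * B₁ < 0 then -(A₀ / A₁ + B₀ / B₁) / 2
  else (1 + A₀ * A₀) / A₁ + (1 + B₀ * B₀) / B₁

/-- The direction in which `a` or `b` moves. -/
noncomputable def shiftDirection (a b a' b' : ℂ) : ℂ :=
  if 0 < (a' - a).re * (a' - a).re + (a' - a).im * (a' - a).im then a' - a else b' - b

/-- Given a vector `r` in the cone left of `a` and right of `b`, a vector in the cone left of `a'`
and right of `b'`. -/
noncomputable def nextPosition (a b a' b' r : ℂ) : ℂ :=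
  r + shiftAmount (cross a' r) (cross a' (shiftDirection a b a' b')) (cross r b')
    (cross (shiftDirection a b a' b') b') • shiftDirection a b a' b'

/-- Otherwise the root `-c / α` of the affine function would lie in the unit interval. -/
theorem mul_add_pos_of_ne_zero {c α : ℝ} (hc : c ≠ 0)
    (h : ∀ t ∈ Set.Icc (0 : ℝ) 1, c + t * α ≠ 0) : 0 < c * (c + α) := by
  by_contra hneg
  rw [not_lt] at hneg
  have hc2 : 0 < c * c := mul_self_pos.2 hc
  have h1 : c * α < 0 := by nlinarith
  have hα : α ≠ 0 := by rintro rfl; simp at h1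
  have hα2 : 0 < α * α := mul_self_pos.2 hα
  have h2 : 0 ≤ α * (α + c) := by
    have : 0 ≤ (c * c) * (α * (α + c)) := by
      have := mul_nonneg_of_nonpos_of_nonpos h1.le hneg
      nlinarith
    exact nonneg_of_mul_nonneg_right this hc2
  have e : -c / α = -(c * α) / (α * α) := by field_simp
  refine h (-c / α) ⟨?_, ?_⟩ ?_
  · rw [e]; exact div_nonneg (by linarith) hα2.le
  · rw [e, div_le_one hα2]; nlinarith
  · field_simp; ring

/-- Here `a` moves along its own line through the origin without reaching the origin, so its
direction does not change. -/
theorem cross_pos_of_cross_eq_zero {a a' r δ : ℂ} {α : ℝ} (h : 0 < cross a r)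
    (ha : a' - a = α • δ) (hz : ∀ t ∈ Set.Icc (0 : ℝ) 1, a + t • (a' - a) ≠ 0)
    (h0 : cross a δ = 0) : 0 < cross a' r := by
  have ha' : a' = a + α • δ := by rw [← ha]; ring
  by_cases hδ : δ = 0
  · rw [ha', hδ, smul_zero, add_zero]; exact h
  have h0' : cross δ a = 0 := by rw [cross_swap, h0, neg_zero]
  obtain ⟨c, hc⟩ := exists_smul_of_cross_eq_zero hδ h0'
  have e : ∀ t : ℝ, a + t • (a' - a) = (c + t * α) • δ := by
    intro t; rw [ha, hc, smul_smul, ← add_smul]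
  have hc0 : c ≠ 0 := by
    rintro rfl
    rw [hc, zero_smul] at h
    simp [cross] at h
  have hpos := mul_add_pos_of_ne_zero hc0 fun t ht h1 => hz t ht (by rw [e, h1, zero_smul])
  have e1 := e 1
  rw [one_smul, one_mul] at e1
  have e2 : a' = (c + α) • δ := by rw [← e1]; ring
  rw [hc, cross_smul_left] at h
  rw [e2, cross_smul_left]
  have : 0 < c * c * ((c + α) * cross δ r) := by
    have := mul_pos hpos h
    nlinarith
  exact pos_of_mul_pos_right this (mul_self_nonneg c)

/-- A change of sign would make the two moving vectors parallel at some time. They stay strictly on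
the same side of the line of `δ`, because their determinants with `δ` are constant, so they would
then be positive multiples of each other. -/
theorem cross_mul_cross_pos {a b δ : ℂ} {α β : ℝ} (hne : cross a b ≠ 0)
    (h : cross a δ * cross δ b < 0)
    (hdir : ∀ t ∈ Set.Icc (0 : ℝ) 1, ∀ c > (0 : ℝ), b + t • β • δ ≠ c • (a + t • α • δ)) :
    0 < cross a b * cross (a + α • δ) (b + β • δ) := by
  set g : ℝ → ℝ := fun t => cross a b * cross (a + t • α • δ) (b + t • β • δ) with hg
  have hcont : Continuous g := continuous_const.mul (continuous_cross (by fun_prop) (by fun_prop))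
  have key := not_of_isClosed_of_cover (P := fun t => g t ≤ 0) (Q := fun t => 0 ≤ g t)
    (isClosed_le hcont continuous_const) (isClosed_le continuous_const hcont)
    (fun t _ => le_total _ _) ?_ ?_ 1 ⟨zero_le_one, le_rfl⟩
  · simpa [hg] using key
  · intro t ht h1 h2
    have h3 : cross (a + t • α • δ) (b + t • β • δ) = 0 :=
      (mul_eq_zero.1 (le_antisymm h1 h2)).resolve_left hne
    have ea : cross (a + t • α • δ) δ = cross a δ := by simp [cross]; ring
    have eb : cross δ (b + t • β • δ) = cross δ b := by simp [cross]; ring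
    have ha0 : a + t • α • δ ≠ 0 := by
      intro h0
      rw [h0] at ea
      rw [← ea] at h
      simp [cross] at h
    obtain ⟨c, hc⟩ := exists_smul_of_cross_eq_zero ha0 h3
    refine hdir t ht c ?_ hc
    rw [hc, cross_smul_right, cross_swap, ea] at eb
    rw [← eb] at h
    have : 0 < c * (cross a δ * cross a δ) := by linarith
    exact pos_of_mul_pos_left this (mul_self_nonneg _)
  · have : 0 < cross a b * cross a b := mul_self_pos.2 hne
    simpa [hg] using this

/-- If `A₁` and `B₁` have opposite signs, the solutions form a bounded interval with ends `-A₀ / A₁`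
and `-B₀ / B₁`, and `γ` is its midpoint. Its ends are in the right order because `E` has the same
sign as its initial value `E₀`: both contain the factor `cross r δ`, and `cross_mul_cross_pos`
compares the other factors. Otherwise a `γ` of the right sign and large absolute value works: `1 +
A₀ * A₀` exceeds `-A₀`, and the other summand does not hurt. A coefficient that is zero contributes
nothing, as `x / 0 = 0`, and its inequality does not depend on `γ`. -/
theorem shiftAmount_spec {a b r δ : ℂ} {α β : ℝ} (hr1 : 0 < cross a r) (hr2 : 0 < cross r b)
    (ha0 : ∀ t ∈ Set.Icc (0 : ℝ) 1, a + t • α • δ ≠ 0)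
    (hb0 : ∀ t ∈ Set.Icc (0 : ℝ) 1, b + t • β • δ ≠ 0)
    (hdir : ∀ t ∈ Set.Icc (0 : ℝ) 1, ∀ c > (0 : ℝ), b + t • β • δ ≠ c • (a + t • α • δ)) :
    0 < cross (a + α • δ) (r + shiftAmount (cross (a + α • δ) r) (cross (a + α • δ) δ)
        (cross r (b + β • δ)) (cross δ (b + β • δ)) • δ) ∧
      0 < cross (r + shiftAmount (cross (a + α • δ) r) (cross (a + α • δ) δ)
        (cross r (b + β • δ)) (cross δ (b + β • δ)) • δ) (b + β • δ) := by
  have ea : cross (a + α • δ) δ = cross a δ := by simp [cross]; ring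
  have eb : cross δ (b + β • δ) = cross δ b := by simp [cross]; ring
  rw [ea, eb]
  set A₁ := cross a δ with hA1
  set B₁ := cross δ b with hB1
  set A₀ := cross (a + α • δ) r with hA0
  set B₀ := cross r (b + β • δ) with hB0
  set γ := shiftAmount A₀ A₁ B₀ B₁ with hγ
  have e1 : cross (a + α • δ) (r + γ • δ) = A₀ + γ * A₁ := by
    rw [hA0, hA1]; simp only [cross, Complex.add_re, Complex.add_im, Complex.smul_re, Complex.smul_im, smul_eq_mul]; ring
  have e2 : cross (r + γ • δ) (b + β • δ) = B₀ + γ * B₁ := by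
    rw [hB0, hB1]; simp only [cross, Complex.add_re, Complex.add_im, Complex.smul_re, Complex.smul_im, smul_eq_mul]; ring
  rw [e1, e2]
  by_cases hs : A₁ * B₁ < 0
  · have hγ' : γ = -(A₀ / A₁ + B₀ / B₁) / 2 := if_pos hs
    have hA : A₁ ≠ 0 := left_ne_zero_of_mul hs.ne
    have hB : B₁ ≠ 0 := right_ne_zero_of_mul hs.ne
    set E := B₀ * A₁ - A₀ * B₁ with hE
    set E₀ := cross r b * A₁ - cross a r * B₁ with hE0
    have q1 : E = cross (a + α • δ) (b + β • δ) * cross r δ := by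
      rw [hE, hA0, hB0, hA1, hB1]
      simp only [cross, Complex.add_re, Complex.add_im, Complex.smul_re, Complex.smul_im, smul_eq_mul]; ring
    have q0 : E₀ = cross a b * cross r δ := by
      rw [hE0, hA1, hB1]; simp only [cross]; ring
    have f1 : A₀ + γ * A₁ = -E / (2 * B₁) := by rw [hγ', hE]; field_simp; ring
    have f2 : B₀ + γ * B₁ = E / (2 * A₁) := by rw [hγ', hE]; field_simp; ring
    have hE0ne : E₀ ≠ 0 := by
      rcases mul_neg_iff.1 hs with ⟨h1, h2⟩ | ⟨h1, h2⟩
      · have := mul_pos hr2 h1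
        have := mul_neg_of_pos_of_neg hr1 h2
        intro h; linarith
      · have := mul_neg_of_pos_of_neg hr2 h1
        have := mul_pos hr1 h2
        intro h; linarith
    have hrδ : cross r δ ≠ 0 := by rw [q0] at hE0ne; exact right_ne_zero_of_mul hE0ne
    have hab : cross a b ≠ 0 := by rw [q0] at hE0ne; exact left_ne_zero_of_mul hE0ne
    have hpos := cross_mul_cross_pos hab hs hdir
    have hEE : 0 < E₀ * E := by
      have : 0 < cross r δ * cross r δ := mul_self_pos.2 hrδ
      rw [q0, q1]; nlinarith [mul_pos hpos this]
    rw [f1, f2]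
    rcases mul_neg_iff.1 hs with ⟨h1, h2⟩ | ⟨h1, h2⟩
    · have k1 := mul_pos hr2 h1
      have k2 := mul_neg_of_pos_of_neg hr1 h2
      have hEpos : 0 < E := pos_of_mul_pos_right hEE (by rw [hE0]; linarith)
      exact ⟨div_pos_of_neg_of_neg (by linarith) (by linarith), by positivity⟩
    · have k1 := mul_neg_of_pos_of_neg hr2 h1
      have k2 := mul_pos hr1 h2
      have hE0n : E₀ < 0 := by rw [hE0]; linarith
      have hEneg : E < 0 := by
        by_contra hh
        have := mul_nonpos_of_nonpos_of_nonneg hE0n.le (not_lt.1 hh)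
        linarith
      exact ⟨div_pos (by linarith) (by linarith), div_pos_of_neg_of_neg hEneg (by linarith)⟩
  · have hγ' : γ = (1 + A₀ * A₀) / A₁ + (1 + B₀ * B₀) / B₁ := if_neg hs
    rw [not_lt] at hs
    have hdiv : 0 ≤ A₁ / B₁ := by
      have : A₁ / B₁ = A₁ * B₁ / (B₁ * B₁) := by
        by_cases hB : B₁ = 0
        · simp [hB]
        · field_simp
      rw [this]; exact div_nonneg hs (mul_self_nonneg _)
    have hdiv' : 0 ≤ B₁ / A₁ := by
      rw [← inv_div]; exact inv_nonneg.2 hdiv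
    constructor
    · by_cases hA : A₁ = 0
      · rw [hA, mul_zero, add_zero]
        exact cross_pos_of_cross_eq_zero (δ := δ) (α := α) hr1 (by ring)
          (by intro t ht; rw [add_sub_cancel_left]; exact ha0 t ht) hA
      · have : A₀ + γ * A₁ = (A₀ + 1 + A₀ * A₀) + (1 + B₀ * B₀) * (A₁ / B₁) := by
          rw [hγ']; field_simp; ring
        rw [this]
        have h1 : 0 < A₀ + 1 + A₀ * A₀ := by nlinarith [sq_nonneg (A₀ + 1)]
        have h2 : 0 ≤ (1 + B₀ * B₀) * (A₁ / B₁) :=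
          mul_nonneg (by nlinarith [mul_self_nonneg B₀]) hdiv
        linarith
    · by_cases hB : B₁ = 0
      · rw [hB, mul_zero, add_zero]
        rw [cross_swap] at hr2
        have h1 : 0 < cross b (-r) := by simp [cross] at hr2 ⊢; linarith
        have := cross_pos_of_cross_eq_zero (a' := b + β • δ) (δ := δ) (α := β) h1 (by ring)
          (by intro t ht; rw [add_sub_cancel_left]; exact hb0 t ht)
          (by rw [cross_swap, ← hB1, hB, neg_zero])
        rw [hB0]
        have e : cross r (b + β • δ) = cross (b + β • δ) (-r) := by simp [cross]; ring
        rw [e]; exact this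
      · have : B₀ + γ * B₁ = (B₀ + 1 + B₀ * B₀) + (1 + A₀ * A₀) * (B₁ / A₁) := by
          rw [hγ']; field_simp; ring
        rw [this]
        have h1 : 0 < B₀ + 1 + B₀ * B₀ := by nlinarith [sq_nonneg (B₀ + 1)]
        have h2 : 0 ≤ (1 + A₀ * A₀) * (B₁ / A₁) :=
          mul_nonneg (by nlinarith [mul_self_nonneg A₀]) hdiv'
        linarith

theorem nextPosition_spec {a b a' b' r l : ℂ} {α β : ℝ} (ha : a' - a = α • l) (hb : b' - b = β • l)
    (hr1 : 0 < cross a r) (hr2 : 0 < cross r b)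
    (ha0 : ∀ t ∈ Set.Icc (0 : ℝ) 1, a + t • (a' - a) ≠ 0)
    (hb0 : ∀ t ∈ Set.Icc (0 : ℝ) 1, b + t • (b' - b) ≠ 0)
    (hdir : ∀ t ∈ Set.Icc (0 : ℝ) 1, ∀ c > (0 : ℝ),
      b + t • (b' - b) ≠ c • (a + t • (a' - a))) :
    0 < cross a' (nextPosition a b a' b' r) ∧ 0 < cross (nextPosition a b a' b' r) b' ∧
      ∃ c : ℝ, nextPosition a b a' b' r - r = c • l := by
  set δ := shiftDirection a b a' b' with hδ
  have hsq : 0 < (a' - a).re * (a' - a).re + (a' - a).im * (a' - a).im ↔ a' - a ≠ 0 := by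
    rw [← Complex.normSq_apply, Complex.normSq_pos]
  -- The unit vector `l` is not part of the input of the algorithm. The first nonzero relative
  -- displacement replaces it; if both vanish, then `δ = 0` and `r` stays.
  obtain ⟨α', β', d, h1, h2, h3⟩ : ∃ α' β' d : ℝ, a' - a = α' • δ ∧ b' - b = β' • δ ∧ δ = d • l := by
    by_cases h0 : a' - a = 0
    · have : δ = b' - b := if_neg (by rw [hsq]; exact not_not.2 h0)
      exact ⟨0, 1, β, by rw [zero_smul, h0], by rw [one_smul, this], by rw [this, hb]⟩
    · have : δ = a' - a := if_pos (hsq.2 h0)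
      have hα : α ≠ 0 := by rintro rfl; rw [zero_smul] at ha; exact h0 ha
      refine ⟨1, β / α, α, by rw [one_smul, this], ?_, by rw [this, ha]⟩
      rw [this, ha, hb, smul_smul, div_mul_cancel₀ _ hα]
  have ha' : a' = a + α' • δ := by rw [← h1]; ring
  have hb' : b' = b + β' • δ := by rw [← h2]; ring
  have key := shiftAmount_spec (α := α') (β := β') (δ := δ) hr1 hr2 (by rwa [← h1])
    (by rwa [← h2]) (by rwa [← h1, ← h2])
  rw [← ha', ← hb'] at key
  refine ⟨key.1, key.2, ?_⟩
  rw [nextPosition, add_sub_cancel_left, ← hδ, h3, smul_smul]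
  exact ⟨_, rfl⟩

end NextPosition

/-! ### Motion of `v` close to `u`. -/

section Conversion

variable {V : Type*} {G : SimpleGraph V} {v u : V} {σ : V → V}

theorem linearMorph_apply {W : Type*} (p q : W → ℂ) (t : ℝ) (w : W) :
    linearMorph p q t w = p w + t • (q w - p w) := by
  simp [linearMorph, AffineMap.lineMap_apply, add_comm]

theorem linearMorph_zero {W : Type*} (p q : W → ℂ) : linearMorph p q 0 = p := by
  funext w; rw [linearMorph_apply, zero_smul, add_zero]

theorem linearMorph_one {W : Type*} (p q : W → ℂ) : linearMorph p q 1 = q := by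
  funext w; rw [linearMorph_apply, one_smul]; ring

/-- The quadratic term in `t` is a multiple of `cross l l = 0`. Hence positivity or a lower bound at
both ends of a unidirectional step holds during the whole step. -/
theorem cross_affine {a a' r r' l : ℂ} {α γ : ℝ} (ha : a' - a = α • l) (hr : r' - r = γ • l)
    (t : ℝ) : cross (a + t • (a' - a)) (r + t • (r' - r)) =
      (1 - t) * cross a r + t * cross a' r' := by
  have ha' : a' = a + α • l := by rw [← ha]; ring
  have hr' : r' = r + γ • l := by rw [← hr]; ring
  rw [ha', hr']
  simp only [cross, Complex.add_re, Complex.add_im, Complex.smul_re, Complex.smul_im, smul_eq_mul,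
    Complex.sub_re, Complex.sub_im]
  ring

/-- The drawing `d` of the contracted graph, with `v` added at the point `z`. -/
def extendDrawing [DecidableEq V] (d : {w : V // w ≠ v} → ℂ) (z : ℂ) : V → ℂ :=
  fun w => if h : w = v then z else d ⟨w, h⟩

theorem extendDrawing_self [DecidableEq V] (d : {w : V // w ≠ v} → ℂ) (z : ℂ) :
    extendDrawing d z v = z := dif_pos rfl

theorem extendDrawing_of_ne [DecidableEq V] (d : {w : V // w ≠ v} → ℂ) (z : ℂ) {w : V}
    (h : w ≠ v) : extendDrawing d z w = d ⟨w, h⟩ := dif_neg h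

theorem extendDrawing_subtype [DecidableEq V] (d : {w : V // w ≠ v} → ℂ) (z : ℂ)
    (w : {w : V // w ≠ v}) : extendDrawing d z w = d w := dif_neg w.2

/-- Twice the area of the triangle `w x y` is at most the base `x y` times the distance from `w` to
any point on its line. -/
theorem le_dist_of_mem_line {x y z w : ℂ} {β Λ : ℝ} (hΛ : 0 < Λ) (h : β ≤ orient w x y)
    (hl : ‖y - x‖ ≤ Λ) (hz : z ∈ affineSpan ℝ {x, y}) : β / Λ ≤ dist z w := by
  obtain ⟨c, rfl⟩ := mem_affineSpan_pair_iff_exists_lineMap_eq.1 hz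
  rw [AffineMap.lineMap_apply, dist_eq_norm, div_le_iff₀ hΛ]
  have e : orient w x y = cross ((c • (y -ᵥ x) +ᵥ x) - w) (y - x) := by
    simp [orient, cross]; ring
  rw [e] at h
  calc β ≤ _ := h
    _ ≤ _ := le_abs_self _
    _ ≤ _ := abs_cross_le _ _
    _ ≤ _ := by gcongr

/-- The neighbors of `v` before and after `u` span a cone at `u`. If `v` is in this cone and close
to `u`, then it is in a suitable position. -/
theorem orient_pos_of_close {f : V → ℂ} {b : V} {B : ℝ} (hB : 0 < B) (hl : IsShortLink G v σ)
    (hb : G.Adj v b) (hbu : σ b = u) (hu : G.Adj v u)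
    (ho : ∀ x, G.Adj v x → x ≠ u → σ x ≠ u → 1 / B ≤ orient (f u) (f x) (f (σ x)))
    (hn : ∀ x, G.Adj v x → x ≠ u → σ x ≠ u → ‖f (σ x) - f x‖ ≤ B)
    (hv : ‖f v - f u‖ < 1 / (B * B)) (h1 : 0 < cross (f (σ u) - f u) (f v - f u))
    (h2 : 0 < cross (f v - f u) (f b - f u)) :
    ∀ x, G.Adj v x → 0 < orient (f v) (f x) (f (σ x)) := by
  intro x hx
  by_cases hxu : x = u
  · subst hxu
    have : orient (f v) (f x) (f (σ x)) = cross (f (σ x) - f x) (f v - f x) := by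
      simp [orient, cross]; ring
    rw [this]; exact h1
  by_cases hσ : σ x = u
  · have : x = b := hl.inj x b hx hb (by rw [hσ, hbu])
    subst this
    have : orient (f v) (f x) (f (σ x)) = cross (f v - f u) (f x - f u) := by
      rw [hσ]; simp [orient, cross]; ring
    rw [this]; exact h2
  -- Moving the apex from `u` to `v` changes the determinant by at most `‖f v - f u‖ * B < 1 / B`.
  have e : orient (f v) (f x) (f (σ x)) =
      orient (f u) (f x) (f (σ x)) - cross (f v - f u) (f (σ x) - f x) := by
    simp [orient, cross]; ring
  have k1 : cross (f v - f u) (f (σ x) - f x) ≤ ‖f v - f u‖ * ‖f (σ x) - f x‖ :=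
    (le_abs_self _).trans (abs_cross_le _ _)
  have k2 : ‖f v - f u‖ * ‖f (σ x) - f x‖ ≤ ‖f v - f u‖ * B :=
    mul_le_mul_of_nonneg_left (hn x hx hxu hσ) (norm_nonneg _)
  have k3 : ‖f v - f u‖ * B < 1 / (B * B) * B := mul_lt_mul_of_pos_right hv hB
  have k4 : 1 / (B * B) * B = 1 / B := by field_simp
  rw [e]
  linarith [ho x hx hxu hσ]

/-- A determinant of at least `1 / B` over a base of length at most `B` gives a distance of at least
`1 / (B * B)` to the line. -/
theorem inSector_of_close {p f : V → ℂ} {B : ℝ} (hB : 0 < B) (hp : IsPlanarDrawing G p)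
    (hσ : ∀ x, G.Adj v x → IsCcwFace G p v x (σ x))
    (ho : ∀ x, G.Adj v x → x ≠ u → σ x ≠ u → 1 / B ≤ orient (f u) (f x) (f (σ x)))
    (hn : ∀ x, G.Adj v x → x ≠ u → σ x ≠ u → ‖f (σ x) - f x‖ ≤ B)
    (hv : ‖f v - f u‖ < 1 / (B * B)) : InSector G p v u (1 / (B * B)) f := by
  have key : ∀ x y, IsCcwFace G p v x y → x ≠ u → y ≠ u →
      ∀ z ∈ affineSpan ℝ {f x, f y}, 1 / (B * B) ≤ dist z (f u) := by
    intro x y hf hx hy z hz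
    have hxv := hf.1.1
    obtain rfl : y = σ x := hf.right_unique hp (hσ x hxv)
    have := le_dist_of_mem_line hB (ho x hxv hx hy) (hn x hxv hx hy) hz
    rwa [div_div] at this
  refine ⟨by rwa [dist_eq_norm], fun x y hf hx hy z hz => ?_⟩
  rcases hf.ccw_or hp with h | h
  · exact key x y h hx hy z hz
  · refine key y x h hy hx z ?_
    rwa [Set.pair_comm]

theorem isUnidirectional_of_eq {p q : V → ℂ} (h : ∀ w, w ≠ v → q w = p w) :
    IsUnidirectional p q := by
  by_cases h0 : q v - p v = 0
  · refine ⟨1, by simp, fun w => ⟨0, ?_⟩⟩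
    by_cases hw : w = v
    · subst hw; rw [sub_eq_zero] at h0; simp [h0]
    · simp [h w hw]
  · refine ⟨(‖q v - p v‖⁻¹ : ℝ) • (q v - p v), ?_, fun w => ?_⟩
    · rw [norm_smul, norm_inv, norm_norm, inv_mul_cancel₀ (norm_ne_zero_iff.2 h0)]
    · by_cases hw : w = v
      · subst hw
        refine ⟨‖q w - p w‖, ?_⟩
        rw [smul_smul, mul_inv_cancel₀ (norm_ne_zero_iff.2 h0), one_smul]; ring
      · exact ⟨0, by simp [h w hw]⟩

/-- The motion of a single vertex in the kernel of its link polygon. -/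
theorem orient_pos_linearMorph {p q : V → ℂ} (hl : IsShortLink G v σ)
    (h : ∀ w, w ≠ v → q w = p w)
    (hp : ∀ x, G.Adj v x → 0 < orient (p v) (p x) (p (σ x)))
    (hq : ∀ x, G.Adj v x → 0 < orient (q v) (q x) (q (σ x))) :
    ∀ t ∈ Set.Icc (0 : ℝ) 1, ∀ x, G.Adj v x →
      0 < orient (linearMorph p q t v) (linearMorph p q t x) (linearMorph p q t (σ x)) := by
  rintro t ⟨h0, h1⟩ x hx
  have hp' := hp x hx
  have hq' := hq x hx
  simp only [linearMorph_apply]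
  rw [h x hx.ne', h (σ x) (hl.adj_next x hx).ne'] at hq' ⊢
  have e : orient (p v + t • (q v - p v)) (p x + t • (p x - p x)) (p (σ x) + t • (p (σ x) - p (σ x)))
      = (1 - t) * orient (p v) (p x) (p (σ x)) + t * orient (q v) (p x) (p (σ x)) := by
    simp [orient, cross]; ring
  rw [e]
  rcases h0.eq_or_lt with rfl | h0
  · simpa using hp'
  · have := mul_pos h0 hq'
    have := mul_nonneg (sub_nonneg.2 h1) hp'.le
    linarith

/-- An orientation is preserved by a planar motion. -/
theorem orient_pos_of_planar {W : Type*} {H : SimpleGraph W} {p q : W → ℂ}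
    (h : ∀ t ∈ Set.Icc (0 : ℝ) 1, IsPlanarDrawing H (linearMorph p q t)) {x y z : W}
    (hxy : H.Adj x y) (hyz : H.Adj y z) (hzx : H.Adj z x) (h0 : 0 < orient (p x) (p y) (p z)) :
    0 < orient (q x) (q y) (q z) := by
  have hf : ∀ w, Continuous fun t : ℝ => linearMorph p q t w := by
    intro w; simp only [linearMorph_apply]; fun_prop
  have hc : Continuous fun t => orient (linearMorph p q t x) (linearMorph p q t y)
    (linearMorph p q t z) := continuous_orient (hf _) (hf _) (hf _)
  have := not_of_isClosed_of_cover
    (P := fun t => orient (linearMorph p q t x) (linearMorph p q t y) (linearMorph p q t z) ≤ 0)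
    (Q := fun t => 0 ≤ orient (linearMorph p q t x) (linearMorph p q t y) (linearMorph p q t z))
    (isClosed_le hc continuous_const) (isClosed_le continuous_const hc)
    (fun t _ => le_total _ _)
    (fun t ht h1 h2 => (h t ht).orient_ne_zero hxy hyz hzx (le_antisymm h1 h2))
    (by simpa [linearMorph_apply] using h0) 1 ⟨zero_le_one, le_rfl⟩
  simpa [linearMorph_apply] using this

/-- The next position of `v` relative to `u`, given the drawings `d` and `d'` of the rest and the
neighbors `a` and `b` of `v` after and before `u`. -/
noncomputable def relativeStep {W : Type*} (u a b : W) (d d' : W → ℂ) (r : ℂ) : ℂ :=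
  nextPosition (d a - d u) (d b - d u) (d' a - d' u) (d' b - d' u) r

/-- Planarity provides the nondegeneracy: the edges `u a` and `u b` never shrink to a point and
never have the same direction. -/
theorem relativeStep_spec {W : Type*} {H : SimpleGraph W} {d d' : W → ℂ}
    (h : ∀ t ∈ Set.Icc (0 : ℝ) 1, IsPlanarDrawing H (linearMorph d d' t)) {u a b : W}
    (ha : H.Adj u a) (hb : H.Adj u b) (hab : a ≠ b) {l : ℂ}
    (hd : ∀ w, ∃ c : ℝ, d' w = d w + c • l) {r : ℂ} (h1 : 0 < cross (d a - d u) r)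
    (h2 : 0 < cross r (d b - d u)) :
    0 < cross (d' a - d' u) (relativeStep u a b d d' r) ∧
      0 < cross (relativeStep u a b d d' r) (d' b - d' u) ∧
      ∃ c : ℝ, relativeStep u a b d d' r - r = c • l := by
  obtain ⟨cu, hcu⟩ := hd u
  obtain ⟨ca, hca⟩ := hd a
  obtain ⟨cb, hcb⟩ := hd b
  have e : ∀ w t, (d w - d u) + t • ((d' w - d' u) - (d w - d u)) =
      linearMorph d d' t w - linearMorph d d' t u := by
    intro w t
    simp only [linearMorph_apply]
    apply Complex.ext <;> simp <;> ring
  refine nextPosition_spec (α := ca - cu) (β := cb - cu) ?_ ?_ h1 h2 ?_ ?_ ?_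
  · rw [hca, hcu, sub_smul]; ring
  · rw [hcb, hcu, sub_smul]; ring
  · intro t ht h0
    rw [e, sub_eq_zero] at h0
    exact ha.ne' ((h t ht).injective h0)
  · intro t ht h0
    rw [e, sub_eq_zero] at h0
    exact hb.ne' ((h t ht).injective h0)
  · intro t ht c hc h0
    rw [e, e] at h0
    exact (h t ht).sub_ne_smul_sub ha hb hab hc h0

theorem norm_affine_lt {x y : ℂ} {c t : ℝ} (hx : ‖x‖ < c) (hy : ‖y‖ < c) (h0 : 0 ≤ t) (h1 : t ≤ 1) :
    ‖x + t • (y - x)‖ < c := by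
  have := (convex_ball (0 : ℂ) c) (x := x) (by simpa using hx) (y := y) (by simpa using hy)
    (a := 1 - t) (b := t) (by linarith) h0 (by ring)
  rw [mem_ball_zero_iff] at this
  have e : x + t • (y - x) = (1 - t) • x + t • y := by
    rw [sub_smul, one_smul, smul_sub]; ring
  rwa [e]

theorem norm_affine_le {x y : ℂ} {c t : ℝ} (hx : ‖x‖ ≤ c) (hy : ‖y‖ ≤ c) (h0 : 0 ≤ t) (h1 : t ≤ 1) :
    ‖x + t • (y - x)‖ ≤ c := by
  have := (convex_closedBall (0 : ℂ) c) (x := x) (by simpa using hx) (y := y) (by simpa using hy)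
    (a := 1 - t) (b := t) (by linarith) h0 (by ring)
  rw [mem_closedBall_zero_iff] at this
  have e : x + t • (y - x) = (1 - t) • x + t • y := by
    rw [sub_smul, one_smul, smul_sub]; ring
  rwa [e]

theorem affine_pos {x y t : ℝ} (hx : 0 < x) (hy : 0 < y) (h0 : 0 ≤ t) (h1 : t ≤ 1) :
    0 < (1 - t) * x + t * y := by
  rcases h0.eq_or_lt with rfl | h0
  · simpa using hx
  · have := mul_pos h0 hy
    have := mul_nonneg (sub_nonneg.2 h1) hx.le
    linarith

theorem le_affine {c x y t : ℝ} (hx : c ≤ x) (hy : c ≤ y) (h0 : 0 ≤ t) (h1 : t ≤ 1) :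
    c ≤ (1 - t) * x + t * y := by
  have := mul_nonneg (sub_nonneg.2 h1) (sub_nonneg.2 hx)
  have := mul_nonneg h0 (sub_nonneg.2 hy)
  linarith

/-- `v` is close to `u`, in the cone spanned by the neighbors before and after `u`, and the rest
of the link polygon is not close to `u`. -/
structure IsClose (G : SimpleGraph V) (v u : V) (σ : V → V) (b : V) (B : ℝ) (f : V → ℂ) :
    Prop where
  orient_le : ∀ x, G.Adj v x → x ≠ u → σ x ≠ u → 1 / B ≤ orient (f u) (f x) (f (σ x))
  norm_le : ∀ x, G.Adj v x → x ≠ u → σ x ≠ u → ‖f (σ x) - f x‖ ≤ B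
  close : ‖f v - f u‖ < 1 / (B * B)
  left : 0 < cross (f (σ u) - f u) (f v - f u)
  right : 0 < cross (f v - f u) (f b - f u)

/-- Differences of positions also move parallel to `l`, so the determinants are affine in time; the
norm bounds follow from the convexity of balls. -/
theorem IsClose.of_linearMorph {f g : V → ℂ} {b : V} {B : ℝ} (hf : IsClose G v u σ b B f)
    (hg : IsClose G v u σ b B g) {l : ℂ} (hd : ∀ w, ∃ c : ℝ, g w = f w + c • l) :
    ∀ t ∈ Set.Icc (0 : ℝ) 1, IsClose G v u σ b B (linearMorph f g t) := by
  rintro t ⟨h0, h1⟩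
  have hd2 : ∀ x y, ∃ c : ℝ, (g x - g y) - (f x - f y) = c • l := by
    intro x y
    obtain ⟨c, hc⟩ := hd x
    obtain ⟨c', hc'⟩ := hd y
    exact ⟨c - c', by rw [hc, hc', sub_smul]; ring⟩
  have e : ∀ x y, linearMorph f g t x - linearMorph f g t y =
      (f x - f y) + t • ((g x - g y) - (f x - f y)) := by
    intro x y
    simp only [linearMorph_apply]
    apply Complex.ext <;> simp <;> ring
  have ec : ∀ x y x' y', cross (linearMorph f g t x - linearMorph f g t y)
      (linearMorph f g t x' - linearMorph f g t y') =
      (1 - t) * cross (f x - f y) (f x' - f y') + t * cross (g x - g y) (g x' - g y') := by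
    intro x y x' y'
    obtain ⟨α, hα⟩ := hd2 x y
    obtain ⟨β, hβ⟩ := hd2 x' y'
    rw [e, e]
    exact cross_affine hα hβ t
  refine ⟨?_, ?_, ?_, ?_, ?_⟩
  · intro x hx hxu hσu
    rw [orient, ec]
    exact le_affine (hf.orient_le x hx hxu hσu) (hg.orient_le x hx hxu hσu) h0 h1
  · intro x hx hxu hσu
    rw [e]
    exact norm_affine_le (hf.norm_le x hx hxu hσu) (hg.norm_le x hx hxu hσu) h0 h1
  · rw [e]
    exact norm_affine_lt hf.close hg.close h0 h1
  · rw [ec]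
    exact affine_pos hf.left hg.left h0 h1
  · rw [ec]
    exact affine_pos hf.right hg.right h0 h1

end Conversion

/-! ### The morph obtained from a pseudomorph. -/

section Conversion

variable {V : Type*} {G : SimpleGraph V} {v u : V} {σ : V → V}
  {Γ₁ Γ₂ : V → ℂ} {k : ℕ} {D : Fin (k + 1) → {w : V // w ≠ v} → ℂ}

/-- The neighbors of `v`, in cyclic order, in both drawings. -/
theorem exists_rotation [Finite V] (h₁ : IsTriangulation G Γ₁) (h₂ : IsTriangulation G Γ₂)
    (ht : TopologicallyEquivalent G Γ₁ Γ₂) (hN : (G.neighborSet v).ncard ≤ 5)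
    (hP : IsPseudomorph G Γ₁ Γ₂ v u D) :
    ∃ σ : V → V, IsShortLink G v σ ∧ (∀ x, G.Adj v x → IsCcwFace G Γ₁ v x (σ x)) ∧
      ∀ x, G.Adj v x → 0 < orient (Γ₂ v) (Γ₂ x) (Γ₂ (σ x)) := by
  have : ∀ x, ∃ y, G.Adj v x → IsCcwFace G Γ₁ v x y := by
    intro x
    by_cases hx : G.Adj v x
    · obtain ⟨y, hy⟩ := h₁.exists_ccwFace hP.contract.internal hx
      exact ⟨y, fun _ => hy⟩
    · exact ⟨x, fun h => absurd h hx⟩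
  choose σ hσ using this
  exact ⟨σ, IsShortLink.of_faces h₁.planar hσ hN, hσ, fun x hx =>
    ht.orient_pos h₁ h₂ hP.uncontract.internal (hσ x hx)⟩

/-- The link polygon of `v` is star-shaped with respect to `u` in all drawings of the contracted
graph. -/
theorem orient_pos_of_pseudomorph [Finite V] (h₁ : IsTriangulation G Γ₁) (hP : IsPseudomorph G Γ₁ Γ₂ v u D)
    (hσ : ∀ x, G.Adj v x → IsCcwFace G Γ₁ v x (σ x)) (i : Fin (k + 1)) {x : {w : V // w ≠ v}}
    {y : {w : V // w ≠ v}} (hx : G.Adj v x) (hy : y.1 = σ x) (hxu : x.1 ≠ u) (hyu : y.1 ≠ u) :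
    0 < orient (D i ⟨u, hP.contract.adj.ne'⟩) (D i x) (D i y) := by
  have hf := hσ x hx
  rw [← hy] at hf
  have hu := hP.contract.adj
  have hvy : G.Adj v y := hf.1.2.2.1.symm
  have a1 : (contractGraph G v u).Adj ⟨u, hu.ne'⟩ x := contractGraph_adj_target hu hx hxu
  have a2 : (contractGraph G v u).Adj x y := contractGraph_adj_of_adj x.2 y.2 hf.1.2.1
  have a3 : (contractGraph G v u).Adj y ⟨u, hu.ne'⟩ := (contractGraph_adj_target hu hvy hyu).symm
  induction i using Fin.induction with
  | zero =>
    -- The kernel gives only a weak inequality; it is strict because `u x y` is a triangle of the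
    -- contracted graph.
    have h0 := hf.orient_nonneg_of_mem_kernel h₁.planar hP.contract.mem_kernel
    rw [hP.contract.fixed, hP.contract.fixed, hP.contract.fixed]
    refine h0.lt_of_ne' ?_
    have := (hP.morph.planar 0).orient_ne_zero a1 a2 a3
    rwa [hP.contract.fixed, hP.contract.fixed, hP.contract.fixed] at this
  | succ i ih => exact orient_pos_of_planar (hP.morph.planar_during i) a1 a2 a3 ih

theorem ne_of_next (hl : IsShortLink G v σ) {b : V} (hb : G.Adj v b) (hbu : σ b = u)
    (hu : G.Adj v u) : σ u ≠ b ∧ σ u ≠ u ∧ b ≠ u := by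
  refine ⟨?_, (hl.adj u hu).ne', ?_⟩
  · intro h
    exact hl.next_next_ne u hu (by rw [h, hbu])
  · rintro rfl
    exact (hl.adj b hb).ne' hbu

/-- In the first drawing the cone conditions are the orientations of the two faces at the edge `v
u`; `relativeStep_spec` carries them from drawing to drawing. -/
theorem cone_of_pseudomorph (hP : IsPseudomorph G Γ₁ Γ₂ v u D)
    (hl : IsShortLink G v σ) (hσ : ∀ x, G.Adj v x → IsCcwFace G Γ₁ v x (σ x))
    {u' a b : {w : V // w ≠ v}} (hu' : u'.1 = u) (ha : a.1 = σ u) (hb : G.Adj v b)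
    (hbu : σ b = u) {r : Fin (k + 1) → ℂ}
    (hr0 : r 0 = Γ₁ v - Γ₁ u)
    (hr : ∀ i : Fin k, r i.succ = relativeStep u' a b (D i.castSucc) (D i.succ) (r i.castSucc))
    (i : Fin (k + 1)) :
    0 < cross (D i a - D i u') (r i) ∧ 0 < cross (r i) (D i b - D i u') := by
  have hu := hP.contract.adj
  obtain ⟨n1, n2, n3⟩ := ne_of_next hl hb hbu hu
  have hua : G.Adj v a := by rw [ha]; exact hl.adj_next u hu
  induction i using Fin.induction with
  | zero =>
    rw [hr0, hP.contract.fixed, hP.contract.fixed, hP.contract.fixed, hu', ha]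
    have k1 := (hσ u hu).2
    have k2 := (hσ b hb).2
    rw [hbu] at k2
    constructor
    · rw [← orient_rotate] at k1; exact k1
    · rw [← orient_rotate, ← orient_rotate] at k2; exact k2
  | succ i ih =>
    obtain ⟨l, -, hd⟩ := hP.morph.unidirectional i
    have a1 : (contractGraph G v u).Adj u' a := by
      have := contractGraph_adj_target hu hua (by rw [ha]; exact n2)
      have e : u' = ⟨u, hu.ne'⟩ := Subtype.ext hu'
      rwa [e]
    have a2 : (contractGraph G v u).Adj u' b := by
      have := contractGraph_adj_target hu hb n3
      have e : u' = ⟨u, hu.ne'⟩ := Subtype.ext hu'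
      rwa [e]
    have := relativeStep_spec (hP.morph.planar_during i) a1 a2
      (fun e => n1 (by rw [← ha, e])) hd ih.1 ih.2
    rw [hr]
    exact ⟨this.1, this.2.1⟩

theorem relativeStep_sub_parallel (u' a b : {w : V // w ≠ v}) (i : Fin k) {l : ℂ}
    (hd : ∀ w, ∃ c : ℝ, D i.succ w = D i.castSucc w + c • l) (r : ℂ) :
    ∃ c : ℝ, relativeStep u' a b (D i.castSucc) (D i.succ) r - r = c • l := by
  obtain ⟨cu, hcu⟩ := hd u'
  obtain ⟨ca, hca⟩ := hd a
  obtain ⟨cb, hcb⟩ := hd b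
  rw [relativeStep, nextPosition, add_sub_cancel_left]
  have : ∃ d : ℝ, shiftDirection (D i.castSucc a - D i.castSucc u')
      (D i.castSucc b - D i.castSucc u') (D i.succ a - D i.succ u') (D i.succ b - D i.succ u') =
      d • l := by
    unfold shiftDirection
    split_ifs
    · exact ⟨ca - cu, by rw [hca, hcu, sub_smul]; ring⟩
    · exact ⟨cb - cu, by rw [hcb, hcu, sub_smul]; ring⟩
  obtain ⟨d, hd⟩ := this
  rw [hd, smul_smul]
  exact ⟨_, rfl⟩

/-- The drawings of the morph: in drawing `i` of the contracted graph, `v` is placed at `z i`. -/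
def conversionDrawings [DecidableEq V] (Γ₁ Γ₂ : V → ℂ) (D : Fin (k + 1) → {w : V // w ≠ v} → ℂ)
    (z : Fin (k + 1) → ℂ) : Fin (k + 2 + 1) → V → ℂ :=
  Fin.cons (α := fun _ => V → ℂ) Γ₁
    (Fin.snoc (α := fun _ => V → ℂ) (fun i => extendDrawing (D i) (z i)) Γ₂)

theorem conversionDrawings_zero [DecidableEq V] (z : Fin (k + 1) → ℂ) :
    conversionDrawings Γ₁ Γ₂ D z 0 = Γ₁ := rfl

theorem conversionDrawings_last [DecidableEq V] (z : Fin (k + 1) → ℂ) :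
    conversionDrawings Γ₁ Γ₂ D z (Fin.last (k + 2)) = Γ₂ := by
  rw [← Fin.succ_last, conversionDrawings, Fin.cons_succ, Fin.snoc_last]

theorem conversionDrawings_mid [DecidableEq V] (z : Fin (k + 1) → ℂ) (i : Fin (k + 1)) :
    conversionDrawings Γ₁ Γ₂ D z i.succ.castSucc = extendDrawing (D i) (z i) := by
  rw [← Fin.succ_castSucc, conversionDrawings, Fin.cons_succ, Fin.snoc_castSucc]

/-- As `‖r i‖ < B`, the factor `1 / B ^ 3` brings `v` within `1 / B ^ 2` of `u`, as `IsClose`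
demands, without leaving the cone. One factor for all drawings keeps the steps unidirectional.
Planarity follows from the link invariant, which is carried along from `Γ₁`. -/
theorem isConversion_of_position [Finite V] [DecidableEq V] (h₁ : IsTriangulation G Γ₁)
    (hP : IsPseudomorph G Γ₁ Γ₂ v u D)
    (hl : IsShortLink G v σ) (hσ : ∀ x, G.Adj v x → IsCcwFace G Γ₁ v x (σ x))
    (hσ₂ : ∀ x, G.Adj v x → 0 < orient (Γ₂ v) (Γ₂ x) (Γ₂ (σ x)))
    {u' a b : {w : V // w ≠ v}} (hu' : u'.1 = u) (ha : a.1 = σ u) (hb : G.Adj v b)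
    (hbu : σ b = u) {r : Fin (k + 1) → ℂ} {B : ℝ} (hB : 0 < B)
    (hr0 : r 0 = Γ₁ v - Γ₁ u)
    (hr : ∀ i : Fin k, r i.succ = relativeStep u' a b (D i.castSucc) (D i.succ) (r i.castSucc))
    (hBr : ∀ i, ‖r i‖ < B)
    (hBl : ∀ i (x y : {w : V // w ≠ v}), G.Adj v x → y.1 = σ x → ‖D i y - D i x‖ ≤ B)
    (hBo : ∀ i (x y : {w : V // w ≠ v}), G.Adj v x → y.1 = σ x →
      0 < orient (D i u') (D i x) (D i y) → 1 / B ≤ orient (D i u') (D i x) (D i y)) :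
    IsConversion G Γ₁ Γ₂ v u D
      (conversionDrawings Γ₁ Γ₂ D fun i => D i u' + (1 / (B * B * B)) • r i) := by
  have hu := hP.contract.adj
  obtain rfl : u' = ⟨u, hu.ne'⟩ := Subtype.ext hu'
  obtain ⟨n1, n2, n3⟩ := ne_of_next hl hb hbu hu
  set z : Fin (k + 1) → ℂ := fun i => D i ⟨u, hu.ne'⟩ + (1 / (B * B * B)) • r i with hz
  set E : Fin (k + 1) → V → ℂ := fun i => extendDrawing (D i) (z i) with hE
  have hEv : ∀ i, E i v = z i := fun i => extendDrawing_self _ _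
  have hEw : ∀ i (w : {w : V // w ≠ v}), E i w = D i w := fun i w => extendDrawing_subtype _ _ _
  have hEn : ∀ i w (h : w ≠ v), E i w = D i ⟨w, h⟩ := fun i w h => extendDrawing_of_ne _ _ h
  have hs : 0 < 1 / (B * B * B) := by positivity
  have hEvu : ∀ i, E i v - E i u = (1 / (B * B * B)) • r i := by
    intro i
    rw [hEv, hEn i u hu.ne', hz, add_sub_cancel_left]
  have hclose : ∀ i, IsClose G v u σ b B (E i) := by
    intro i
    have hcone := cone_of_pseudomorph hP hl hσ rfl ha hb hbu hr0 hr i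
    refine ⟨?_, ?_, ?_, ?_, ?_⟩
    · intro x hx hxu hσu
      have hσx := hl.adj_next x hx
      rw [hEn i u hu.ne', hEn i x hx.ne', hEn i _ hσx.ne']
      exact hBo i ⟨x, hx.ne'⟩ ⟨σ x, hσx.ne'⟩ hx rfl
        (orient_pos_of_pseudomorph (x := ⟨x, hx.ne'⟩) (y := ⟨σ x, hσx.ne'⟩) h₁ hP hσ i hx rfl hxu hσu)
    · intro x hx hxu hσu
      have hσx := hl.adj_next x hx
      rw [hEn i x hx.ne', hEn i _ hσx.ne']
      exact hBl i ⟨x, hx.ne'⟩ ⟨σ x, hσx.ne'⟩ hx rfl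
    · rw [hEvu, norm_smul, Real.norm_of_nonneg hs.le]
      have := mul_lt_mul_of_pos_left (hBr i) hs
      have e : 1 / (B * B * B) * B = 1 / (B * B) := by field_simp
      rwa [e] at this
    · rw [hEvu, cross_smul_right, hEn i u hu.ne', ← ha, hEw]
      exact mul_pos hs hcone.1
    · rw [hEvu, cross_smul_left, hEn i u hu.ne', hEw]
      exact mul_pos hs hcone.2
  have hpos : ∀ {f : V → ℂ}, IsClose G v u σ b B f →
      ∀ x, G.Adj v x → 0 < orient (f v) (f x) (f (σ x)) := fun hf =>
    orient_pos_of_close hB hl hb hbu hu hf.orient_le hf.norm_le hf.close hf.left hf.right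
  have hsec : ∀ {f : V → ℂ}, IsClose G v u σ b B f → InSector G Γ₁ v u (1 / (B * B)) f := fun hf =>
    inSector_of_close hB h₁.planar hσ hf.orient_le hf.norm_le hf.close
  have hfirst : ∀ w, w ≠ v → E 0 w = Γ₁ w := by
    intro w hw; rw [hEn 0 w hw, hP.contract.fixed]
  have hlast : ∀ w, w ≠ v → Γ₂ w = E (Fin.last k) w := by
    intro w hw; rw [hEn _ w hw, hP.uncontract.fixed]
  have hdir : ∀ i : Fin k, ∃ l : ℂ, ‖l‖ = 1 ∧ ∀ w, ∃ c : ℝ, E i.succ w = E i.castSucc w + c • l := by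
    intro i
    obtain ⟨l, hl1, hd⟩ := hP.morph.unidirectional i
    refine ⟨l, hl1, fun w => ?_⟩
    by_cases hw : w = v
    · subst hw
      rw [hEv, hEv, hz]
      obtain ⟨c, hc⟩ := hd ⟨u, hu.ne'⟩
      obtain ⟨c', hc'⟩ := relativeStep_sub_parallel ⟨u, hu.ne'⟩ a b i hd (r i.castSucc)
      rw [← hr] at hc'
      have hc'' : r i.succ = r i.castSucc + c' • l := by rw [← hc']; ring
      -- The displacement of `u` plus the scaled displacement of the relative position.
      refine ⟨c + 1 / (B * B * B) * c', ?_⟩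
      simp only
      rw [hc, hc'', smul_add, smul_smul, add_smul]; ring
    · rw [hEn _ w hw, hEn _ w hw]
      exact hd _
  have hcont : ∀ (f g : V → ℂ) w, Continuous fun t : ℝ => linearMorph f g t w := by
    intro f g w; simp only [linearMorph_apply]; fun_prop
  have hDconst : ∀ (f g : V → ℂ) (i : Fin (k + 1)), (∀ w, w ≠ v → g w = f w) →
      (∀ w (h : w ≠ v), f w = D i ⟨w, h⟩) → ∀ t ∈ Set.Icc (0 : ℝ) 1,
      IsPlanarDrawing (contractGraph G v u) fun w : {w : V // w ≠ v} => linearMorph f g t w := by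
    intro f g i hfg hf t _
    have : (fun w : {w : V // w ≠ v} => linearMorph f g t w) = D i := by
      funext w
      rw [linearMorph_apply, hfg w w.2, sub_self, smul_zero, add_zero, hf w w.2]
    rw [this]
    exact hP.morph.planar i
  set M := conversionDrawings Γ₁ Γ₂ D z with hM
  have hM0 : M 0 = Γ₁ := rfl
  have hMlast : M (Fin.last (k + 2)) = Γ₂ := conversionDrawings_last z
  have hMmid : ∀ i : Fin (k + 1), M i.succ.castSucc = E i := conversionDrawings_mid z
  have hMmid' : ∀ i : Fin (k + 1), M i.castSucc.succ = E i := by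
    intro i; rw [Fin.succ_castSucc]; exact hMmid i
  -- There are three kinds of steps: in the first and the last only `v` moves, and those in between
  -- lift the steps of the contracted graph.
  have hstep : ∀ i : Fin (k + 2), IsUnidirectional (M i.castSucc) (M i.succ) ∧
      ∀ t ∈ Set.Icc (0 : ℝ) 1,
        (∀ x, G.Adj v x → 0 < orient (linearMorph (M i.castSucc) (M i.succ) t v)
          (linearMorph (M i.castSucc) (M i.succ) t x)
          (linearMorph (M i.castSucc) (M i.succ) t (σ x))) ∧
        IsPlanarDrawing (contractGraph G v u) fun w : {w : V // w ≠ v} =>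
          linearMorph (M i.castSucc) (M i.succ) t w := by
    intro i
    refine Fin.cases ?_ (fun j => ?_) i
    · have e1 : M (Fin.castSucc 0) = Γ₁ := rfl
      have e2 : M (Fin.succ 0) = E 0 := hMmid' 0
      rw [e1, e2]
      refine ⟨isUnidirectional_of_eq hfirst, fun t ht => ⟨?_, ?_⟩⟩
      · exact orient_pos_linearMorph hl hfirst (fun x hx => (hσ x hx).2) (hpos (hclose 0)) t ht
      · exact hDconst _ _ 0 hfirst (fun w h => by rw [hP.contract.fixed]) t ht
    refine Fin.lastCases ?_ (fun j => ?_) j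
    · rw [hMmid, Fin.succ_last, Fin.succ_last, hMlast]
      refine ⟨isUnidirectional_of_eq hlast, fun t ht => ⟨?_, ?_⟩⟩
      · exact orient_pos_linearMorph hl hlast (hpos (hclose _)) hσ₂ t ht
      · exact hDconst _ _ (Fin.last k) hlast (fun w h => hEn _ _ _) t ht
    · rw [hMmid, Fin.succ_castSucc, hMmid']
      obtain ⟨l, hl1, hd⟩ := hdir j
      refine ⟨⟨l, hl1, hd⟩, fun t ht => ⟨?_, ?_⟩⟩
      · exact hpos ((hclose j.castSucc).of_linearMorph (hclose j.succ) hd t ht)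
      · have : (fun w : {w : V // w ≠ v} => linearMorph (E j.castSucc) (E j.succ) t w) =
            linearMorph (D j.castSucc) (D j.succ) t := by
          funext w
          rw [linearMorph_apply, linearMorph_apply, hEw, hEw]
        rw [this]
        exact hP.morph.planar_during j t ht
  -- The end of each step is the start of the next, so the invariant passes from `Γ₁` to all
  -- drawings.
  have hlink : ∀ i : Fin (k + 2 + 1), IsLinkDrawing G v σ (M i) := by
    intro i
    induction i using Fin.induction with
    | zero => exact IsLinkDrawing.of_faces h₁.planar hσ
    | succ i ih =>
      have := isLinkDrawing_of_continuous hl hu (hcont (M i.castSucc) (M i.succ))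
        (fun t ht => ((hstep i).2 t ht).1) (fun t ht => ((hstep i).2 t ht).2)
        (by rw [linearMorph_zero]; exact ih) 1 ⟨zero_le_one, le_rfl⟩
      rwa [linearMorph_one] at this
  have hduring : ∀ i : Fin (k + 2), ∀ t ∈ Set.Icc (0 : ℝ) 1,
      IsPlanarDrawing G (linearMorph (M i.castSucc) (M i.succ) t) := by
    intro i t ht
    refine IsLinkDrawing.isPlanarDrawing ?_ hl hu ((hstep i).2 t ht).2
    exact isLinkDrawing_of_continuous hl hu (hcont (M i.castSucc) (M i.succ))
        (fun t ht => ((hstep i).2 t ht).1) (fun t ht => ((hstep i).2 t ht).2)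
        (by rw [linearMorph_zero]; exact hlink i.castSucc) t ht
  refine ⟨hM0, hMlast, ⟨?_, fun i => (hstep i).1, hduring⟩, ?_, ?_⟩
  · intro i
    refine Fin.cases ?_ (fun j => ?_) i
    · exact h₁.planar
    · have := hduring j 1 ⟨zero_le_one, le_rfl⟩
      rwa [linearMorph_one] at this
  · intro i w
    rw [hMmid, hEw]
  · intro _
    refine ⟨1 / (B * B), by positivity, ?_, ?_⟩
    · intro i
      rw [hMmid]
      exact hsec (hclose i)
    · intro i t ht
      rw [hMmid, hMmid]
      obtain ⟨l, -, hd⟩ := hdir i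
      exact hsec ((hclose i.castSucc).of_linearMorph (hclose i.succ) hd t ht)

end Conversion

namespace RealRAM

/-! ### A small language of straight-line code with conditionals -/

/-- The part of a state that is visible to structured code: registers with a large index are used
for the evaluation of expressions. -/
structure View where
  nreg : Fin 64 → ℕ
  rreg : Fin 64 → ℝ
  nmem : ℕ → ℕ
  rmem : ℕ → ℝ

def State.view (s : State) : View :=
  ⟨fun i => s.nreg i, fun i => s.rreg i, s.nmem, s.rmem⟩

/-- Expressions for natural numbers. -/
inductive NExp where
  | var (i : Fin 64)
  | const (c : ℕ)
  | add (a b : NExp)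
  | load (a : NExp)

def NExp.eval (σ : View) : NExp → ℕ
  | var i => σ.nreg i
  | const c => c
  | add a b => a.eval σ + b.eval σ
  | load a => σ.nmem (a.eval σ)

/-- Code that evaluates an expression into register `d`. -/
def NExp.compile : NExp → ℕ → Prog
  -- There is no instruction for copying registers; zero is added instead.
  | var i, d => .seq (.instr (.natConst (d + 1) 0)) (.instr (.natAdd d i (d + 1)))
  | const c, d => .instr (.natConst d c)
  | add a b, d => .seq (a.compile d) (.seq (b.compile (d + 1)) (.instr (.natAdd d d (d + 1))))
  | load a, d => .seq (a.compile d) (.instr (.natLoad d d))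

def NExp.cost : NExp → ℕ
  | var _ => 2
  | const _ => 1
  | add a b => a.cost + (b.cost + 1)
  | load a => a.cost + 1

/-- Temporaries form a stack: registers below `d` are preserved, so the first operand in `d`
survives the evaluation of the second one in `d + 1`. The bound `64 ≤ d` protects the visible
registers. -/
theorem NExp.exec_compile (e : NExp) : ∀ (d : ℕ) (s : State), 64 ≤ d →
    ∃ s', Exec (e.compile d) s s' e.cost ∧ s'.nreg d = e.eval s.view ∧
      (∀ i < d, s'.nreg i = s.nreg i) ∧ s'.rreg = s.rreg ∧ s'.nmem = s.nmem ∧ s'.rmem = s.rmem := by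
  induction e with
  | var i =>
    intro d s hd
    have hi := i.2
    refine ⟨_, .seq (.instr (.natConst (d + 1) 0) _ trivial)
      (.instr (.natAdd d i (d + 1)) _ trivial), ?_, ?_, rfl, rfl, rfl⟩
    · have : (i : ℕ) ≠ d + 1 := by omega
      simp [Instr.run, this, NExp.eval, State.view]
    · intro j hj
      have h1 : j ≠ d := by omega
      have h2 : j ≠ d + 1 := by omega
      simp [Instr.run, h1, h2]
  | const c =>
    intro d s _
    refine ⟨_, .instr _ _ trivial, ?_, ?_, rfl, rfl, rfl⟩
    · simp [Instr.run, NExp.eval]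
    · intro j hj
      have h1 : j ≠ d := by omega
      simp [Instr.run, h1]
  | add a b iha ihb =>
    intro d s hd
    obtain ⟨s1, e1, r1, f1, g1, h1, k1⟩ := iha d s hd
    obtain ⟨s2, e2, r2, f2, g2, h2, k2⟩ := ihb (d + 1) s1 (by omega)
    refine ⟨_, .seq e1 (.seq e2 (.instr _ _ trivial)), ?_, ?_, by simp [Instr.run, g2, g1],
      by simp [Instr.run, h2, h1], by simp [Instr.run, k2, k1]⟩
    · have hv : s1.view = s.view := by
        unfold State.view
        rw [g1, h1, k1]
        congr 1
        funext i
        exact f1 _ (by omega)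
      rw [hv] at r2
      simp [Instr.run, NExp.eval, r2, f2 d (by omega), r1]
    · intro j hj
      have h1 : j ≠ d := by omega
      simp [Instr.run, h1, f2 j (by omega), f1 j hj]
  | load a iha =>
    intro d s hd
    obtain ⟨s1, e1, r1, f1, g1, h1, k1⟩ := iha d s hd
    refine ⟨_, .seq e1 (.instr _ _ trivial), ?_, ?_, by simp [Instr.run, g1],
      by simp [Instr.run, h1], by simp [Instr.run, k1]⟩
    · simp [Instr.run, NExp.eval, r1, h1, State.view]
    · intro j hj
      have h1 : j ≠ d := by omega
      simp [Instr.run, h1, f1 j hj]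

/-- Expressions for real numbers. -/
inductive RExp where
  | var (i : Fin 64)
  | const (c : ℤ)
  | add (a b : RExp)
  | sub (a b : RExp)
  | mul (a b : RExp)
  | div (a b : RExp)
  | load (a : NExp)

noncomputable def RExp.eval (σ : View) : RExp → ℝ
  | var i => σ.rreg i
  | const c => c
  | add a b => a.eval σ + b.eval σ
  | sub a b => a.eval σ - b.eval σ
  | mul a b => a.eval σ * b.eval σ
  | div a b => a.eval σ / b.eval σ
  | load a => σ.rmem (a.eval σ)

/-- No division by zero occurs in the evaluation. -/
def RExp.Legal (σ : View) : RExp → Prop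
  | var _ => True
  | const _ => True
  | add a b => a.Legal σ ∧ b.Legal σ
  | sub a b => a.Legal σ ∧ b.Legal σ
  | mul a b => a.Legal σ ∧ b.Legal σ
  | div a b => a.Legal σ ∧ b.Legal σ ∧ b.eval σ ≠ 0
  | load _ => True

def RExp.compile : RExp → ℕ → Prog
  | var i, d => .seq (.instr (.realConst (d + 1) 0)) (.instr (.realAdd d i (d + 1)))
  | const c, d => .instr (.realConst d c)
  | add a b, d => .seq (a.compile d) (.seq (b.compile (d + 1)) (.instr (.realAdd d d (d + 1))))
  | sub a b, d => .seq (a.compile d) (.seq (b.compile (d + 1)) (.instr (.realSub d d (d + 1))))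
  | mul a b, d => .seq (a.compile d) (.seq (b.compile (d + 1)) (.instr (.realMul d d (d + 1))))
  | div a b, d => .seq (a.compile d) (.seq (b.compile (d + 1)) (.instr (.realDiv d d (d + 1))))
  -- Natural and real registers are separate, and no natural temporary is pending here, so register
  -- 64 is free for the address.
  | load a, d => .seq (a.compile 64) (.instr (.realLoad d 64))

def RExp.cost : RExp → ℕ
  | var _ => 2
  | const _ => 1
  | add a b => a.cost + (b.cost + 1)
  | sub a b => a.cost + (b.cost + 1)
  | mul a b => a.cost + (b.cost + 1)
  | div a b => a.cost + (b.cost + 1)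
  | load a => a.cost + 1

theorem view_eq {s s' : State} (h1 : ∀ i < 64, s'.nreg i = s.nreg i)
    (h2 : ∀ i < 64, s'.rreg i = s.rreg i) (h3 : s'.nmem = s.nmem) (h4 : s'.rmem = s.rmem) :
    s'.view = s.view := by
  unfold State.view
  rw [h3, h4]
  congr 1
  · funext i; exact h1 _ i.2
  · funext i; exact h2 _ i.2

theorem RExp.exec_compile (e : RExp) : ∀ (d : ℕ) (s : State), 64 ≤ d → e.Legal s.view →
    ∃ s', Exec (e.compile d) s s' e.cost ∧ s'.rreg d = e.eval s.view ∧
      (∀ i < d, s'.rreg i = s.rreg i) ∧ (∀ i < 64, s'.nreg i = s.nreg i) ∧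
      s'.nmem = s.nmem ∧ s'.rmem = s.rmem := by
  -- The four arithmetic operations share this argument; only division has a condition of legality.
  have bin : ∀ (a b : RExp) (op : ℕ → ℕ → ℕ → Instr) (f : ℝ → ℝ → ℝ),
      (∀ s : State, ∀ d x y, ((op d x y).run s).rreg =
        Function.update s.rreg d (f (s.rreg x) (s.rreg y))) →
      (∀ s : State, ∀ d x y, ((op d x y).run s).nreg = s.nreg) →
      (∀ s : State, ∀ d x y, ((op d x y).run s).nmem = s.nmem) →
      (∀ s : State, ∀ d x y, ((op d x y).run s).rmem = s.rmem) →
      (∀ (d : ℕ) (s : State), 64 ≤ d → a.Legal s.view →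
        ∃ s', Exec (a.compile d) s s' a.cost ∧ s'.rreg d = a.eval s.view ∧
        (∀ i < d, s'.rreg i = s.rreg i) ∧ (∀ i < 64, s'.nreg i = s.nreg i) ∧
        s'.nmem = s.nmem ∧ s'.rmem = s.rmem) →
      (∀ (d : ℕ) (s : State), 64 ≤ d → b.Legal s.view →
        ∃ s', Exec (b.compile d) s s' b.cost ∧ s'.rreg d = b.eval s.view ∧
        (∀ i < d, s'.rreg i = s.rreg i) ∧ (∀ i < 64, s'.nreg i = s.nreg i) ∧
        s'.nmem = s.nmem ∧ s'.rmem = s.rmem) →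
      ∀ (d : ℕ) (s : State), 64 ≤ d → a.Legal s.view → b.Legal s.view →
      (∀ s' : State, s'.rreg (d + 1) = b.eval s.view → (op d d (d + 1)).Legal s') →
      ∃ s', Exec (.seq (a.compile d) (.seq (b.compile (d + 1)) (.instr (op d d (d + 1))))) s s'
        (a.cost + (b.cost + 1)) ∧ s'.rreg d = f (a.eval s.view) (b.eval s.view) ∧
        (∀ i < d, s'.rreg i = s.rreg i) ∧ (∀ i < 64, s'.nreg i = s.nreg i) ∧
        s'.nmem = s.nmem ∧ s'.rmem = s.rmem := by
    intro a b op f o1 o2 o3 o4 iha ihb d s hd la lb hleg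
    obtain ⟨s1, e1, r1, f1, g1, h1, k1⟩ := iha d s hd la
    have hv : s1.view = s.view := view_eq g1 (fun i hi => f1 i (by omega)) h1 k1
    obtain ⟨s2, e2, r2, f2, g2, h2, k2⟩ := ihb (d + 1) s1 (by omega) (by rwa [hv])
    rw [hv] at r2
    refine ⟨_, .seq e1 (.seq e2 (.instr _ _ (hleg _ r2))), ?_, ?_, ?_, by rw [o3, h2, h1],
      by rw [o4, k2, k1]⟩
    · rw [o1, Function.update_self, f2 d (by omega), r1, r2]
    · intro j hj
      rw [o1, Function.update_of_ne (by omega), f2 j (by omega), f1 j hj]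
    · intro j hj
      rw [o2, g2 j hj, g1 j hj]
  induction e with
  | var i =>
    intro d s hd _
    have hi := i.2
    refine ⟨_, .seq (.instr (.realConst (d + 1) 0) _ trivial)
      (.instr (.realAdd d i (d + 1)) _ trivial), ?_, ?_, fun _ _ => rfl, rfl, rfl⟩
    · have : (i : ℕ) ≠ d + 1 := by omega
      simp [Instr.run, this, RExp.eval, State.view]
    · intro j hj
      have h1 : j ≠ d := by omega
      have h2 : j ≠ d + 1 := by omega
      simp [Instr.run, h1, h2]
  | const c =>
    intro d s _ _
    refine ⟨_, .instr _ _ trivial, ?_, ?_, fun _ _ => rfl, rfl, rfl⟩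
    · simp [Instr.run, RExp.eval]
    · intro j hj
      have h1 : j ≠ d := by omega
      simp [Instr.run, h1]
  | add a b iha ihb =>
    intro d s hd hl
    exact bin a b Instr.realAdd _ (fun _ _ _ _ => rfl) (fun _ _ _ _ => rfl) (fun _ _ _ _ => rfl)
      (fun _ _ _ _ => rfl) iha ihb d s hd hl.1 hl.2 (fun _ _ => trivial)
  | sub a b iha ihb =>
    intro d s hd hl
    exact bin a b Instr.realSub _ (fun _ _ _ _ => rfl) (fun _ _ _ _ => rfl) (fun _ _ _ _ => rfl)
      (fun _ _ _ _ => rfl) iha ihb d s hd hl.1 hl.2 (fun _ _ => trivial)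
  | mul a b iha ihb =>
    intro d s hd hl
    exact bin a b Instr.realMul _ (fun _ _ _ _ => rfl) (fun _ _ _ _ => rfl) (fun _ _ _ _ => rfl)
      (fun _ _ _ _ => rfl) iha ihb d s hd hl.1 hl.2 (fun _ _ => trivial)
  | div a b iha ihb =>
    intro d s hd hl
    refine bin a b Instr.realDiv _ (fun _ _ _ _ => rfl) (fun _ _ _ _ => rfl) (fun _ _ _ _ => rfl)
      (fun _ _ _ _ => rfl) iha ihb d s hd hl.1 hl.2.1 (fun s' h => ?_)
    change s'.rreg (d + 1) ≠ 0
    rw [h]; exact hl.2.2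
  | load a =>
    intro d s hd _
    obtain ⟨s1, e1, r1, f1, g1, h1, k1⟩ := a.exec_compile 64 s le_rfl
    refine ⟨_, .seq e1 (.instr _ _ trivial), ?_, ?_, f1, h1, k1⟩
    · simp [Instr.run, RExp.eval, r1, k1, State.view]
    · intro j hj
      have h1 : j ≠ d := by omega
      simp [Instr.run, h1, g1]

/-- Code without loops. -/
inductive Code where
  | skip
  | setN (x : Fin 64) (e : NExp)
  | setR (x : Fin 64) (e : RExp)
  | store (a : NExp) (e : RExp)
  | seq (P Q : Code)
  | ifN (a b : NExp) (P Q : Code)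
  | ifR (a b : RExp) (P Q : Code)

open Classical in
/-- The effect of code. -/
noncomputable def Code.eval : Code → View → View
  | skip, σ => σ
  | setN x e, σ => { σ with nreg := Function.update σ.nreg x (e.eval σ) }
  | setR x e, σ => { σ with rreg := Function.update σ.rreg x (e.eval σ) }
  | store a e, σ => { σ with rmem := Function.update σ.rmem (a.eval σ) (e.eval σ) }
  | seq P Q, σ => Q.eval (P.eval σ)
  | ifN a b P Q, σ => if a.eval σ < b.eval σ then P.eval σ else Q.eval σ
  | ifR a b P Q, σ => if a.eval σ < b.eval σ then P.eval σ else Q.eval σ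

/-- No division by zero occurs when the code is run. -/
def Code.Legal : Code → View → Prop
  | skip, _ => True
  | setN _ _, _ => True
  | setR _ e, σ => e.Legal σ
  | store _ e, σ => e.Legal σ
  | seq P Q, σ => P.Legal σ ∧ Q.Legal (P.eval σ)
  | ifN a b P Q, σ => (a.eval σ < b.eval σ → P.Legal σ) ∧ (¬ a.eval σ < b.eval σ → Q.Legal σ)
  | ifR a b P Q, σ => a.Legal σ ∧ b.Legal σ ∧ (a.eval σ < b.eval σ → P.Legal σ) ∧
      (¬ a.eval σ < b.eval σ → Q.Legal σ)

def Code.compile : Code → Prog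
  | skip => .skip
  | setN x e => .seq (e.compile 64) (.seq (.instr (.natConst 65 0)) (.instr (.natAdd x 64 65)))
  | setR x e => .seq (e.compile 64) (.seq (.instr (.realConst 65 0)) (.instr (.realAdd x 64 65)))
  | store a e => .seq (e.compile 64) (.seq (a.compile 64) (.instr (.realStore 64 64)))
  | seq P Q => .seq P.compile Q.compile
  | ifN a b P Q => .seq (a.compile 64) (.seq (b.compile 65) (.ite (.natLt 64 65) P.compile Q.compile))
  | ifR a b P Q => .seq (a.compile 64) (.seq (b.compile 65) (.ite (.realLt 64 65) P.compile Q.compile))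

/-- This is only an upper bound: a conditional is charged for both branches, so that the cost does
not depend on the state. -/
def Code.cost : Code → ℕ
  | skip => 0
  | setN _ e => e.cost + 2
  | setR _ e => e.cost + 2
  | store a e => e.cost + (a.cost + 1)
  | seq P Q => P.cost + Q.cost
  | ifN a b P Q => a.cost + (b.cost + (P.cost + Q.cost + 1))
  | ifR a b P Q => a.cost + (b.cost + (P.cost + Q.cost + 1))

theorem Code.exec_compile (c : Code) : ∀ s : State, c.Legal s.view →
    ∃ s' t, Exec c.compile s s' t ∧ t ≤ c.cost ∧ s'.view = c.eval s.view := by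
  induction c with
  | skip => exact fun s _ => ⟨s, 0, .skip s, le_rfl, rfl⟩
  | setN x e =>
    intro s _
    obtain ⟨s1, e1, r1, f1, g1, h1, k1⟩ := e.exec_compile 64 s le_rfl
    refine ⟨_, _, .seq e1 (.seq (.instr _ _ trivial) (.instr _ _ trivial)), le_rfl, ?_⟩
    simp only [State.view, Instr.run, Code.eval, g1, h1, k1]
    congr 1
    funext i
    by_cases hi : i = x
    · subst hi
      simp [r1, State.view]
    · have hi' : (i : ℕ) ≠ x := fun h => hi (Fin.ext h)
      have hi2 : (i : ℕ) ≠ 65 := by omega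
      simp [hi, hi', hi2, f1 i i.2]
  | setR x e =>
    intro s hl
    obtain ⟨s1, e1, r1, f1, g1, h1, k1⟩ := e.exec_compile 64 s le_rfl hl
    refine ⟨_, _, .seq e1 (.seq (.instr _ _ trivial) (.instr _ _ trivial)), le_rfl, ?_⟩
    simp only [State.view, Instr.run, Code.eval, h1, k1]
    congr 1
    · funext i; exact g1 i i.2
    funext i
    by_cases hi : i = x
    · subst hi
      simp [r1, State.view]
    · have hi' : (i : ℕ) ≠ x := fun h => hi (Fin.ext h)
      have hi2 : (i : ℕ) ≠ 65 := by omega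
      simp [hi, hi', hi2, f1 i i.2]
  | store a e =>
    intro s hl
    obtain ⟨s1, e1, r1, f1, g1, h1, k1⟩ := e.exec_compile 64 s le_rfl hl
    have hv : s1.view = s.view := view_eq g1 f1 h1 k1
    obtain ⟨s2, e2, r2, f2, g2, h2, k2⟩ := a.exec_compile 64 s1 le_rfl
    refine ⟨_, _, .seq e1 (.seq e2 (.instr _ _ trivial)), le_rfl, ?_⟩
    rw [hv] at r2
    simp only [State.view, Instr.run, Code.eval, g2, h2, k2, h1, k1, r2, r1]
    congr 1
    · funext i; rw [f2 i i.2, g1 i i.2]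
    · funext i; exact f1 i i.2
  | seq P Q ihP ihQ =>
    intro s hl
    obtain ⟨s1, t1, e1, c1, v1⟩ := ihP s hl.1
    obtain ⟨s2, t2, e2, c2, v2⟩ := ihQ s1 (by rw [v1]; exact hl.2)
    refine ⟨s2, _, .seq e1 e2, Nat.add_le_add c1 c2, ?_⟩
    rw [v2, v1]; rfl
  | ifN a b P Q ihP ihQ =>
    intro s hl
    obtain ⟨s1, e1, r1, f1, g1, h1, k1⟩ := a.exec_compile 64 s le_rfl
    have hv1 : s1.view = s.view := view_eq f1 (fun i _ => by rw [g1]) h1 k1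
    obtain ⟨s2, e2, r2, f2, g2, h2, k2⟩ := b.exec_compile 65 s1 (by omega)
    have hv2 : s2.view = s.view := by
      rw [← hv1]
      exact view_eq (fun i hi => f2 i (by omega)) (fun i _ => by rw [g2]) h2 k2
    have hx : s2.nreg 64 = a.eval s.view := by rw [f2 64 (by omega), r1]
    have hy : s2.nreg 65 = b.eval s.view := by rw [r2, hv1]
    by_cases hb : a.eval s.view < b.eval s.view
    · obtain ⟨s3, t3, e3, c3, v3⟩ := ihP s2 (by rw [hv2]; exact hl.1 hb)
      refine ⟨s3, _, .seq e1 (.seq e2 (.ite_true (b := .natLt 64 65) ?_ e3)), ?_, ?_⟩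
      · change s2.nreg 64 < s2.nreg 65
        rwa [hx, hy]
      · simp only [Code.cost]; omega
      · rw [v3, hv2, Code.eval, if_pos hb]
    · obtain ⟨s3, t3, e3, c3, v3⟩ := ihQ s2 (by rw [hv2]; exact hl.2 hb)
      refine ⟨s3, _, .seq e1 (.seq e2 (.ite_false (b := .natLt 64 65) ?_ e3)), ?_, ?_⟩
      · change ¬ s2.nreg 64 < s2.nreg 65
        rwa [hx, hy]
      · simp only [Code.cost]; omega
      · rw [v3, hv2, Code.eval, if_neg hb]
  | ifR a b P Q ihP ihQ =>
    intro s hl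
    obtain ⟨s1, e1, r1, f1, g1, h1, k1⟩ := a.exec_compile 64 s le_rfl hl.1
    have hv1 : s1.view = s.view := view_eq g1 f1 h1 k1
    obtain ⟨s2, e2, r2, f2, g2, h2, k2⟩ := b.exec_compile 65 s1 (by omega) (by rw [hv1]; exact hl.2.1)
    have hv2 : s2.view = s.view := by
      rw [← hv1]
      exact view_eq g2 (fun i hi => f2 i (by omega)) h2 k2
    have hx : s2.rreg 64 = a.eval s.view := by rw [f2 64 (by omega), r1]
    have hy : s2.rreg 65 = b.eval s.view := by rw [r2, hv1]
    by_cases hb : a.eval s.view < b.eval s.view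
    · obtain ⟨s3, t3, e3, c3, v3⟩ := ihP s2 (by rw [hv2]; exact hl.2.2.1 hb)
      refine ⟨s3, _, .seq e1 (.seq e2 (.ite_true (b := .realLt 64 65) ?_ e3)), ?_, ?_⟩
      · change s2.rreg 64 < s2.rreg 65
        rwa [hx, hy]
      · simp only [Code.cost]; omega
      · rw [v3, hv2, Code.eval, if_pos hb]
    · obtain ⟨s3, t3, e3, c3, v3⟩ := ihQ s2 (by rw [hv2]; exact hl.2.2.2 hb)
      refine ⟨s3, _, .seq e1 (.seq e2 (.ite_false (b := .realLt 64 65) ?_ e3)), ?_, ?_⟩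
      · change ¬ s2.rreg 64 < s2.rreg 65
        rwa [hx, hy]
      · simp only [Code.cost]; omega
      · rw [v3, hv2, Code.eval, if_neg hb]

/-- Started in a state with view `σ`, the program `P` halts after at most `c` steps in a state with
a view that satisfies `Q`. -/
def Achieves (P : Prog) (c : ℕ) (σ : View) (Q : View → Prop) : Prop :=
  ∀ s : State, s.view = σ → ∃ s' t, Exec P s s' t ∧ t ≤ c ∧ Q s'.view

theorem Achieves.code {c : Code} {σ : View} {Q : View → Prop} (hl : c.Legal σ)
    (hQ : Q (c.eval σ)) : Achieves c.compile c.cost σ Q := by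
  rintro s rfl
  obtain ⟨s', t, e, ht, hv⟩ := c.exec_compile s hl
  exact ⟨s', t, e, ht, by rwa [hv]⟩

theorem Achieves.seq {P R : Prog} {c d : ℕ} {σ : View} {Q Q' : View → Prop}
    (h : Achieves P c σ Q) (h' : ∀ τ, Q τ → Achieves R d τ Q') :
    Achieves (.seq P R) (c + d) σ Q' := by
  intro s hs
  obtain ⟨s1, t1, e1, c1, q1⟩ := h s hs
  obtain ⟨s2, t2, e2, c2, q2⟩ := h' _ q1 s1 rfl
  exact ⟨s2, _, .seq e1 e2, Nat.add_le_add c1 c2, q2⟩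

theorem Achieves.loop {c : Code} {x y : Fin 64} (I : ℕ → View → Prop) (m : ℕ)
    (hstep : ∀ j < m, ∀ σ, I j σ → σ.nreg x < σ.nreg y ∧ c.Legal σ ∧ I (j + 1) (c.eval σ))
    (hend : ∀ σ, I m σ → ¬ σ.nreg x < σ.nreg y) {σ : View} (h0 : I 0 σ) :
    Achieves (.loop (.natLt x y) c.compile) (m * (c.cost + 1) + 1) σ (I m) := by
  -- Here `i` is the number of remaining rounds; the summand 1 pays for the final test, which fails.
  have key : ∀ i j, i + j = m → ∀ τ, I j τ →
      Achieves (.loop (.natLt x y) c.compile) (i * (c.cost + 1) + 1) τ (I m) := by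
    intro i
    induction i with
    | zero =>
      rintro j hj τ hτ s rfl
      obtain rfl : j = m := by omega
      exact ⟨s, 1, .loop_false (hend _ hτ), by omega, hτ⟩
    | succ i ih =>
      rintro j hj τ hτ s rfl
      obtain ⟨h1, h2, h3⟩ := hstep j (by omega) _ hτ
      obtain ⟨s1, t1, e1, c1, v1⟩ := c.exec_compile s h2
      obtain ⟨s2, t2, e2, c2, q2⟩ := ih (j + 1) (by omega) _ h3 s1 v1
      refine ⟨s2, _, .loop_true h1 e1 e2, ?_, q2⟩
      rw [Nat.succ_mul]; omega
  exact key m 0 (by omega) σ h0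

end RealRAM

namespace RealRAM

/-! ### Complex expressions and the memory -/

/-- A pair of expressions for the coordinates of a point. -/
structure CExp where
  re : RExp
  im : RExp

noncomputable def CExp.eval (σ : View) (e : CExp) : ℂ := ⟨e.re.eval σ, e.im.eval σ⟩

def CExp.Legal (σ : View) (e : CExp) : Prop := e.re.Legal σ ∧ e.im.Legal σ

/-- The point stored at address `A`. -/
noncomputable def readPt (m : ℕ → ℝ) (A : ℕ) : ℂ := ⟨m A, m (A + 1)⟩

/-- The point at the address that is the sum of two registers. -/
def CExp.mem (b w : Fin 64) : CExp :=
  ⟨.load (.add (.var b) (.var w)), .load (.add (.add (.var b) (.var w)) (.const 1))⟩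

def CExp.reg (x y : Fin 64) : CExp := ⟨.var x, .var y⟩

def CExp.sub (a b : CExp) : CExp := ⟨.sub a.re b.re, .sub a.im b.im⟩

def CExp.cross (a b : CExp) : RExp := .sub (.mul a.re b.im) (.mul a.im b.re)

def CExp.normSq (a : CExp) : RExp := .add (.mul a.re a.re) (.mul a.im a.im)

@[simp] theorem CExp.eval_mem (σ : View) (b w : Fin 64) :
    (CExp.mem b w).eval σ = readPt σ.rmem (σ.nreg b + σ.nreg w) := rfl

@[simp] theorem CExp.eval_reg (σ : View) (x y : Fin 64) :
    (CExp.reg x y).eval σ = ⟨σ.rreg x, σ.rreg y⟩ := rfl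

@[simp] theorem CExp.eval_sub (σ : View) (a b : CExp) :
    (a.sub b).eval σ = a.eval σ - b.eval σ := rfl

@[simp] theorem CExp.eval_cross (σ : View) (a b : CExp) :
    (a.cross b).eval σ = _root_.cross (a.eval σ) (b.eval σ) := rfl

@[simp] theorem CExp.eval_normSq (σ : View) (a : CExp) :
    a.normSq.eval σ = Complex.normSq (a.eval σ) :=
  (Complex.normSq_apply (a.eval σ)).symm

@[simp] theorem CExp.legal_mem (σ : View) (b w : Fin 64) : (CExp.mem b w).Legal σ :=
  ⟨trivial, trivial⟩

@[simp] theorem CExp.legal_reg (σ : View) (x y : Fin 64) : (CExp.reg x y).Legal σ :=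
  ⟨trivial, trivial⟩

@[simp] theorem CExp.legal_sub (σ : View) (a b : CExp) :
    (a.sub b).Legal σ ↔ a.Legal σ ∧ b.Legal σ := by
  simp only [CExp.sub, CExp.Legal, RExp.Legal]; tauto

@[simp] theorem CExp.legal_cross (σ : View) (a b : CExp) :
    (a.cross b).Legal σ ↔ a.Legal σ ∧ b.Legal σ := by
  simp only [CExp.cross, CExp.Legal, RExp.Legal]; tauto

@[simp] theorem CExp.legal_normSq (σ : View) (a : CExp) : a.normSq.Legal σ ↔ a.Legal σ := by
  simp only [CExp.normSq, CExp.Legal, RExp.Legal]; tauto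

/-- Assignment of a point to two registers. -/
def Code.setC (x y : Fin 64) (e : CExp) : Code := .seq (.setR x e.re) (.setR y e.im)

/-- Storing two registers as a point. -/
def Code.storeC (b w x y : Fin 64) : Code :=
  .seq (.store (.add (.var b) (.var w)) (.var x))
    (.store (.add (.add (.var b) (.var w)) (.const 1)) (.var y))

/-- The expression does not depend on register `x`. -/
def CExp.Indep (x : Fin 64) (e : CExp) : Prop :=
  ∀ (σ : View) (r : ℝ), e.eval { σ with rreg := Function.update σ.rreg x r } = e.eval σ ∧
    (e.Legal σ → e.Legal { σ with rreg := Function.update σ.rreg x r })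

theorem CExp.indep_mem (x b w : Fin 64) : (CExp.mem b w).Indep x :=
  fun _ _ => ⟨rfl, fun _ => ⟨trivial, trivial⟩⟩

theorem CExp.indep_reg {x a b : Fin 64} (h1 : a ≠ x) (h2 : b ≠ x) : (CExp.reg a b).Indep x :=
  fun _ _ => ⟨by simp [h1, h2], fun _ => ⟨trivial, trivial⟩⟩

theorem CExp.Indep.sub {x : Fin 64} {a b : CExp} (ha : a.Indep x) (hb : b.Indep x) :
    (a.sub b).Indep x := fun σ r => by
  refine ⟨?_, ?_⟩
  · rw [CExp.eval_sub, CExp.eval_sub, (ha σ r).1, (hb σ r).1]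
  · rw [CExp.legal_sub, CExp.legal_sub]
    exact fun h => ⟨(ha σ r).2 h.1, (hb σ r).2 h.2⟩

/-- The first coordinate is written before the second one is evaluated, so the expression must not
read register `x`. -/
theorem Code.eval_setC {x y : Fin 64} {e : CExp} (h : e.Indep x) (σ : View) :
    (Code.setC x y e).eval σ =
      { σ with rreg := Function.update (Function.update σ.rreg x (e.eval σ).re) y (e.eval σ).im } := by
  have := congrArg Complex.im (h σ (e.re.eval σ)).1
  simp only [CExp.eval] at this
  simp only [Code.setC, Code.eval, CExp.eval, this]

theorem Code.legal_setC {x y : Fin 64} {e : CExp} (h : e.Indep x) {σ : View} (hl : e.Legal σ) :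
    (Code.setC x y e).Legal σ :=
  ⟨hl.1, ((h σ (e.re.eval σ)).2 hl).2⟩

/-- Memory with a point stored at address `A`. -/
noncomputable def writePt (m : ℕ → ℝ) (A : ℕ) (z : ℂ) : ℕ → ℝ :=
  Function.update (Function.update m A z.re) (A + 1) z.im

@[simp] theorem Code.eval_storeC (b w x y : Fin 64) (σ : View) :
    (Code.storeC b w x y).eval σ =
      { σ with rmem := writePt σ.rmem (σ.nreg b + σ.nreg w) ⟨σ.rreg x, σ.rreg y⟩ } := rfl

@[simp] theorem Code.legal_storeC (b w x y : Fin 64) (σ : View) : (Code.storeC b w x y).Legal σ :=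
  ⟨trivial, trivial⟩

/-- Point `w` of drawing `j` is `X j w`. -/
def MemIs (n : ℕ) (m : ℕ → ℝ) (X : ℕ → ℕ → ℂ) : Prop :=
  ∀ j w, w < n → readPt m (2 * (n * j) + 2 * w) = X j w

theorem mul_add_inj {n j w j' w' : ℕ} (hw : w < n) (hw' : w' < n) (h : n * j + w = n * j' + w') :
    j = j' ∧ w = w' := by
  have h1 : (n * j + w) / n = j := by
    rw [Nat.mul_add_div (by omega), Nat.div_eq_of_lt hw, add_zero]
  have h2 : (n * j' + w') / n = j' := by
    rw [Nat.mul_add_div (by omega), Nat.div_eq_of_lt hw', add_zero]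
  have h3 : j = j' := by rw [← h1, ← h2, h]
  subst h3
  exact ⟨rfl, by omega⟩

theorem MemIs.writePt {n : ℕ} {m : ℕ → ℝ} {X : ℕ → ℕ → ℂ} (h : MemIs n m X) {j₀ w₀ : ℕ}
    (hw₀ : w₀ < n) (z : ℂ) : MemIs n (writePt m (2 * (n * j₀) + 2 * w₀) z)
      fun j w => if j = j₀ ∧ w = w₀ then z else X j w := by
  intro j w hw
  by_cases he : j = j₀ ∧ w = w₀
  · obtain ⟨rfl, rfl⟩ := he
    simp [readPt, RealRAM.writePt]
  · have hne : n * j + w ≠ n * j₀ + w₀ := fun h => he (mul_add_inj hw hw₀ h)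
    simp only [he, if_false]
    rw [← h j w hw]
    -- Points occupy two cells each, starting at even addresses, so different points do not share a
    -- cell.
    have e1 : 2 * (n * j) + 2 * w ≠ 2 * (n * j₀) + 2 * w₀ := by omega
    have e2 : 2 * (n * j) + 2 * w ≠ 2 * (n * j₀) + 2 * w₀ + 1 := by omega
    have e3 : 2 * (n * j) + 2 * w + 1 ≠ 2 * (n * j₀) + 2 * w₀ := by omega
    have e4 : 2 * (n * j) + 2 * w + 1 ≠ 2 * (n * j₀) + 2 * w₀ + 1 := by omega
    simp [readPt, RealRAM.writePt, e1, e2, e3]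

theorem MemIs.congr {n : ℕ} {m : ℕ → ℝ} {X Y : ℕ → ℕ → ℂ} (h : MemIs n m X)
    (hXY : ∀ j w, w < n → X j w = Y j w) : MemIs n m Y :=
  fun j w hw => (h j w hw).trans (hXY j w hw)

def Code.seqs : List Code → Code
  | [] => .skip
  | c :: l => .seq c (Code.seqs l)

/-! ### Copying a drawing -/

/-- Copies a point from the address in register 9 to the address in register 15. -/
def copyBody : Code :=
  .seq (.setC 11 12 (.mem 9 17)) (.seq (.storeC 15 17 11 12)
    (.seq (.setN 9 (.add (.var 9) (.const 2))) (.setN 15 (.add (.var 15) (.const 2)))))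

theorem copyBody_legal (σ : View) : copyBody.Legal σ :=
  ⟨Code.legal_setC (CExp.indep_mem _ _ _) (CExp.legal_mem _ _ _), Code.legal_storeC _ _ _ _ _,
    trivial, trivial⟩

theorem eval_copyBody (σ : View) : copyBody.eval σ =
    { σ with
      nreg := Function.update (Function.update σ.nreg 9 (σ.nreg 9 + 2)) 15 (σ.nreg 15 + 2)
      rreg := Function.update (Function.update σ.rreg 11 (readPt σ.rmem (σ.nreg 9 + σ.nreg 17)).re)
        12 (readPt σ.rmem (σ.nreg 9 + σ.nreg 17)).im
      rmem := writePt σ.rmem (σ.nreg 15 + σ.nreg 17) (readPt σ.rmem (σ.nreg 9 + σ.nreg 17)) } := by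
  simp [copyBody, Code.eval, Code.eval_setC (CExp.indep_mem _ _ _), NExp.eval]

/-- Two views agree except in the given registers and the real memory. -/
structure View.Frame (N R : List (Fin 64)) (σ τ : View) : Prop where
  nreg : ∀ i, i ∉ N → τ.nreg i = σ.nreg i
  rreg : ∀ i, i ∉ R → τ.rreg i = σ.rreg i
  nmem : τ.nmem = σ.nmem

theorem View.Frame.refl (N R : List (Fin 64)) (σ : View) : View.Frame N R σ σ :=
  ⟨fun _ _ => rfl, fun _ _ => rfl, rfl⟩

theorem View.Frame.trans {N R : List (Fin 64)} {σ τ ρ : View} (h : View.Frame N R σ τ)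
    (h' : View.Frame N R τ ρ) : View.Frame N R σ ρ :=
  ⟨fun i hi => (h'.nreg i hi).trans (h.nreg i hi), fun i hi => (h'.rreg i hi).trans (h.rreg i hi),
    h'.nmem.trans h.nmem⟩

theorem achieves_copy {n js jd : ℕ} (hj : js ≠ jd) {X : ℕ → ℕ → ℂ} {σ : View}
    (hX : MemIs n σ.rmem X) (h9 : σ.nreg 9 = 2 * (n * js)) (h15 : σ.nreg 15 = 2 * (n * jd))
    (h8 : σ.nreg 8 = 2 * (n * js) + 2 * n) (h17 : σ.nreg 17 = 0) :
    Achieves (.loop (.natLt (9 : Fin 64) (8 : Fin 64)) copyBody.compile)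
      (n * (copyBody.cost + 1) + 1) σ fun τ => View.Frame [9, 15] [11, 12] σ τ ∧
        MemIs n τ.rmem fun j w => if j = jd then X js w else X j w := by
  have main := Achieves.loop (c := copyBody) (x := 9) (y := 8) (σ := σ) (m := n)
    -- After `t` rounds the first `t` points are copied; the source is intact because it is a
    -- different drawing.
    (fun t τ => View.Frame [9, 15] [11, 12] σ τ ∧ τ.nreg 9 = 2 * (n * js) + 2 * t ∧
      τ.nreg 15 = 2 * (n * jd) + 2 * t ∧
      MemIs n τ.rmem fun j w => if j = jd ∧ w < t then X js w else X j w) ?_ ?_ ?_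
  · intro s hs
    obtain ⟨s', t, e, ht, hf, -, -, hm⟩ := main s hs
    refine ⟨s', t, e, ht, hf, hm.congr fun j w hw => ?_⟩
    simp [hw]
  · rintro t ht τ ⟨hf, k9, k15, hm⟩
    have k8 : τ.nreg 8 = 2 * (n * js) + 2 * n := by rw [hf.nreg 8 (by decide), h8]
    have k17 : τ.nreg 17 = 0 := by rw [hf.nreg 17 (by decide), h17]
    refine ⟨by omega, copyBody_legal _, ?_⟩
    rw [eval_copyBody, k9, k15, k17]
    refine ⟨hf.trans ⟨?_, ?_, rfl⟩, by simp; ring, by simp; ring, ?_⟩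
    · intro i hi
      simp only [List.mem_cons, List.not_mem_nil, or_false, not_or] at hi
      simp [hi.1, hi.2]
    · intro i hi
      simp only [List.mem_cons, List.not_mem_nil, or_false, not_or] at hi
      simp [hi.1, hi.2]
    · refine (hm.writePt ht _).congr fun j w hw => ?_
      rw [add_zero, hm js t ht]
      by_cases h1 : j = jd
      · subst h1
        by_cases h2 : w = t
        · subst h2; simp [hj]
        · have : w < t + 1 ↔ w < t := by omega
          simp [h2, this]
      · simp [h1]
  · rintro τ ⟨hf, k9, -, -⟩
    rw [k9, hf.nreg 8 (by decide), h8]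
    exact lt_irrefl _
  · refine ⟨View.Frame.refl _ _ _, by rw [h9]; ring, by rw [h15]; ring, ?_⟩
    simpa using hX

end RealRAM

namespace RealRAM

/-! ### The neighbors of `v` -/

/-- The register that holds neighbor number `j`. -/
def nb (j : Fin 5) : Fin 64 := ⟨20 + j, by omega⟩

theorem nb_ne (j : Fin 5) {x : Fin 64} (hx : (x : ℕ) < 20) : nb j ≠ x := by
  intro h
  have : (nb j : ℕ) = x := congrArg _ h
  simp only [nb] at this
  omega

theorem nb_injective : Function.Injective nb := by
  intro i j h
  have : (nb i : ℕ) = nb j := congrArg _ h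
  simp only [nb] at this
  exact Fin.ext (by omega)

/-- Loads the neighbors of `v` from the list at the address in register 15, with the length in
register 16. If there are fewer than five, then `u` is repeated. -/
def loadNb (j : Fin 5) : Code :=
  .ifN (.const j) (.var 16)
    (.setN (nb j) (.add (.load (.add (.var 15) (.const j))) (.load (.add (.var 15) (.const j)))))
    (.setN (nb j) (.var 3))

theorem loadNb_legal (j : Fin 5) (σ : View) : (loadNb j).Legal σ := ⟨fun _ => trivial, fun _ => trivial⟩

theorem eval_loadNb (j : Fin 5) (σ : View) : (loadNb j).eval σ =
    { σ with nreg := Function.update σ.nreg (nb j) (if (j : ℕ) < σ.nreg 16 then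
        2 * σ.nmem (σ.nreg 15 + j) else σ.nreg 3) } := by
  by_cases h : (j : ℕ) < σ.nreg 16
  · refine (if_pos h).trans ?_
    rw [if_pos h, two_mul]
    rfl
  · refine (if_neg h).trans ?_
    rw [if_neg h]
    rfl

theorem eval_loadNbs (l : List (Fin 5)) (σ : View) : ((Code.seqs (l.map loadNb)).Legal σ) ∧
    ∃ f, (Code.seqs (l.map loadNb)).eval σ = { σ with nreg := f } ∧
      (∀ x, (∀ j ∈ l, x ≠ nb j) → f x = σ.nreg x) ∧
      ∀ j ∈ l, f (nb j) = if (j : ℕ) < σ.nreg 16 then 2 * σ.nmem (σ.nreg 15 + j) else σ.nreg 3 := by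
  induction l generalizing σ with
  | nil => exact ⟨trivial, σ.nreg, rfl, fun _ _ => rfl, by simp⟩
  | cons i l ih =>
    obtain ⟨hl, f, h1, h2, h3⟩ := ih ((loadNb i).eval σ)
    refine ⟨⟨loadNb_legal i σ, hl⟩, f, ?_, ?_, ?_⟩
    · simp only [List.map_cons, Code.seqs, Code.eval]
      rw [h1, eval_loadNb]
    · intro x hx
      rw [h2 x fun j hj => hx j (List.mem_cons_of_mem _ hj), eval_loadNb]
      simp [hx i List.mem_cons_self]
    · have e3 : ∀ x : Fin 64, (x : ℕ) < 20 → ((loadNb i).eval σ).nreg x = σ.nreg x := by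
        intro x hx
        rw [eval_loadNb]
        simp [(nb_ne i hx).symm]
      have en : ((loadNb i).eval σ).nmem = σ.nmem := by rw [eval_loadNb]
      rw [e3 16 (by decide), e3 15 (by decide), e3 3 (by decide), en] at h3
      intro j hj
      by_cases hjl : j ∈ l
      · exact h3 j hjl
      · obtain rfl : j = i := by
          rcases List.mem_cons.1 hj with h | h
          · exact h
          · contradiction
        rw [h2 (nb j) fun j' hj' he => hjl (nb_injective he ▸ hj'), eval_loadNb]
        simp

/-! ### Searching for the neighbors of `v` next to `u` -/

/-- The determinant, with a sign. -/
def signedCross (m : Bool) (a b : ℂ) : ℝ := if m then cross a b else cross b a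

def CExp.signedCross (m : Bool) (a b : CExp) : RExp := if m then a.cross b else b.cross a

theorem CExp.eval_signedCross (m : Bool) (σ : View) (a b : CExp) :
    (CExp.signedCross m a b).eval σ = RealRAM.signedCross m (a.eval σ) (b.eval σ) := by
  cases m <;> simp [CExp.signedCross, RealRAM.signedCross]

theorem CExp.legal_signedCross (m : Bool) {σ : View} {a b : CExp} (ha : a.Legal σ)
    (hb : b.Legal σ) : (CExp.signedCross m a b).Legal σ := by
  cases m <;> simp [CExp.signedCross, ha, hb]

theorem signedCross_swap (m : Bool) (a b : ℂ) : signedCross m b a = -signedCross m a b := by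
  cases m <;> simp [signedCross, cross_swap a b]

/-- The position of neighbor `j` relative to `v`, in the first drawing. -/
def nbExp (j : Fin 64) : CExp := (CExp.mem 6 j).sub (.reg 0 1)

/-- Replaces the current neighbor (with offset in register `o` and relative position in the
registers `x` and `y`) by neighbor `j` if this is nearer to `u` in circular order. -/
def searchNb (m : Bool) (o x y : Fin 64) (j : Fin 5) : Code :=
  .ifR (.const 0) (CExp.signedCross m (nbExp 3) (nbExp (nb j)))
    (.ifR (.const 0) (CExp.signedCross m (nbExp (nb j)) (.reg x y))
      (.seq (.setN o (.var (nb j))) (.setC x y (nbExp (nb j)))) .skip) .skip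

theorem nbExp_indep {x : Fin 64} (h0 : x ≠ 0) (h1 : x ≠ 1) (j : Fin 64) : (nbExp j).Indep x :=
  (CExp.indep_mem _ _ _).sub (CExp.indep_reg h0.symm h1.symm)

theorem nbExp_legal (j : Fin 64) (σ : View) : (nbExp j).Legal σ := by simp [nbExp]

theorem searchNb_legal (m : Bool) {o x y : Fin 64} (h0 : x ≠ 0) (h1 : x ≠ 1) (j : Fin 5)
    (σ : View) : (searchNb m o x y j).Legal σ :=
  ⟨trivial, CExp.legal_signedCross m (nbExp_legal _ _) (nbExp_legal _ _),
    fun _ => ⟨trivial, CExp.legal_signedCross m (nbExp_legal _ _) (CExp.legal_reg _ _ _),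
      fun _ => ⟨trivial, Code.legal_setC (nbExp_indep h0 h1 _) (nbExp_legal _ _)⟩,
      fun _ => trivial⟩, fun _ => trivial⟩

/-- The search keeps the nearest neighbor and finds it if it is in the list. -/
theorem eval_searchNbs (m : Bool) {o x y : Fin 64} (ho : (o : ℕ) < 20) (ho3 : o ≠ 3) (ho6 : o ≠ 6)
    (hx0 : x ≠ 0) (hx1 : x ≠ 1) (hy0 : y ≠ 0) (hy1 : y ≠ 1) (hxy : x ≠ y)
    (z : ℂ) (off : ℕ) (l : List (Fin 5)) (σ : View)
    (hz : ∀ j ∈ l, ((nbExp (nb j)).eval σ = z ∧ σ.nreg (nb j) = off) ∨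
      ¬ 0 < signedCross m ((nbExp 3).eval σ) ((nbExp (nb j)).eval σ) ∨
      0 < signedCross m z ((nbExp (nb j)).eval σ))
    (hu : 0 < signedCross m ((nbExp 3).eval σ) z)
    (hσ : (σ.nreg o = off ∧ (⟨σ.rreg x, σ.rreg y⟩ : ℂ) = z) ∨
      0 < signedCross m z ⟨σ.rreg x, σ.rreg y⟩) :
    (Code.seqs (l.map (searchNb m o x y))).Legal σ ∧
    View.Frame [o] [x, y] σ ((Code.seqs (l.map (searchNb m o x y))).eval σ) ∧
      ((Code.seqs (l.map (searchNb m o x y))).eval σ).rmem = σ.rmem ∧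
      (((σ.nreg o = off ∧ (⟨σ.rreg x, σ.rreg y⟩ : ℂ) = z) ∨
        ∃ j ∈ l, (nbExp (nb j)).eval σ = z ∧ σ.nreg (nb j) = off) →
        ((Code.seqs (l.map (searchNb m o x y))).eval σ).nreg o = off) := by
  induction l generalizing σ with
  | nil =>
    refine ⟨trivial, View.Frame.refl _ _ _, rfl, ?_⟩
    rintro (h | ⟨j, hj, -⟩)
    · exact h.1
    · simp at hj
  | cons i l ih =>
    set τ := (searchNb m o x y i).eval σ with hτ
    -- Invariant: the candidate is the wanted neighbor or lies beyond it. Once found, the wanted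
    -- neighbor is not replaced, since nothing eligible lies between `u` and it.
    have hstep : View.Frame [o] [x, y] σ τ ∧ τ.rmem = σ.rmem ∧
        ((τ.nreg o = off ∧ (⟨τ.rreg x, τ.rreg y⟩ : ℂ) = z) ∨
          0 < signedCross m z ⟨τ.rreg x, τ.rreg y⟩) ∧
        (((σ.nreg o = off ∧ (⟨σ.rreg x, σ.rreg y⟩ : ℂ) = z) ∨
          (nbExp (nb i)).eval σ = z ∧ σ.nreg (nb i) = off) →
          (τ.nreg o = off ∧ (⟨τ.rreg x, τ.rreg y⟩ : ℂ) = z)) := by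
      have hzi := hz i List.mem_cons_self
      simp only [searchNb, Code.eval, CExp.eval_signedCross, RExp.eval, Int.cast_zero,
        CExp.eval_reg, NExp.eval, Code.eval_setC (nbExp_indep hx0 hx1 _)] at hτ
      by_cases c1 : 0 < signedCross m ((nbExp 3).eval σ) ((nbExp (nb i)).eval σ)
      · rw [if_pos c1] at hτ
        by_cases c2 : 0 < signedCross m ((nbExp (nb i)).eval σ) ⟨σ.rreg x, σ.rreg y⟩
        · rw [if_pos c2] at hτ
          have hev : (nbExp (nb i)).eval { σ with nreg := Function.update σ.nreg o (σ.nreg (nb i)) } =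
              (nbExp (nb i)).eval σ := by
            simp [nbExp, ho6.symm, nb_ne i ho]
          have ht1 : τ.nreg o = σ.nreg (nb i) := by rw [hτ]; simp
          have ht2 : (⟨τ.rreg x, τ.rreg y⟩ : ℂ) = (nbExp (nb i)).eval σ := by
            rw [hτ]
            simp [hxy, hev]
          refine ⟨⟨?_, ?_, ?_⟩, ?_, ?_, ?_⟩
          · intro k hk
            simp only [List.mem_singleton] at hk
            rw [hτ]; simp [hk]
          · intro k hk
            simp only [List.mem_cons, List.not_mem_nil, or_false, not_or] at hk
            rw [hτ]; simp [hk.1, hk.2]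
          · rw [hτ]
          · rw [hτ]
          · rw [ht1, ht2]
            rcases hzi with h | h | h
            · exact Or.inl ⟨h.2, h.1⟩
            · exact absurd c1 h
            · exact Or.inr h
          · rw [ht1, ht2]
            rintro (h | h)
            · rcases hzi with h' | h' | h'
              · exact ⟨h'.2, h'.1⟩
              · exact absurd c1 h'
              · rw [h.2, signedCross_swap] at c2
                linarith
            · exact ⟨h.2, h.1⟩
        · rw [if_neg c2] at hτ
          rw [hτ]
          refine ⟨View.Frame.refl _ _ _, rfl, hσ, ?_⟩
          rintro (h | h)
          · exact h
          · rcases hσ with h' | h'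
            · exact h'
            · rw [h.1] at c2
              exact absurd h' c2
      · rw [if_neg c1] at hτ
        rw [hτ]
        refine ⟨View.Frame.refl _ _ _, rfl, hσ, ?_⟩
        rintro (h | h)
        · exact h
        · rw [h.1] at c1
          exact absurd hu c1
    obtain ⟨hf, hm, hI, hT⟩ := hstep
    have e1 : ∀ w : Fin 64, w ≠ o → (nbExp w).eval τ = (nbExp w).eval σ := by
      intro w hw
      simp only [nbExp, CExp.eval_sub, CExp.eval_mem, CExp.eval_reg]
      rw [hm, hf.nreg 6 (by simpa using ho6.symm), hf.nreg w (by simpa using hw),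
        hf.rreg 0 (by simp [hx0.symm, hy0.symm]), hf.rreg 1 (by simp [hx1.symm, hy1.symm])]
    have e2 : ∀ j, (nbExp (nb j)).eval τ = (nbExp (nb j)).eval σ := fun j => e1 _ (nb_ne j ho)
    have e3 := e1 3 ho3.symm
    have e4 : ∀ j, τ.nreg (nb j) = σ.nreg (nb j) := fun j =>
      hf.nreg _ (by simpa using nb_ne j ho)
    obtain ⟨k0, k1, k2, k3⟩ := ih τ
      (fun j hj => by rw [e2, e3, e4]; exact hz j (List.mem_cons_of_mem _ hj))
      (by rw [e3]; exact hu) hI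
    refine ⟨⟨searchNb_legal m hx0 hx1 i σ, k0⟩, hf.trans k1, k2.trans hm, ?_⟩
    intro h
    apply k3
    rcases h with h | ⟨j, hj, h⟩
    · exact Or.inl (hT (Or.inl h))
    · rcases List.mem_cons.1 hj with rfl | hj
      · exact Or.inl (hT (Or.inr h))
      · exact Or.inr ⟨j, hj, by rw [e2, e4]; exact h⟩

/-! ### The scale -/

/-- The contribution of two neighbors of `v` to the bound, given their positions relative to
`u`. -/
noncomputable def pairTerm (X Y : ℂ) : ℝ :=
  Complex.normSq X + Complex.normSq Y + if 0 < cross X Y then 1 / cross X Y else 0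

/-- The position of a neighbor relative to `u`, in the current drawing. -/
def relExp (w : Fin 64) : CExp := (CExp.mem 6 w).sub (.mem 6 3)

def pairCode (ij : Fin 5 × Fin 5) : Code :=
  .seq (.setR 6 (.add (.var 6) (.add (relExp (nb ij.1)).normSq (relExp (nb ij.2)).normSq)))
    (.ifR (.const 0) ((relExp (nb ij.1)).cross (relExp (nb ij.2)))
      (.setR 6 (.add (.var 6) (.div (.const 1) ((relExp (nb ij.1)).cross (relExp (nb ij.2))))))
      .skip)

theorem eval_relExp (w : Fin 64) (σ : View) : (relExp w).eval σ =
    readPt σ.rmem (σ.nreg 6 + σ.nreg w) - readPt σ.rmem (σ.nreg 6 + σ.nreg 3) := rfl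

theorem relExp_legal (w : Fin 64) (σ : View) : (relExp w).Legal σ := by simp [relExp]

theorem eval_relExp_update (w : Fin 64) (σ : View) (f : Fin 64 → ℝ) :
    (relExp w).eval { σ with rreg := f } = (relExp w).eval σ := rfl

theorem eval_pairCode (ij : Fin 5 × Fin 5) (σ : View) : (pairCode ij).Legal σ ∧
    (pairCode ij).eval σ = { σ with rreg := Function.update σ.rreg 6 (σ.rreg 6 +
      pairTerm ((relExp (nb ij.1)).eval σ) ((relExp (nb ij.2)).eval σ)) } := by
  constructor
  · refine ⟨?_, trivial, ?_, fun h => ⟨trivial, trivial, ?_, ?_⟩, fun _ => trivial⟩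
    · simp [Code.Legal, RExp.Legal, relExp_legal]
    · simp [relExp_legal]
    · simp [relExp_legal]
    · refine ne_of_gt (lt_of_eq_of_lt ?_ h)
      simp [RExp.eval]
  · simp only [pairCode, Code.eval, RExp.eval, CExp.eval_cross, CExp.eval_normSq, Int.cast_zero,
      Int.cast_one, eval_relExp_update, pairTerm]
    split_ifs with h
    · simp [add_assoc]
    · simp

/-- All ordered pairs are used because the cyclic order of the neighbors is not known to the
program; superfluous pairs only enlarge the bound. -/
def pairs : List (Fin 5 × Fin 5) := List.finRange 5 ×ˢ List.finRange 5

theorem mem_pairs (ij : Fin 5 × Fin 5) : ij ∈ pairs := by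
  exact List.pair_mem_product.2 ⟨List.mem_finRange _, List.mem_finRange _⟩

theorem eval_pairCodes (l : List (Fin 5 × Fin 5)) (σ : View) :
    (Code.seqs (l.map pairCode)).Legal σ ∧
    (Code.seqs (l.map pairCode)).eval σ = { σ with rreg := Function.update σ.rreg 6 (σ.rreg 6 +
      (l.map fun ij => pairTerm ((relExp (nb ij.1)).eval σ) ((relExp (nb ij.2)).eval σ)).sum) } := by
  induction l generalizing σ with
  | nil => exact ⟨trivial, by simp [Code.seqs, Code.eval]⟩
  | cons i l ih =>
    obtain ⟨h1, h2⟩ := eval_pairCode i σ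
    obtain ⟨h3, h4⟩ := ih ((pairCode i).eval σ)
    refine ⟨⟨h1, h3⟩, ?_⟩
    simp only [List.map_cons, Code.seqs, Code.eval]
    rw [h4, h2]
    simp only [eval_relExp_update, List.sum_cons, Function.update_self, Function.update_idem,
      add_assoc]

/-! ### The next position of `v` -/

/-- The position of a vertex relative to `u`, in the next drawing. -/
def relExp' (w : Fin 64) : CExp := (CExp.mem 15 w).sub (.mem 15 3)

/-- Computes the direction of motion. -/
def directionCode : Code :=
  .ifR (.const 0) ((relExp' 4).sub (relExp 4)).normSq (.setC 7 8 ((relExp' 4).sub (relExp 4)))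
    (.setC 7 8 ((relExp' 5).sub (relExp 5)))

theorem relExp_indep (x w : Fin 64) : (relExp w).Indep x :=
  (CExp.indep_mem _ _ _).sub (CExp.indep_mem _ _ _)

theorem relExp'_indep (x w : Fin 64) : (relExp' w).Indep x :=
  (CExp.indep_mem _ _ _).sub (CExp.indep_mem _ _ _)

theorem relExp'_legal (w : Fin 64) (σ : View) : (relExp' w).Legal σ := by simp [relExp']

theorem eval_relExp'_update (w : Fin 64) (σ : View) (f : Fin 64 → ℝ) :
    (relExp' w).eval { σ with rreg := f } = (relExp' w).eval σ := rfl

theorem eval_directionCode (σ : View) : directionCode.Legal σ ∧ directionCode.eval σ =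
    { σ with
      rreg := Function.update (Function.update σ.rreg 7
        (shiftDirection ((relExp 4).eval σ) ((relExp 5).eval σ) ((relExp' 4).eval σ)
          ((relExp' 5).eval σ)).re) 8
        (shiftDirection ((relExp 4).eval σ) ((relExp 5).eval σ) ((relExp' 4).eval σ)
          ((relExp' 5).eval σ)).im } := by
  have i4 := (relExp'_indep 7 4).sub (relExp_indep 7 4)
  have i5 := (relExp'_indep 7 5).sub (relExp_indep 7 5)
  constructor
  · refine ⟨trivial, ?_, fun _ => Code.legal_setC i4 ?_, fun _ => Code.legal_setC i5 ?_⟩ <;>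
      simp [relExp_legal, relExp'_legal]
  · simp only [directionCode, Code.eval, RExp.eval, CExp.eval_normSq, CExp.eval_sub, Int.cast_zero,
      Code.eval_setC i4, Code.eval_setC i5, shiftDirection, Complex.normSq_apply]
    split_ifs <;> rfl

/-- Computes the amount of motion. -/
def amountCode : Code :=
  .ifR (.mul (.var 12) (.var 14)) (.const 0)
    (.setR 15 (.div (.sub (.const 0) (.add (.div (.var 11) (.var 12)) (.div (.var 13) (.var 14))))
      (.const 2)))
    (.seq (.ifR (.const 0) (.mul (.var 12) (.var 12))
        (.setR 15 (.div (.add (.const 1) (.mul (.var 11) (.var 11))) (.var 12)))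
        (.setR 15 (.const 0)))
      (.ifR (.const 0) (.mul (.var 14) (.var 14))
        (.setR 15 (.add (.var 15) (.div (.add (.const 1) (.mul (.var 13) (.var 13))) (.var 14))))
        .skip))

/-- The machine gets stuck on division by zero, so branches reproduce the convention `x / 0 = 0` in
`shiftAmount`. A test for `x ≠ 0` is made as `0 < x * x`. -/
theorem eval_amountCode (σ : View) : amountCode.Legal σ ∧ amountCode.eval σ =
    { σ with
      rreg := Function.update σ.rreg 15
        (shiftAmount (σ.rreg 11) (σ.rreg 12) (σ.rreg 13) (σ.rreg 14)) } := by
  have h0 : ∀ x : ℝ, 0 < x * x ↔ x ≠ 0 := fun x => mul_self_pos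
  by_cases hs : σ.rreg 12 * σ.rreg 14 < 0
  · have hA := left_ne_zero_of_mul hs.ne
    have hB := right_ne_zero_of_mul hs.ne
    constructor
    · simp [amountCode, Code.Legal, RExp.Legal, RExp.eval, hs, hA, hB]
    · simp [amountCode, Code.eval, RExp.eval, hs, shiftAmount]
  · by_cases hA : σ.rreg 12 = 0 <;> by_cases hB : σ.rreg 14 = 0
    · constructor
      · simp [amountCode, Code.Legal, Code.eval, RExp.Legal, RExp.eval, hA, hB]
      · simp [amountCode, Code.eval, RExp.eval, hA, hB, shiftAmount]
    · constructor
      · simp [amountCode, Code.Legal, Code.eval, RExp.Legal, RExp.eval, hA, hB]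
      · simp [amountCode, Code.eval, RExp.eval, hA, hB, h0, shiftAmount]
    · constructor
      · simp [amountCode, Code.Legal, Code.eval, RExp.Legal, RExp.eval, hA, hB, h0]
      · simp [amountCode, Code.eval, RExp.eval, hA, hB, h0, shiftAmount]
    · constructor
      · simp only [amountCode, Code.Legal, Code.eval, RExp.Legal, RExp.eval, Int.cast_zero]
        simp [hs, hA, hB, h0]
      · simp only [amountCode, Code.eval, RExp.eval, Int.cast_zero, shiftAmount]
        simp [hs, hA, hB, h0]

/-- Computes the position of `v` relative to `u` in the next drawing. -/
def stepCode : Code :=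
  .seq directionCode <| .seq (.setR 11 ((relExp' 4).cross (.reg 4 5))) <|
  .seq (.setR 12 ((relExp' 4).cross (.reg 7 8))) <|
  .seq (.setR 13 ((CExp.reg 4 5).cross (relExp' 5))) <|
  .seq (.setR 14 ((CExp.reg 7 8).cross (relExp' 5))) <| .seq amountCode <|
  .seq (.setR 4 (.add (.var 4) (.mul (.var 15) (.var 7))))
    (.setR 5 (.add (.var 5) (.mul (.var 15) (.var 8))))

theorem eval_stepCode (σ : View) : stepCode.Legal σ ∧
    (stepCode.eval σ).nreg = σ.nreg ∧ (stepCode.eval σ).nmem = σ.nmem ∧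
    (stepCode.eval σ).rmem = σ.rmem ∧ (stepCode.eval σ).rreg 0 = σ.rreg 0 ∧
    (stepCode.eval σ).rreg 1 = σ.rreg 1 ∧ (stepCode.eval σ).rreg 6 = σ.rreg 6 ∧
    (⟨(stepCode.eval σ).rreg 4, (stepCode.eval σ).rreg 5⟩ : ℂ) =
      nextPosition ((relExp 4).eval σ) ((relExp 5).eval σ) ((relExp' 4).eval σ)
        ((relExp' 5).eval σ) ⟨σ.rreg 4, σ.rreg 5⟩ := by
  constructor
  · refine ⟨(eval_directionCode σ).1, ?_, ?_, ?_, ?_, (eval_amountCode _).1, ?_, ?_⟩ <;>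
      simp [Code.Legal, RExp.Legal, relExp'_legal]
  · simp only [stepCode, Code.eval, (eval_directionCode _).2, (eval_amountCode _).2, RExp.eval,
      CExp.eval_cross, CExp.eval_reg, eval_relExp'_update]
    refine ⟨trivial, trivial, trivial, by simp, by simp, by simp, ?_⟩
    simp only [nextPosition]
    apply Complex.ext <;> simp

end RealRAM

/-! ### The sequence of relative positions and the scale. -/

namespace RealRAM

/-- The positions of `v` relative to `u`. -/
noncomputable def positionSeq {W : Type*} (u a b : W) (E : ℕ → W → ℂ) (r₀ : ℂ) : ℕ → ℂ
  | 0 => r₀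
  | i + 1 => relativeStep u a b (E i) (E (i + 1)) (positionSeq u a b E r₀ i)

/-- The contribution of a drawing to the scale. -/
noncomputable def pairSum {W : Type*} (u : W) (y : Fin 5 → W) (d : W → ℂ) : ℝ :=
  (pairs.map fun ij => pairTerm (d (y ij.1) - d u) (d (y ij.2) - d u)).sum

/-- An upper bound for the coordinates, and for the inverse areas, in the first drawings. -/
noncomputable def scaleBound {W : Type*} (u : W) (y : Fin 5 → W) (E : ℕ → W → ℂ) (r : ℕ → ℂ) :
    ℕ → ℝ
  | 0 => 1 + Complex.normSq (r 0) + pairSum u y (E 0)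
  | i + 1 => scaleBound u y E r i + (Complex.normSq (r (i + 1)) + pairSum u y (E (i + 1)))

theorem pairTerm_nonneg (X Y : ℂ) : 0 ≤ pairTerm X Y := by
  have h1 := Complex.normSq_nonneg X
  have h2 := Complex.normSq_nonneg Y
  unfold pairTerm
  split_ifs with h
  · positivity
  · positivity

variable {W : Type*} {u : W} {y : Fin 5 → W} {E : ℕ → W → ℂ} {r : ℕ → ℂ}

theorem pairTerm_le_pairSum (d : W → ℂ) (i j : Fin 5) :
    pairTerm (d (y i) - d u) (d (y j) - d u) ≤ pairSum u y d :=
  List.single_le_sum (by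
    intro x hx
    obtain ⟨ij, -, rfl⟩ := List.mem_map.1 hx
    exact pairTerm_nonneg _ _) _ (List.mem_map.2 ⟨(i, j), mem_pairs _, rfl⟩)

theorem pairSum_nonneg (d : W → ℂ) : 0 ≤ pairSum u y d :=
  (pairTerm_nonneg _ _).trans (pairTerm_le_pairSum d 0 0)

theorem scaleBound_mono : Monotone (scaleBound u y E r) :=
  monotone_nat_of_le_succ fun i => by
    have h1 := Complex.normSq_nonneg (r (i + 1))
    have h2 := pairSum_nonneg (u := u) (y := y) (E (i + 1))
    simp only [scaleBound]
    linarith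

theorem one_le_scaleBound (i : ℕ) : 1 ≤ scaleBound u y E r i := by
  have h1 := Complex.normSq_nonneg (r 0)
  have h2 := pairSum_nonneg (u := u) (y := y) (E 0)
  refine le_trans ?_ (scaleBound_mono (Nat.zero_le i))
  simp only [scaleBound]
  linarith

/-- The initial summand 1 survives in all partial sums, so it is available in addition to the
contribution of each single drawing. -/
theorem le_scaleBound {i k : ℕ} (h : i ≤ k) :
    1 + Complex.normSq (r i) ≤ scaleBound u y E r k ∧
      1 + pairSum u y (E i) ≤ scaleBound u y E r k := by
  have hm : scaleBound u y E r i ≤ scaleBound u y E r k := scaleBound_mono h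
  have h1 := Complex.normSq_nonneg (r i)
  have h2 := pairSum_nonneg (u := u) (y := y) (E i)
  cases i with
  | zero =>
    simp only [scaleBound] at hm
    exact ⟨by linarith, by linarith⟩
  | succ i =>
    have h3 := one_le_scaleBound (u := u) (y := y) (E := E) (r := r) i
    rw [scaleBound] at hm
    exact ⟨by linarith, by linarith⟩

/-- Without square roots on the machine, norms are bounded through their squares. -/
theorem norm_lt_one_add_normSq (z : ℂ) : ‖z‖ < 1 + Complex.normSq z := by
  rw [Complex.normSq_eq_norm_sq]
  nlinarith [sq_nonneg (‖z‖ - 1), sq_nonneg ‖z‖]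

theorem two_mul_norm_le (z : ℂ) : 2 * ‖z‖ ≤ 1 + Complex.normSq z := by
  rw [Complex.normSq_eq_norm_sq]
  nlinarith [sq_nonneg (‖z‖ - 1)]

theorem norm_sub_le_pairTerm (d : W → ℂ) (x z : W) :
    ‖d z - d x‖ ≤ 1 + pairTerm (d x - d u) (d z - d u) := by
  have h1 := two_mul_norm_le (d x - d u)
  have h2 := two_mul_norm_le (d z - d u)
  have h3 : ‖d z - d x‖ ≤ ‖d z - d u‖ + ‖d x - d u‖ := by
    rw [← sub_sub_sub_cancel_right (d z) (d x) (d u)]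
    exact norm_sub_le _ _
  have h4 : (0 : ℝ) ≤ if 0 < cross (d x - d u) (d z - d u) then 1 / cross (d x - d u) (d z - d u)
      else 0 := by
    split_ifs with h
    · positivity
    · exact le_rfl
  have h5 := Complex.normSq_nonneg (d x - d u)
  have h6 := Complex.normSq_nonneg (d z - d u)
  unfold pairTerm
  linarith

theorem one_div_le_of_pairTerm_le {B : ℝ} {X Y : ℂ} (h : pairTerm X Y ≤ B) (hc : 0 < cross X Y) :
    1 / B ≤ cross X Y := by
  have h5 := Complex.normSq_nonneg X
  have h6 := Complex.normSq_nonneg Y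
  rw [pairTerm, if_pos hc] at h
  have h1 : 1 / cross X Y ≤ B := by linarith
  have h2 : 0 < 1 / cross X Y := by positivity
  rw [one_div_le (h2.trans_le h1) hc]
  exact h1

end RealRAM

open RealRAM in
/-- The positions that are computed with the explicit scale convert the pseudomorph. -/
theorem isConversion_of_scaleBound {n k : ℕ} {G : SimpleGraph (Fin n)} {Γ₁ Γ₂ : Fin n → ℂ}
    {v u : Fin n} {D : Fin (k + 1) → {w : Fin n // w ≠ v} → ℂ} {σ : Fin n → Fin n}
    (h₁ : IsTriangulation G Γ₁) (hP : IsPseudomorph G Γ₁ Γ₂ v u D)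
    (hl : IsShortLink G v σ) (hσ : ∀ x, G.Adj v x → IsCcwFace G Γ₁ v x (σ x))
    (hσ₂ : ∀ x, G.Adj v x → 0 < orient (Γ₂ v) (Γ₂ x) (Γ₂ (σ x)))
    {b : Fin n} (hb : G.Adj v b) (hbu : σ b = u) {E : ℕ → ℕ → ℂ}
    (hE : ∀ (i : Fin (k + 1)) (w : {w : Fin n // w ≠ v}), E i (w : Fin n) = D i w)
    {y : Fin 5 → ℕ} (hy : ∀ x, G.Adj v x → ∃ j, y j = x) {r : ℕ → ℂ} {B : ℝ}
    (hr : r = positionSeq (u : ℕ) (σ u : Fin n) b E (Γ₁ v - E 0 u))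
    (hB : B = scaleBound (u : ℕ) y E r k) :
    IsConversion G Γ₁ Γ₂ v u D
      (conversionDrawings Γ₁ Γ₂ D fun i => E i u + (1 / (B * B * B)) • r i) := by
  have hu := hP.contract.adj
  have hau := hl.adj_next u hu
  have hE' : ∀ (i : Fin (k + 1)) (w : Fin n) (hw : w ≠ v), D i ⟨w, hw⟩ = E i w :=
    fun i w hw => (hE i ⟨w, hw⟩).symm
  have hBp : 1 ≤ B := hB ▸ one_le_scaleBound k
  have hpair : ∀ (i : Fin (k + 1)) (x z : Fin n), G.Adj v x → G.Adj v z →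
      1 + pairTerm (E i x - E i u) (E i z - E i u) ≤ B := by
    intro i x z hx hz
    obtain ⟨jx, hjx⟩ := hy x hx
    obtain ⟨jz, hjz⟩ := hy z hz
    have h := pairTerm_le_pairSum (u := (u : ℕ)) (y := y) (E i) jx jz
    rw [hjx, hjz] at h
    have h' := (le_scaleBound (u := (u : ℕ)) (y := y) (E := E) (r := r)
      (Nat.lt_succ_iff.1 i.2)).2
    rw [hB]
    linarith
  have main := isConversion_of_position (u' := ⟨u, hu.ne'⟩) (a := ⟨σ u, hau.ne'⟩)
    (b := ⟨b, hb.ne'⟩) (r := fun i => r i) (B := B) h₁ hP hl hσ hσ₂ rfl rfl hb hbu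
    (by linarith) ?_ ?_ ?_ ?_ ?_
  · simpa only [hE'] using main
  · subst hr
    have := hP.contract.fixed ⟨u, hu.ne'⟩
    rw [hE' 0 u hu.ne'] at this
    simp only [Fin.val_zero] at this ⊢
    rw [positionSeq, this]
  · intro i
    have e1 := fun w hw => hE' i.castSucc w hw
    have e2 := fun w hw => hE' i.succ w hw
    simp only [Fin.val_castSucc, Fin.val_succ] at e1 e2 ⊢
    rw [hr, positionSeq]
    simp only [relativeStep, e1, e2]
  · intro i
    refine (norm_lt_one_add_normSq _).trans_le ?_
    rw [hB]
    exact (le_scaleBound (Nat.lt_succ_iff.1 i.2)).1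
  · rintro i ⟨x, hx⟩ ⟨z, hz⟩ hxa he
    simp only at he hxa
    subst he
    rw [hE', hE']
    exact (norm_sub_le_pairTerm (u := (u : ℕ)) (E i) x (σ x : Fin n)).trans
      (hpair i _ _ hxa (hl.adj_next x hxa))
  · rintro i ⟨x, hx⟩ ⟨z, hz⟩ hxa he ho
    simp only at he hxa
    subst he
    rw [hE', hE', hE'] at ho ⊢
    have := hpair i _ _ hxa (hl.adj_next x hxa)
    exact one_div_le_of_pairTerm_le (by linarith) ho

namespace RealRAM

/-! ### The first part of the program: initialization -/

/-- The registers with the sizes and the offsets of vertices, except the neighbors next to `u`. -/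
structure HasOffsets (n k v u : ℕ) (y : Fin 5 → ℕ) (τ : View) : Prop where
  size : τ.nreg 0 = 2 * n
  steps : τ.nreg 1 = k
  vertex : τ.nreg 2 = 2 * v
  target : τ.nreg 3 = 2 * u
  zero : τ.nreg 17 = 0
  nbs : ∀ j, τ.nreg (nb j) = 2 * y j

theorem HasOffsets.congr {n k v u : ℕ} {y : Fin 5 → ℕ} {σ τ : View} (h : HasOffsets n k v u y σ)
    (hn : ∀ i : Fin 64, i ∉ [4, 5, 6, 7, 8, 9, 15] → τ.nreg i = σ.nreg i) :
    HasOffsets n k v u y τ where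
  size := (hn 0 (by decide)).trans h.size
  steps := (hn 1 (by decide)).trans h.steps
  vertex := (hn 2 (by decide)).trans h.vertex
  target := (hn 3 (by decide)).trans h.target
  zero := (hn 17 (by decide)).trans h.zero
  nbs j := by
    refine (hn _ ?_).trans (h.nbs j)
    simp only [List.mem_cons, List.not_mem_nil, or_false, not_or]
    exact ⟨nb_ne j (by decide), nb_ne j (by decide), nb_ne j (by decide), nb_ne j (by decide),
      nb_ne j (by decide), nb_ne j (by decide), nb_ne j (by decide)⟩

/-- Loads the sizes and the offsets of vertices. -/
def offsetCode : Code :=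
  .seq (.setN 17 (.const 0)) <|
  .seq (.setN 0 (.add (.load (.const 0)) (.load (.const 0)))) <|
  .seq (.setN 1 (.load (.const 1))) <|
  .seq (.setN 2 (.add (.load (.const 2)) (.load (.const 2)))) <|
  .seq (.setN 3 (.add (.load (.const 3)) (.load (.const 3)))) <|
  .seq (.setN 15 (.load (.add (.const 4) (.var 2)))) <|
  .seq (.setN 16 (.load (.add (.const 5) (.var 2)))) <|
  .seq (Code.seqs ((List.finRange 5).map loadNb)) (.setN 6 (.var 0))

theorem achieves_offsetCode {n k v u : ℕ} {y : Fin 5 → ℕ} {σ : View} (h0 : σ.nmem 0 = n)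
    (h1 : σ.nmem 1 = k) (h2 : σ.nmem 2 = v) (h3 : σ.nmem 3 = u)
    (hy : ∀ j : Fin 5, (if (j : ℕ) < σ.nmem (5 + 2 * v) then σ.nmem (σ.nmem (4 + 2 * v) + j) else u)
      = y j) :
    Achieves offsetCode.compile offsetCode.cost σ fun τ => HasOffsets n k v u y τ ∧
      τ.nreg 6 = 2 * n ∧ τ.rmem = σ.rmem := by
  have key : ∀ ρ : View, ρ.nreg 0 = 2 * n → ρ.nreg 1 = k → ρ.nreg 2 = 2 * v → ρ.nreg 3 = 2 * u →
      ρ.nreg 17 = 0 → ρ.nreg 15 = σ.nmem (4 + 2 * v) → ρ.nreg 16 = σ.nmem (5 + 2 * v) →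
      ρ.nmem = σ.nmem → ρ.rmem = σ.rmem →
      (Code.seq (Code.seqs ((List.finRange 5).map loadNb)) (.setN 6 (.var 0))).Legal ρ ∧
      HasOffsets n k v u y
        ((Code.seq (Code.seqs ((List.finRange 5).map loadNb)) (.setN 6 (.var 0))).eval ρ) ∧
      ((Code.seq (Code.seqs ((List.finRange 5).map loadNb)) (.setN 6 (.var 0))).eval ρ).nreg 6
        = 2 * n ∧
      ((Code.seq (Code.seqs ((List.finRange 5).map loadNb)) (.setN 6 (.var 0))).eval ρ).rmem
        = σ.rmem := by
    intro ρ k0 k1 k2 k3 k17 k15 k16 kn kr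
    obtain ⟨hl, f, e1, e2, e3⟩ := eval_loadNbs (List.finRange 5) ρ
    have e4 : ∀ x : Fin 64, (x : ℕ) < 20 → f x = ρ.nreg x :=
      fun x hx => e2 x fun j _ => (nb_ne j hx).symm
    simp only [Code.eval, e1, NExp.eval]
    refine ⟨⟨hl, trivial⟩, ⟨?_, ?_, ?_, ?_, ?_, ?_⟩, ?_, kr⟩
    · simp [e4 0 (by decide), k0]
    · simp [e4 1 (by decide), k1]
    · simp [e4 2 (by decide), k2]
    · simp [e4 3 (by decide), k3]
    · simp [e4 17 (by decide), k17]
    · intro j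
      simp only [ne_eq, nb_ne j (show ((6 : Fin 64) : ℕ) < 20 by decide), not_false_eq_true,
        Function.update_of_ne]
      rw [e3 j (List.mem_finRange j), k16, k15, k3, kn, ← hy j]
      split_ifs <;> rfl
    · simp [e4 0 (by decide), k0]
  have := key ((Code.seq (.setN 17 (.const 0)) <|
    .seq (.setN 0 (.add (.load (.const 0)) (.load (.const 0)))) <|
    .seq (.setN 1 (.load (.const 1))) <|
    .seq (.setN 2 (.add (.load (.const 2)) (.load (.const 2)))) <|
    .seq (.setN 3 (.add (.load (.const 3)) (.load (.const 3)))) <|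
    .seq (.setN 15 (.load (.add (.const 4) (.var 2)))) <|
    (.setN 16 (.load (.add (.const 5) (.var 2))))).eval σ)
    (by simp [Code.eval, NExp.eval, h0, two_mul]) (by simp [Code.eval, NExp.eval, h1])
    (by simp [Code.eval, NExp.eval, h2, two_mul]) (by simp [Code.eval, NExp.eval, h3, two_mul])
    (by simp [Code.eval, NExp.eval]) (by simp [Code.eval, NExp.eval, h2, two_mul])
    (by simp [Code.eval, NExp.eval, h2, two_mul]) rfl rfl
  exact Achieves.code ⟨trivial, trivial, trivial, trivial, trivial, trivial, trivial, this.1⟩ this.2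

/-- Loads the position of `v`, and starts both searches. -/
def positionCode : Code :=
  .seq (.setC 0 1 (.mem 17 2)) <| .seq (.setC 7 8 ((CExp.reg 0 1).sub (.mem 6 3)))
    (.setC 9 10 ((CExp.reg 0 1).sub (.mem 6 3)))

/-- Both searches start with the direction opposite to `u` as seen from `v`: every neighbor on the
relevant side of `u` comes before it, so the first eligible one replaces it. -/
theorem achieves_positionCode {n k v u : ℕ} {y : Fin 5 → ℕ} {σ : View} {X : ℕ → ℕ → ℂ}
    (hv : v < n) (hu : u < n) (h : HasOffsets n k v u y σ) (h6 : σ.nreg 6 = 2 * n)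
    (hX : MemIs n σ.rmem X) :
    Achieves positionCode.compile positionCode.cost σ fun τ => HasOffsets n k v u y τ ∧
      τ.nreg 6 = 2 * n ∧ MemIs n τ.rmem X ∧ (⟨τ.rreg 0, τ.rreg 1⟩ : ℂ) = X 0 v ∧
      (⟨τ.rreg 7, τ.rreg 8⟩ : ℂ) = X 0 v - X 1 u ∧ (⟨τ.rreg 9, τ.rreg 10⟩ : ℂ) = X 0 v - X 1 u := by
  have i1 : (CExp.mem 17 2).Indep 0 := CExp.indep_mem _ _ _
  have i2 : ((CExp.reg 0 1).sub (.mem 6 3)).Indep 7 :=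
    (CExp.indep_reg (by decide) (by decide)).sub (CExp.indep_mem _ _ _)
  have i3 : ((CExp.reg 0 1).sub (.mem 6 3)).Indep 9 :=
    (CExp.indep_reg (by decide) (by decide)).sub (CExp.indep_mem _ _ _)
  have m1 : readPt σ.rmem (σ.nreg 17 + σ.nreg 2) = X 0 v := by
    rw [← hX 0 v hv, h.zero, h.vertex, mul_zero, mul_zero]
  have m2 : readPt σ.rmem (σ.nreg 6 + σ.nreg 3) = X 1 u := by
    rw [← hX 1 u hu, h6, h.target, mul_one]
  refine Achieves.code ⟨Code.legal_setC i1 (by simp), Code.legal_setC i2 (by simp),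
    Code.legal_setC i3 (by simp)⟩ ?_
  simp only [positionCode, Code.eval, Code.eval_setC i1, Code.eval_setC i2, Code.eval_setC i3,
    CExp.eval_sub, CExp.eval_reg, CExp.eval_mem, m1, m2]
  exact ⟨h.congr fun _ _ => rfl, h6, hX, by simp, Complex.ext (by simp) (by simp),
    Complex.ext (by simp) (by simp)⟩

/-- Finds the neighbors next to `u`. -/
def searchCode : Code :=
  .seq (Code.seqs ((List.finRange 5).map (searchNb true 4 7 8)))
    (Code.seqs ((List.finRange 5).map (searchNb false 5 9 10)))

/-- Vertex `a` is the first neighbor after `u`, and there is no neighbor between them. The order is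
counterclockwise or clockwise. -/
structure IsNearest (m : Bool) (p : ℂ) (d : ℕ → ℂ) (y : Fin 5 → ℕ) (u a : ℕ) : Prop where
  pos : 0 < signedCross m (d u - p) (d a - p)
  mem : ∃ j, y j = a
  nearest : ∀ j, y j = a ∨ ¬ 0 < signedCross m (d u - p) (d (y j) - p) ∨
    0 < signedCross m (d a - p) (d (y j) - p)

theorem eval_search {m : Bool} {o x₁ x₂ : Fin 64} (ho : (o : ℕ) < 20) (ho3 : o ≠ 3) (ho6 : o ≠ 6)
    (hx0 : x₁ ≠ 0) (hx1 : x₁ ≠ 1) (hy0 : x₂ ≠ 0) (hy1 : x₂ ≠ 1) (hxy : x₁ ≠ x₂)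
    {n k v u a : ℕ} {y : Fin 5 → ℕ} {σ : View} {X : ℕ → ℕ → ℂ} (hu : u < n) (hy : ∀ j, y j < n)
    (h : HasOffsets n k v u y σ) (h6 : σ.nreg 6 = 2 * n) (hX : MemIs n σ.rmem X)
    (h01 : (⟨σ.rreg 0, σ.rreg 1⟩ : ℂ) = X 0 v)
    (hs : (⟨σ.rreg x₁, σ.rreg x₂⟩ : ℂ) = X 0 v - X 1 u) (ha : IsNearest m (X 0 v) (X 1) y u a) :
    (Code.seqs ((List.finRange 5).map (searchNb m o x₁ x₂))).Legal σ ∧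
    View.Frame [o] [x₁, x₂] σ
      ((Code.seqs ((List.finRange 5).map (searchNb m o x₁ x₂))).eval σ) ∧
    ((Code.seqs ((List.finRange 5).map (searchNb m o x₁ x₂))).eval σ).rmem = σ.rmem ∧
    ((Code.seqs ((List.finRange 5).map (searchNb m o x₁ x₂))).eval σ).nreg o = 2 * a := by
  have e1 : ∀ w' w, w < n → σ.nreg w' = 2 * w → (nbExp w').eval σ = X 1 w - X 0 v := by
    intro w' w hw hw'
    rw [← hX 1 w hw, ← h01]
    simp [nbExp, h6, hw']
  have e2 := fun j => e1 (nb j) (y j) (hy j) (h.nbs j)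
  have e3 := e1 3 u hu h.target
  obtain ⟨j, hj⟩ := ha.mem
  have := eval_searchNbs m ho ho3 ho6 hx0 hx1 hy0 hy1 hxy (X 1 a - X 0 v) (2 * a)
    (List.finRange 5) σ ?_ ?_ ?_
  · exact ⟨this.1, this.2.1, this.2.2.1, this.2.2.2 (Or.inr ⟨j, List.mem_finRange j, by
      rw [e2, hj], by rw [h.nbs, hj]⟩)⟩
  · intro j _
    rw [e2, e3]
    rcases ha.nearest j with h' | h'
    · exact Or.inl ⟨by rw [h'], by rw [h.nbs, h']⟩
    · exact Or.inr h'
  · rw [e3]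
    exact ha.pos
  · right
    rw [hs]
    have := ha.pos
    have e : signedCross m (X 1 a - X 0 v) (X 0 v - X 1 u) =
        signedCross m (X 1 u - X 0 v) (X 1 a - X 0 v) := by
      cases m <;> simp [signedCross, cross] <;> ring
    rwa [e]

theorem achieves_searchCode {n k v u a b : ℕ} {y : Fin 5 → ℕ} {σ : View} {X : ℕ → ℕ → ℂ}
    (hu : u < n) (hy : ∀ j, y j < n)
    (h : HasOffsets n k v u y σ) (h6 : σ.nreg 6 = 2 * n) (hX : MemIs n σ.rmem X)
    (h01 : (⟨σ.rreg 0, σ.rreg 1⟩ : ℂ) = X 0 v) (h78 : (⟨σ.rreg 7, σ.rreg 8⟩ : ℂ) = X 0 v - X 1 u)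
    (h90 : (⟨σ.rreg 9, σ.rreg 10⟩ : ℂ) = X 0 v - X 1 u)
    (ha : IsNearest true (X 0 v) (X 1) y u a) (hb : IsNearest false (X 0 v) (X 1) y u b) :
    Achieves searchCode.compile searchCode.cost σ fun τ => HasOffsets n k v u y τ ∧
      τ.nreg 6 = 2 * n ∧ τ.nreg 4 = 2 * a ∧ τ.nreg 5 = 2 * b ∧ MemIs n τ.rmem X ∧
      (⟨τ.rreg 0, τ.rreg 1⟩ : ℂ) = X 0 v := by
  obtain ⟨l1, f1, m1, r1⟩ := eval_search (o := 4) (x₁ := 7) (x₂ := 8) (by decide) (by decide)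
    (by decide) (by decide) (by decide) (by decide) (by decide) (by decide) hu hy h h6 hX h01 h78 ha
  set τ := (Code.seqs ((List.finRange 5).map (searchNb true 4 7 8))).eval σ with hτ
  have h' : HasOffsets n k v u y τ := h.congr fun i hi => f1.nreg i fun hc => hi (by
    simp only [List.mem_singleton] at hc
    simp [hc])
  have h6' : τ.nreg 6 = 2 * n := (f1.nreg 6 (by decide)).trans h6
  have h01' : (⟨τ.rreg 0, τ.rreg 1⟩ : ℂ) = X 0 v := by
    rw [f1.rreg 0 (by decide), f1.rreg 1 (by decide), h01]
  obtain ⟨l2, f2, m2, r2⟩ := eval_search (o := 5) (x₁ := 9) (x₂ := 10) (by decide) (by decide)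
    (by decide) (by decide) (by decide) (by decide) (by decide) (by decide) hu hy h' h6'
    (m1 ▸ hX) h01' (by rw [f1.rreg 9 (by decide), f1.rreg 10 (by decide), h90]) hb
  refine Achieves.code ⟨l1, l2⟩ ?_
  simp only [searchCode, Code.eval, ← hτ]
  refine ⟨h'.congr fun i hi => f2.nreg i fun hc => hi (by
    simp only [List.mem_singleton] at hc
    simp [hc]), (f2.nreg 6 (by decide)).trans h6', (f2.nreg 4 (by decide)).trans r1, r2,
    by rw [m2, m1]; exact hX, ?_⟩
  rw [f2.rreg 0 (by decide), f2.rreg 1 (by decide), h01']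

end RealRAM

namespace RealRAM

/-! ### The second part of the program: the positions of `v` relative to `u` -/

/-- Updates the scale and stores the position of `v` relative to `u`. -/
def recordCode : Code :=
  .seq (.setR 6 (.add (.var 6) (CExp.reg 4 5).normSq)) <|
  .seq (Code.seqs (pairs.map pairCode)) (.storeC 6 2 4 5)

theorem eval_recordCode {n k v u : ℕ} {y : Fin 5 → ℕ} {σ : View} {Y : ℕ → ℕ → ℂ} {j : ℕ}
    (hu : u < n) (hy : ∀ j, y j < n) (h : HasOffsets n k v u y σ) (h6 : σ.nreg 6 = 2 * (n * j))
    (hY : MemIs n σ.rmem Y) :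
    recordCode.Legal σ ∧ recordCode.eval σ =
      { σ with
        rreg := Function.update σ.rreg 6
          (σ.rreg 6 + Complex.normSq ⟨σ.rreg 4, σ.rreg 5⟩ + pairSum u y (Y j))
        rmem := writePt σ.rmem (2 * (n * j) + 2 * v) ⟨σ.rreg 4, σ.rreg 5⟩ } := by
  have e1 : ∀ i, (relExp (nb i)).eval σ = Y j (y i) - Y j u := by
    intro i
    rw [eval_relExp, h6, h.nbs, h.target, hY j _ (hy i), hY j _ hu]
  set ρ : View := { σ with
    rreg := Function.update σ.rreg 6 (σ.rreg 6 + Complex.normSq ⟨σ.rreg 4, σ.rreg 5⟩) } with hρ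
  have e0 : (Code.setR 6 (.add (.var 6) (CExp.reg 4 5).normSq)).eval σ = ρ := by
    simp [Code.eval, RExp.eval, hρ]
  obtain ⟨l2, e2⟩ := eval_pairCodes pairs ρ
  constructor
  · refine ⟨⟨trivial, by simp⟩, ?_, ?_⟩
    · rw [e0]
      exact l2
    · exact Code.legal_storeC _ _ _ _ _
  · simp only [recordCode, Code.eval] at e0 ⊢
    rw [e0, e2, hρ]
    simp [eval_relExp_update, e1, pairSum, h6, h.vertex]

/-- The memory after the positions of `v` relative to `u` have been stored in the places
`1, …, m`. -/
noncomputable def recorded (v : ℕ) (R : ℕ → ℂ) (X : ℕ → ℕ → ℂ) (m j w : ℕ) : ℂ :=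
  if w = v ∧ 1 ≤ j ∧ j ≤ m then R (j - 1) else X j w

theorem recorded_of_ne {v w : ℕ} (h : w ≠ v) (R : ℕ → ℂ) (X : ℕ → ℕ → ℂ) (m j : ℕ) :
    recorded v R X m j w = X j w := by
  simp [recorded, h]

theorem MemIs.record {n v m : ℕ} {R : ℕ → ℂ} {X : ℕ → ℕ → ℂ} {mem : ℕ → ℝ} (hv : v < n)
    (h : MemIs n mem (recorded v R X m)) :
    MemIs n (RealRAM.writePt mem (2 * (n * (m + 1)) + 2 * v) (R m)) (recorded v R X (m + 1)) := by
  refine (h.writePt hv (R m)).congr fun j w _ => ?_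
  simp only [recorded]
  by_cases hw : w = v
  · by_cases hj : j = m + 1
    · simp [hw, hj]
    · have : j ≤ m + 1 ↔ j ≤ m := by omega
      simp [hw, hj, this]
  · simp [hw]

/-- The state of the program before the step from drawing `i` to drawing `i + 1`. -/
structure StepInv (n k v u a b : ℕ) (y : Fin 5 → ℕ) (X : ℕ → ℕ → ℂ) (R : ℕ → ℂ) (S : ℕ → ℝ)
    (i : ℕ) (τ : View) : Prop where
  offsets : HasOffsets n k v u y τ
  left : τ.nreg 4 = 2 * a
  right : τ.nreg 5 = 2 * b
  base : τ.nreg 6 = 2 * (n * (i + 1))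
  counter : τ.nreg 7 = i
  start : (⟨τ.rreg 0, τ.rreg 1⟩ : ℂ) = X 0 v
  pos : (⟨τ.rreg 4, τ.rreg 5⟩ : ℂ) = R i
  scale : τ.rreg 6 = S i
  mem : MemIs n τ.rmem (recorded v R X (i + 1))

/-- Treats the first drawing of the contracted graph. -/
def firstCode : Code :=
  .seq (.setC 4 5 ((CExp.reg 0 1).sub (.mem 6 3))) <| .seq (.setR 6 (.const 1)) <|
  .seq recordCode (.setN 7 (.const 0))

variable {n k v u a b : ℕ} {y : Fin 5 → ℕ} {X : ℕ → ℕ → ℂ} {R : ℕ → ℂ} {S : ℕ → ℝ}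

theorem achieves_firstCode {σ : View} (hv : v < n) (hu : u < n) (hy : ∀ j, y j < n)
    (h : HasOffsets n k v u y σ)
    (h6 : σ.nreg 6 = 2 * n) (h4 : σ.nreg 4 = 2 * a) (h5 : σ.nreg 5 = 2 * b)
    (hX : MemIs n σ.rmem X) (h01 : (⟨σ.rreg 0, σ.rreg 1⟩ : ℂ) = X 0 v) (hR : R 0 = X 0 v - X 1 u)
    (hS : S 0 = 1 + Complex.normSq (R 0) + pairSum u y (X 1)) :
    Achieves firstCode.compile firstCode.cost σ (StepInv n k v u a b y X R S 0) := by
  have i1 : ((CExp.reg 0 1).sub (.mem 6 3)).Indep 4 :=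
    (CExp.indep_reg (by decide) (by decide)).sub (CExp.indep_mem _ _ _)
  have m2 : readPt σ.rmem (σ.nreg 6 + σ.nreg 3) = X 1 u := by
    rw [← hX 1 u hu, h6, h.target, mul_one]
  set ρ : View := (Code.setR 6 (.const 1)).eval
    ((Code.setC 4 5 ((CExp.reg 0 1).sub (.mem 6 3))).eval σ) with hρ
  simp only [Code.eval_setC i1, CExp.eval_sub, CExp.eval_reg, CExp.eval_mem, m2, h01, ← hR,
    Code.eval, RExp.eval] at hρ
  have hρo : HasOffsets n k v u y ρ := by rw [hρ]; exact h.congr fun _ _ => rfl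
  have hρ6 : ρ.nreg 6 = 2 * (n * 1) := by rw [hρ, mul_one]; exact h6
  have hρX : MemIs n ρ.rmem X := by rw [hρ]; exact hX
  have hρR : (⟨ρ.rreg 4, ρ.rreg 5⟩ : ℂ) = R 0 := by rw [hρ]; simp
  obtain ⟨l, e⟩ := eval_recordCode hu hy hρo hρ6 hρX
  rw [hρR] at e
  have hρ' : (Code.setR 6 (.const 1)).eval
    ((Code.setC 4 5 ((CExp.reg 0 1).sub (.mem 6 3))).eval σ) = ρ := by
    simp only [Code.eval_setC i1, CExp.eval_sub, CExp.eval_reg, CExp.eval_mem, m2, h01, ← hR,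
      Code.eval, RExp.eval, hρ]
  refine Achieves.code ⟨Code.legal_setC i1 (by simp), trivial, ?_, trivial⟩ ?_
  · rw [hρ']
    exact l
  · have : firstCode.eval σ = (Code.setN 7 (.const 0)).eval (recordCode.eval
      ((Code.setR 6 (.const 1)).eval
        ((Code.setC 4 5 ((CExp.reg 0 1).sub (.mem 6 3))).eval σ))) := rfl
    rw [this, hρ', e]
    simp only [Code.eval, NExp.eval]
    refine ⟨hρo.congr fun i hi => ?_, ?_, ?_, ?_, ?_, ?_, ?_, ?_, ?_⟩
    · refine Function.update_of_ne ?_ _ _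
      rintro rfl
      exact hi (by decide)
    · simp [hρ, h4]
    · simp [hρ, h5]
    · simp [hρ6]
    · simp
    · simp [hρ, h01]
    · simpa using hρR
    · simp [hρ, hS]
    · exact MemIs.record (m := 0) hv (hρX.congr fun j w _ => by
        simp only [recorded]
        rw [if_neg (by omega)])

/-- Treats the next drawing of the contracted graph. -/
def nextCode : Code :=
  .seq (.setN 15 (.add (.var 6) (.var 0))) <| .seq stepCode <|
  .seq (.setN 6 (.var 15)) <| .seq recordCode (.setN 7 (.add (.var 7) (.const 1)))

/-- The slots of `v` in the treated drawings already hold relative positions, but the points read in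
this step belong to other vertices, where the memory still agrees with the input (`recorded_of_ne`).
-/
theorem eval_nextCode {σ : View} (hv : v < n) (hu : u < n) (ha : a < n) (hb : b < n)
    (hy : ∀ j, y j < n) (huv : u ≠ v) (hav : a ≠ v) (hbv : b ≠ v) (hyv : ∀ j, y j ≠ v)
    {i : ℕ} (hR : R (i + 1) = relativeStep u a b (X (i + 1)) (X (i + 1 + 1)) (R i))
    (hS : S (i + 1) = S i + (Complex.normSq (R (i + 1)) + pairSum u y (X (i + 1 + 1))))
    (h : StepInv n k v u a b y X R S i σ) :
    nextCode.Legal σ ∧ StepInv n k v u a b y X R S (i + 1) (nextCode.eval σ) := by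
  set ρ₁ : View := (Code.setN 15 (.add (.var 6) (.var 0))).eval σ with hρ₁
  obtain ⟨l1, n1, -, r1, q0, q1, q6, q⟩ := eval_stepCode ρ₁
  set ρ₂ : View := (Code.setN 6 (.var 15)).eval (stepCode.eval ρ₁) with hρ₂
  have hk15 : ρ₁.nreg 15 = 2 * (n * (i + 1 + 1)) := by
    rw [hρ₁]
    simp only [Code.eval, NExp.eval, Function.update_self, h.base, h.offsets.size]
    ring
  have hk : ∀ x : Fin 64, x ≠ 15 → ρ₁.nreg x = σ.nreg x := by
    intro x hx
    rw [hρ₁]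
    simp [Code.eval, hx]
  have hm : ρ₁.rmem = σ.rmem := rfl
  have hrr : ρ₁.rreg = σ.rreg := rfl
  have e1 : ∀ x w, x ≠ 15 → w < n → w ≠ v → σ.nreg x = 2 * w →
      (relExp x).eval ρ₁ = X (i + 1) w - X (i + 1) u := by
    intro x w hx hw hwv hxw
    rw [eval_relExp, hk 6 (by decide), hk 3 (by decide), hk x hx, h.base, h.offsets.target, hxw, hm,
      h.mem _ w hw, h.mem _ u hu, recorded_of_ne hwv, recorded_of_ne huv]
  have e2 : ∀ x w, x ≠ 15 → w < n → w ≠ v → σ.nreg x = 2 * w →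
      (relExp' x).eval ρ₁ = X (i + 1 + 1) w - X (i + 1 + 1) u := by
    intro x w hx hw hwv hxw
    rw [relExp', CExp.eval_sub, CExp.eval_mem, CExp.eval_mem, hk15, hk 3 (by decide), hk x hx,
      h.offsets.target, hxw, hm,
      h.mem _ w hw, h.mem _ u hu, recorded_of_ne hwv, recorded_of_ne huv]
  rw [e1 4 a (by decide) ha hav h.left, e1 5 b (by decide) hb hbv h.right,
    e2 4 a (by decide) ha hav h.left, e2 5 b (by decide) hb hbv h.right, hrr, h.pos,
    ← relativeStep, ← hR] at q
  have hρr : ρ₂.rreg = (stepCode.eval ρ₁).rreg := rfl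
  have hρm : ρ₂.rmem = σ.rmem := r1
  have hρn : ∀ x : Fin 64, x ≠ 15 → x ≠ 6 → ρ₂.nreg x = σ.nreg x := by
    intro x hx hx6
    rw [← hk x hx, ← n1, hρ₂]
    simp [Code.eval, hx6]
  have hρ6 : ρ₂.nreg 6 = 2 * (n * (i + 1 + 1)) := by
    rw [← hk15, ← n1, hρ₂]
    simp [Code.eval, NExp.eval]
  have hρo : HasOffsets n k v u y ρ₂ := h.offsets.congr fun x hx => hρn x
    (fun hc => hx (by simp [hc])) (fun hc => hx (by simp [hc]))
  have hρM : MemIs n ρ₂.rmem (recorded v R X (i + 1)) := hρm ▸ h.mem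
  obtain ⟨l, e⟩ := eval_recordCode hu hy hρo hρ6 hρM
  rw [hρr, q] at e
  have hps : pairSum u y (recorded v R X (i + 1) (i + 1 + 1)) = pairSum u y (X (i + 1 + 1)) := by
    simp only [pairSum, recorded_of_ne huv, recorded_of_ne (hyv _)]
  refine ⟨⟨trivial, l1, trivial, l, trivial⟩, ?_⟩
  have : nextCode.eval σ = (Code.setN 7 (.add (.var 7) (.const 1))).eval (recordCode.eval ρ₂) := rfl
  rw [this, e]
  simp only [Code.eval, NExp.eval]
  refine ⟨hρo.congr fun x hx => ?_, ?_, ?_, ?_, ?_, ?_, ?_, ?_, ?_⟩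
  · refine Function.update_of_ne ?_ _ _
    rintro rfl
    exact hx (by decide)
  · simp [hρn, h.left]
  · simp [hρn, h.right]
  · simp [hρ6]
  · simp [hρn, h.counter]
  · simp [q0, q1, hrr, h.start]
  · simpa using q
  · simp only [Function.update_self]
    rw [q6, hrr, h.scale, hps, hS, add_assoc]
  · exact MemIs.record hv hρM

end RealRAM

namespace RealRAM

/-! ### The third part of the program: the output -/

/-- Saves the final position of `v` and prepares the copy of the last drawing. -/
def lastCode : Code :=
  .seq (.setN 15 (.add (.var 6) (.var 0))) <| .seq (.setC 2 3 (.mem 15 2)) <|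
  .seq (.setN 9 (.var 6)) (.setN 8 (.var 15))

/-- Prepares the copy of the first drawing. -/
def copyFirstCode : Code :=
  .seq (.setN 15 (.var 17)) <| .seq (.setN 9 (.var 0)) (.setN 8 (.add (.var 0) (.var 0)))

/-- Computes the factor by which the relative positions of `v` are shrunk. -/
def factorCode : Code :=
  .seq (.setR 7 (.div (.const 1) (.mul (.mul (.var 6) (.var 6)) (.var 6)))) <|
  .seq (.setN 6 (.var 0)) <| .seq (.setN 7 (.const 0)) (.setN 8 (.add (.var 1) (.const 1)))

/-- The final position of `v`. -/
def placeExp : CExp :=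
  ⟨.add (CExp.mem 6 3).re (.mul (.var 7) (CExp.mem 6 2).re),
    .add (CExp.mem 6 3).im (.mul (.var 7) (CExp.mem 6 2).im)⟩

/-- Stores the position of `v` in the next drawing. -/
def placeCode : Code :=
  .seq (.setC 11 12 placeExp) <| .seq (.storeC 6 2 11 12) <|
  .seq (.setN 6 (.add (.var 6) (.var 0))) (.setN 7 (.add (.var 7) (.const 1)))

/-- Stores the initial and final positions of `v`. -/
def endCode : Code := .seq (.storeC 17 2 0 1) (.storeC 6 2 2 3)

theorem eval_placeExp (σ : View) : placeExp.eval σ = readPt σ.rmem (σ.nreg 6 + σ.nreg 3) +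
    σ.rreg 7 • readPt σ.rmem (σ.nreg 6 + σ.nreg 2) :=
  Complex.ext (by simp [placeExp, CExp.eval, RExp.eval, CExp.mem, NExp.eval, readPt])
    (by simp [placeExp, CExp.eval, RExp.eval, CExp.mem, NExp.eval, readPt])

theorem placeExp_legal (σ : View) : placeExp.Legal σ :=
  ⟨⟨trivial, trivial, trivial⟩, ⟨trivial, trivial, trivial⟩⟩

theorem placeExp_indep : placeExp.Indep 11 := fun σ r =>
  ⟨by simp [eval_placeExp], fun _ => placeExp_legal _⟩

/-- The whole program. -/
def program : Prog :=
  .seq offsetCode.compile <| .seq positionCode.compile <| .seq searchCode.compile <|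
  .seq firstCode.compile <| .seq (.loop (.natLt (7 : Fin 64) (1 : Fin 64)) nextCode.compile) <|
  .seq lastCode.compile <| .seq (.loop (.natLt (9 : Fin 64) (8 : Fin 64)) copyBody.compile) <|
  .seq copyFirstCode.compile <|
  .seq (.loop (.natLt (9 : Fin 64) (8 : Fin 64)) copyBody.compile) <|
  .seq factorCode.compile <| .seq (.loop (.natLt (7 : Fin 64) (8 : Fin 64)) placeCode.compile)
    endCode.compile

/-- The constant in the bound for the running time. -/
def timeConst : ℕ :=
  offsetCode.cost + positionCode.cost + searchCode.cost + firstCode.cost + lastCode.cost +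
    copyFirstCode.cost + factorCode.cost + endCode.cost + nextCode.cost + 2 * copyBody.cost +
    2 * placeCode.cost + 10

/-- The memory at the end. -/
noncomputable def outputPts (k v u : ℕ) (X : ℕ → ℕ → ℂ) (R : ℕ → ℂ) (s : ℝ) (j w : ℕ) : ℂ :=
  if j = 0 then if w = v then X 0 v else X 1 w
  else if j = k + 2 then if w = v then X (k + 2) v else X (k + 1) w
  else if w = v ∧ j < k + 2 then X j u + s • R (j - 1) else X j w

variable {n k v u a b : ℕ} {y : Fin 5 → ℕ} {X : ℕ → ℕ → ℂ} {R : ℕ → ℂ} {S : ℕ → ℝ}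

/-- The state of the program during the copies. -/
structure CopyInv (n k v u : ℕ) (y : Fin 5 → ℕ) (X Y : ℕ → ℕ → ℂ) (B : ℝ) (τ : View) : Prop where
  offsets : HasOffsets n k v u y τ
  start : (⟨τ.rreg 0, τ.rreg 1⟩ : ℂ) = X 0 v
  finish : (⟨τ.rreg 2, τ.rreg 3⟩ : ℂ) = X (k + 2) v
  scale : τ.rreg 6 = B
  mem : MemIs n τ.rmem Y

theorem CopyInv.frame {Y Y' : ℕ → ℕ → ℂ} {B : ℝ} {σ τ : View} (h : CopyInv n k v u y X Y B σ)
    (hf : View.Frame [9, 15] [11, 12] σ τ) (hY : MemIs n τ.rmem Y') :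
    CopyInv n k v u y X Y' B τ where
  offsets := h.offsets.congr fun i hi => hf.nreg i fun hc => hi (by
    simp only [List.mem_cons, List.not_mem_nil, or_false] at hc
    rcases hc with rfl | rfl <;> decide)
  start := by rw [hf.rreg 0 (by decide), hf.rreg 1 (by decide), h.start]
  finish := by rw [hf.rreg 2 (by decide), hf.rreg 3 (by decide), h.finish]
  scale := by rw [hf.rreg 6 (by decide), h.scale]
  mem := hY

/-- The final position of `v` goes into registers now because the copy of drawing `k + 1` will
overwrite it in place `k + 2`. -/
theorem achieves_lastCode {σ : View} (hv : v < n) (h : StepInv n k v u a b y X R S k σ) :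
    Achieves lastCode.compile lastCode.cost σ fun τ =>
      CopyInv n k v u y X (recorded v R X (k + 1)) (S k) τ ∧ τ.nreg 9 = 2 * (n * (k + 1)) ∧
      τ.nreg 15 = 2 * (n * (k + 2)) ∧ τ.nreg 8 = 2 * (n * (k + 1)) + 2 * n := by
  have i1 : (CExp.mem 15 2).Indep 2 := CExp.indep_mem _ _ _
  have e : 2 * (n * (k + 1)) + 2 * n = 2 * (n * (k + 2)) := by ring
  refine Achieves.code ⟨trivial, Code.legal_setC i1 (by simp), trivial, trivial⟩ ?_
  simp only [lastCode, Code.eval, Code.eval_setC i1, NExp.eval]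
  refine ⟨⟨?_, ?_, ?_, ?_, ?_⟩, ?_, ?_, ?_⟩
  · refine h.offsets.congr fun i hi => ?_
    simp only [List.mem_cons, List.not_mem_nil, or_false, not_or] at hi
    simp [hi]
  · simp [h.start]
  · have : readPt σ.rmem (σ.nreg 6 + σ.nreg 0 + σ.nreg 2) = X (k + 2) v := by
      rw [h.base, h.offsets.size, h.offsets.vertex, e, h.mem _ v hv, recorded, if_neg (by omega)]
    simp [this]
  · simp [h.scale]
  · exact h.mem
  · simp [h.base]
  · simp [h.base, h.offsets.size, e]
  · simp [h.base, h.offsets.size]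

theorem achieves_copyFirstCode {Y : ℕ → ℕ → ℂ} {B : ℝ} {σ : View}
    (h : CopyInv n k v u y X Y B σ) :
    Achieves copyFirstCode.compile copyFirstCode.cost σ fun τ =>
      CopyInv n k v u y X Y B τ ∧ τ.nreg 9 = 2 * (n * 1) ∧
      τ.nreg 15 = 2 * (n * 0) ∧ τ.nreg 8 = 2 * (n * 1) + 2 * n := by
  refine Achieves.code ⟨trivial, trivial, trivial⟩ ?_
  simp only [copyFirstCode, Code.eval, NExp.eval]
  refine ⟨⟨?_, h.start, h.finish, h.scale, h.mem⟩, ?_, ?_, ?_⟩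
  · refine h.offsets.congr fun i hi => ?_
    simp only [List.mem_cons, List.not_mem_nil, or_false, not_or] at hi
    simp [hi]
  · simp [h.offsets.size]
  · simp [h.offsets.zero]
  · simp [h.offsets.size]

/-- The state of the program after the positions of `v` have been stored in the places
`1, …, i`. -/
structure PlaceInv (n k v u : ℕ) (y : Fin 5 → ℕ) (X Y : ℕ → ℕ → ℂ) (B : ℝ) (i : ℕ) (τ : View) :
    Prop where
  inv : CopyInv n k v u y X
    (fun j w => if w = v ∧ 1 ≤ j ∧ j ≤ i then Y j u + (1 / (B * B * B)) • Y j v else Y j w) B τ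
  base : τ.nreg 6 = 2 * (n * (i + 1))
  counter : τ.nreg 7 = i
  limit : τ.nreg 8 = k + 1
  factor : τ.rreg 7 = 1 / (B * B * B)

theorem achieves_factorCode {Y : ℕ → ℕ → ℂ} {B : ℝ} {σ : View}
    (h : CopyInv n k v u y X Y B σ) (hB : B ≠ 0) :
    Achieves factorCode.compile factorCode.cost σ (PlaceInv n k v u y X Y B 0) := by
  refine Achieves.code ⟨⟨trivial, ⟨⟨trivial, trivial⟩, trivial⟩, ?_⟩, trivial, trivial, trivial⟩ ?_
  · simp [RExp.eval, h.scale, hB]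
  simp only [factorCode, Code.eval, NExp.eval, RExp.eval]
  refine ⟨⟨?_, ?_, ?_, ?_, ?_⟩, ?_, ?_, ?_, ?_⟩
  · refine h.offsets.congr fun i hi => ?_
    simp only [List.mem_cons, List.not_mem_nil, or_false, not_or] at hi
    simp [hi]
  · simp [h.start]
  · simp [h.finish]
  · simp [h.scale]
  · refine h.mem.congr fun j w _ => ?_
    rw [if_neg (by omega)]
  · simp [h.offsets.size]
  · simp
  · simp [h.offsets.steps]
  · simp [h.scale]

theorem eval_placeCode {Y : ℕ → ℕ → ℂ} {B : ℝ} {i : ℕ} {σ : View} (hv : v < n) (hu : u < n)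
    (huv : u ≠ v) (h : PlaceInv n k v u y X Y B i σ) :
    placeCode.Legal σ ∧ PlaceInv n k v u y X Y B (i + 1) (placeCode.eval σ) := by
  refine ⟨⟨Code.legal_setC placeExp_indep (placeExp_legal _), Code.legal_storeC _ _ _ _ _,
    trivial, trivial⟩, ?_⟩
  have e : placeExp.eval σ = Y (i + 1) u + (1 / (B * B * B)) • Y (i + 1) v := by
    rw [eval_placeExp, h.factor, h.base, h.inv.offsets.target, h.inv.offsets.vertex,
      h.inv.mem _ u hu, h.inv.mem _ v hv]
    simp [huv]
  simp only [placeCode, Code.eval, Code.eval_setC placeExp_indep, Code.eval_storeC, NExp.eval, e]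
  refine ⟨⟨?_, ?_, ?_, ?_, ?_⟩, ?_, ?_, ?_, ?_⟩
  · refine h.inv.offsets.congr fun i hi => ?_
    simp only [List.mem_cons, List.not_mem_nil, or_false, not_or] at hi
    simp [hi]
  · simp [h.inv.start]
  · simp [h.inv.finish]
  · simp [h.inv.scale]
  · simp only [Function.update_self, ne_eq, Fin.reduceEq, not_false_eq_true, Function.update_of_ne,
      h.base, h.inv.offsets.vertex]
    refine (h.inv.mem.writePt hv _).congr fun j w _ => ?_
    by_cases hw : w = v
    · by_cases hj : j = i + 1
      · rw [if_pos ⟨hj, hw⟩, if_pos (by omega), hj]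
      · have : j ≤ i + 1 ↔ j ≤ i := by omega
        simp [hw, hj, this]
    · simp [hw]
  · simp [h.base, h.inv.offsets.size]
    ring
  · simp [h.counter]
  · simp [h.limit]
  · simp [h.factor]

/-- The two copied drawings carry relative positions in the slots of `v`; the true initial and final
positions, kept in registers, are written over them. -/
theorem achieves_endCode {Y : ℕ → ℕ → ℂ} {B : ℝ} {σ : View} (hv : v < n) (hu : u < n)
    (huv : u ≠ v) (h : PlaceInv n k v u y X Y B (k + 1) σ)
    (hY : ∀ j w, w < n → Y j w = if j = 0 then recorded v R X (k + 1) 1 w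
      else if j = k + 2 then recorded v R X (k + 1) (k + 1) w else recorded v R X (k + 1) j w) :
    Achieves endCode.compile endCode.cost σ fun τ =>
      MemIs n τ.rmem (outputPts k v u X R (1 / (B * B * B))) := by
  refine Achieves.code ⟨Code.legal_storeC _ _ _ _ _, Code.legal_storeC _ _ _ _ _⟩ ?_
  have e1 : 0 + 2 * v = 2 * (n * 0) + 2 * v := by ring
  simp only [endCode, Code.eval, Code.eval_storeC, h.inv.start, h.inv.finish,
    h.inv.offsets.zero, h.inv.offsets.vertex, h.base, e1]
  refine ((h.inv.mem.writePt hv _).writePt hv _).congr fun j w hw => ?_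
  rw [hY j w hw, hY j u hu, hY j v hv, recorded_of_ne huv, recorded_of_ne huv, recorded_of_ne huv]
  by_cases hwv : w = v
  · subst hwv
    by_cases h0 : j = 0
    · simp [outputPts, h0]
    by_cases h2 : j = k + 2
    · simp [outputPts, h2]
    by_cases h4 : j < k + 2
    · have h5 : 1 ≤ j ∧ j ≤ k + 1 := by omega
      simp only [outputPts, recorded, h0, h2, h4, h5, and_self, if_true, if_false, false_and]
    · have h5 : ¬ (1 ≤ j ∧ j ≤ k + 1) := by omega
      simp only [outputPts, recorded, h0, h2, h4, h5, and_false, if_false, false_and]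
  · simp only [recorded_of_ne hwv, outputPts, hwv, and_false, false_and, if_false]

theorem achieves_program {σ : View} (h0 : σ.nmem 0 = n) (h1 : σ.nmem 1 = k) (h2 : σ.nmem 2 = v)
    (h3 : σ.nmem 3 = u)
    (hy : ∀ j : Fin 5, (if (j : ℕ) < σ.nmem (5 + 2 * v) then σ.nmem (σ.nmem (4 + 2 * v) + j) else u)
      = y j)
    (hv : v < n) (hu : u < n) (ha : a < n) (hb : b < n) (hyn : ∀ j, y j < n)
    (huv : u ≠ v) (hav : a ≠ v) (hbv : b ≠ v) (hyv : ∀ j, y j ≠ v) (hX : MemIs n σ.rmem X)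
    (hna : IsNearest true (X 0 v) (X 1) y u a) (hnb : IsNearest false (X 0 v) (X 1) y u b)
    {B : ℝ} (hR : R = positionSeq u a b (fun i => X (i + 1)) (X 0 v - X 1 u))
    (hB : B = scaleBound u y (fun i => X (i + 1)) R k) :
    Achieves program (timeConst * (k + n)) σ fun τ =>
      MemIs n τ.rmem (outputPts k v u X R (1 / (B * B * B))) := by
  have hB0 : scaleBound u y (fun i => X (i + 1)) R k ≠ 0 :=
    (zero_lt_one.trans_le (one_le_scaleBound k)).ne'
  have hR0 : R 0 = X 0 v - X 1 u := by rw [hR]; rfl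
  have hRs : ∀ i, R (i + 1) = relativeStep u a b (X (i + 1)) (X (i + 1 + 1)) (R i) := by
    intro i; rw [hR]; rfl
  subst hB
  have main : Achieves program (offsetCode.cost + (positionCode.cost + (searchCode.cost +
      (firstCode.cost + (k * (nextCode.cost + 1) + 1 + (lastCode.cost +
      (n * (copyBody.cost + 1) + 1 + (copyFirstCode.cost + (n * (copyBody.cost + 1) + 1 +
      (factorCode.cost + ((k + 1) * (placeCode.cost + 1) + 1 + endCode.cost))))))))))) σ fun τ => MemIs n τ.rmem (outputPts k v u X R
      (1 / (scaleBound u y (fun i => X (i + 1)) R k * scaleBound u y (fun i => X (i + 1)) R k *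
        scaleBound u y (fun i => X (i + 1)) R k))) := by
    refine (achieves_offsetCode h0 h1 h2 h3 hy).seq fun τ₁ ⟨o1, b1, m1⟩ => ?_
    refine (achieves_positionCode hv hu o1 b1 (m1 ▸ hX)).seq fun τ₂ ⟨o2, b2, m2, p2, q2, q2'⟩ => ?_
    refine (achieves_searchCode hu hyn o2 b2 m2 p2 q2 q2' hna hnb).seq
      fun τ₃ ⟨o3, b3, a3, b3', m3, p3⟩ => ?_
    refine (achieves_firstCode (S := scaleBound u y (fun i => X (i + 1)) R) hv hu hyn o3 b3 a3 b3'
      m3 p3 hR0 rfl).seq fun τ₄ i4 => ?_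
    refine (Achieves.loop (StepInv n k v u a b y X R (scaleBound u y (fun i => X (i + 1)) R)) k
      (fun j hj τ hτ => ⟨by rw [hτ.counter, hτ.offsets.steps]; exact hj,
        eval_nextCode hv hu ha hb hyn huv hav hbv hyv (hRs j) rfl hτ⟩)
      (fun τ hτ => by rw [hτ.counter, hτ.offsets.steps]; exact lt_irrefl _) i4).seq
      fun τ₅ i5 => ?_
    refine (achieves_lastCode hv i5).seq fun τ₆ ⟨i6, n6, n6', n6''⟩ => ?_
    refine (achieves_copy (by omega) i6.mem n6 n6' n6'' i6.offsets.zero).seq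
      fun τ₇ ⟨f7, m7⟩ => ?_
    refine (achieves_copyFirstCode (i6.frame f7 m7)).seq fun τ₈ ⟨i8, n8, n8', n8''⟩ => ?_
    refine (achieves_copy (by omega) i8.mem n8 n8' n8'' i8.offsets.zero).seq
      fun τ₉ ⟨f9, m9⟩ => ?_
    refine (achieves_factorCode (i8.frame f9 m9) hB0).seq fun τ₁₀ i10 => ?_
    refine (Achieves.loop (PlaceInv n k v u y X _ _) (k + 1)
      (fun j hj τ hτ => ⟨by rw [hτ.counter, hτ.limit]; exact hj, eval_placeCode hv hu huv hτ⟩)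
      (fun τ hτ => by rw [hτ.counter, hτ.limit]; exact lt_irrefl _) i10).seq fun τ₁₁ i11 => ?_
    exact achieves_endCode hv hu huv i11 fun j w _ => by simp
  intro s hs
  obtain ⟨s', t, e, ht, hm⟩ := main s hs
  refine ⟨s', t, e, ht.trans ?_, hm⟩
  -- Since `v < n`, the number `k + n` is positive and absorbs the constant costs.
  have hn : 1 ≤ k + n := by omega
  have k1 := Nat.mul_le_mul_left (offsetCode.cost + positionCode.cost + searchCode.cost +
    firstCode.cost + lastCode.cost + copyFirstCode.cost + factorCode.cost + endCode.cost) hn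
  have k2 := Nat.mul_le_mul_left nextCode.cost (Nat.le_add_right k n)
  have k3 := Nat.mul_le_mul_left copyBody.cost (Nat.le_add_left n k)
  have k4 := Nat.mul_le_mul_left placeCode.cost (show k + 1 ≤ k + n by omega)
  have k5 := Nat.zero_le (placeCode.cost * (k + n))
  simp only [timeConst, add_mul, mul_add, mul_one] at *
  linarith

end RealRAM

/-! ### The conversion by the program -/

namespace RealRAM

/-- The first five entries of a list, padded with `u`. -/
def padded {n : ℕ} (L : List (Fin n)) (u : Fin n) (j : Fin 5) : Fin n :=
  if h : (j : ℕ) < L.length then L.get ⟨j, h⟩ else u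

theorem padded_mem {n : ℕ} {L : List (Fin n)} {u : Fin n} (hu : u ∈ L) (j : Fin 5) :
    padded L u j ∈ L := by
  unfold padded
  split_ifs with h
  · exact List.get_mem _ _
  · exact hu

/-- With at most five neighbors, none is cut off. -/
theorem exists_padded_eq {n : ℕ} {L : List (Fin n)} (u : Fin n) (hL : L.length ≤ 5) {x : Fin n}
    (hx : x ∈ L) : ∃ j, padded L u j = x := by
  obtain ⟨i, rfl⟩ := List.get_of_mem hx
  exact ⟨⟨i, i.2.trans_le hL⟩, dif_pos i.2⟩

theorem length_eq_ncard {α : Type*} {s : Set α} {L : List α} (hL : L.Nodup)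
    (h : ∀ x, x ∈ L ↔ x ∈ s) : L.length = s.ncard := by
  classical
  have : s = (L.toFinset : Set α) := by
    ext x
    simp [h]
  rw [this, Set.ncard_coe_finset, List.toFinset_card_of_nodup hL]

variable {n k : ℕ} {G : SimpleGraph (Fin n)} {Γ₁ Γ₂ : Fin n → ℂ} {v u : Fin n}
  {D : Fin (k + 1) → {w : Fin n // w ≠ v} → ℂ} {σ : Fin n → Fin n}

/-- A neighbor strictly left of `v u` but not strictly left of the edge to `σ u` is in the closed
wedge of the face, so it is `u` or `σ u`; the determinant of `u` with itself is zero. -/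
theorem isNearest_next (h : IsPlanarDrawing G Γ₁) (hf : IsCcwFace G Γ₁ v u (σ u)) {d : ℕ → ℂ}
    (hd : ∀ w : Fin n, w ≠ v → d w = Γ₁ w) {y : Fin 5 → Fin n} (hy : ∀ j, G.Adj v (y j))
    (hya : ∃ j, y j = σ u) : IsNearest true (Γ₁ v) d (fun j => y j) u (σ u : Fin n) := by
  have hu := hf.1.1
  have ha := hf.1.2.2.1.symm
  refine ⟨?_, hya.imp fun j hj => by rw [hj], fun j => ?_⟩
  · rw [hd u hu.ne', hd _ ha.ne']
    exact hf.2
  · rw [hd u hu.ne', hd _ ha.ne', hd _ (hy j).ne']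
    change _ ∨ ¬ 0 < orient (Γ₁ v) (Γ₁ u) (Γ₁ (y j)) ∨ 0 < orient (Γ₁ v) (Γ₁ (σ u)) (Γ₁ (y j))
    by_contra! hc
    obtain ⟨h1, h2, h3⟩ := hc
    rcases hf.eq_or_eq h (hy j) h2.le (by rw [orient_swap]; linarith) with h4 | h4
    · rw [h4] at h2
      simp [orient, cross_self_eq] at h2
    · exact h1 (by rw [h4])

theorem isNearest_prev (h : IsPlanarDrawing G Γ₁) {b : Fin n} (hf : IsCcwFace G Γ₁ v b u)
    {d : ℕ → ℂ} (hd : ∀ w : Fin n, w ≠ v → d w = Γ₁ w) {y : Fin 5 → Fin n}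
    (hy : ∀ j, G.Adj v (y j)) (hyb : ∃ j, y j = b) :
    IsNearest false (Γ₁ v) d (fun j => y j) u b := by
  have hb := hf.1.1
  have hu := hf.1.2.2.1.symm
  refine ⟨?_, hyb.imp fun j hj => by rw [hj], fun j => ?_⟩
  · rw [hd u hu.ne', hd _ hb.ne']
    exact hf.2
  · rw [hd u hu.ne', hd _ hb.ne', hd _ (hy j).ne']
    change _ ∨ ¬ 0 < orient (Γ₁ v) (Γ₁ (y j)) (Γ₁ u) ∨ 0 < orient (Γ₁ v) (Γ₁ (y j)) (Γ₁ b)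
    by_contra! hc
    obtain ⟨h1, h2, h3⟩ := hc
    rcases hf.eq_or_eq h (hy j) (by rw [orient_swap]; linarith) h2.le with h4 | h4
    · exact h1 (by rw [h4])
    · rw [h4] at h2
      simp [orient, cross_self_eq] at h2

/-- A list of the neighbors of `v` gives a conversion of the pseudomorph. -/
theorem isConversion_of_list (h₁ : IsTriangulation G Γ₁) (hP : IsPseudomorph G Γ₁ Γ₂ v u D)
    (hN : (G.neighborSet v).ncard ≤ 5)
    (hl : IsShortLink G v σ) (hσ : ∀ x, G.Adj v x → IsCcwFace G Γ₁ v x (σ x))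
    (hσ₂ : ∀ x, G.Adj v x → 0 < orient (Γ₂ v) (Γ₂ x) (Γ₂ (σ x)))
    {b : Fin n} (hb : G.Adj v b) (hbu : σ b = u) {E : ℕ → ℕ → ℂ}
    (hE : ∀ (i : Fin (k + 1)) (w : {w : Fin n // w ≠ v}), E i (w : Fin n) = D i w)
    {L : List (Fin n)} (hL : L.Nodup) (hLv : ∀ x, x ∈ L ↔ G.Adj v x) {r : ℕ → ℂ} {B : ℝ}
    (hr : r = positionSeq (u : ℕ) (σ u : Fin n) b E (Γ₁ v - E 0 u))
    (hB : B = scaleBound (u : ℕ) (fun j => (padded L u j : ℕ)) E r k) :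
    IsConversion G Γ₁ Γ₂ v u D
      (conversionDrawings Γ₁ Γ₂ D fun i => E i u + (1 / (B * B * B)) • r i) :=
  isConversion_of_scaleBound h₁ hP hl hσ hσ₂ hb hbu hE (fun x hx =>
    (exists_padded_eq u ((length_eq_ncard hL hLv).trans_le hN) ((hLv x).2 hx)).imp
      fun j hj => by rw [hj]) hr hB

theorem exists_isConversion (h₁ : IsTriangulation G Γ₁) (hP : IsPseudomorph G Γ₁ Γ₂ v u D)
    (hN : (G.neighborSet v).ncard ≤ 5)
    (hl : IsShortLink G v σ) (hσ : ∀ x, G.Adj v x → IsCcwFace G Γ₁ v x (σ x))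
    (hσ₂ : ∀ x, G.Adj v x → 0 < orient (Γ₂ v) (Γ₂ x) (Γ₂ (σ x)))
    {b : Fin n} (hb : G.Adj v b) (hbu : σ b = u) :
    ∃ M : Fin (k + 2 + 1) → Fin n → ℂ, IsConversion G Γ₁ Γ₂ v u D M := by
  classical
  -- The default value 0 is irrelevant: only entries that come from the drawings are constrained.
  let E : ℕ → ℕ → ℂ := fun i w => if h : ∃ (hi : i < k + 1) (hw : w < n), (⟨w, hw⟩ : Fin n) ≠ v
    then D ⟨i, h.1⟩ ⟨⟨w, h.2.1⟩, h.2.2⟩ else 0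
  exact ⟨_, isConversion_of_list h₁ hP hN hl hσ hσ₂ hb hbu (E := E)
    (fun i w => dif_pos ⟨i.2, w.1.2, w.2⟩) (L := (Finset.univ.filter (G.Adj v)).toList)
    (Finset.nodup_toList _) (by simp) rfl rfl⟩

/-- The memory at the end holds the drawings of the conversion. -/
theorem conversionDrawings_eq_outputPts (hP : IsPseudomorph G Γ₁ Γ₂ v u D) {X : ℕ → ℕ → ℂ}
    (hX : ∀ (i : Fin (k + 1)) (w : {w : Fin n // w ≠ v}), X (i + 1) (w : Fin n) = D i w)
    (h0 : X 0 v = Γ₁ v) (hk : X (k + 2) v = Γ₂ v) (r : ℕ → ℂ) (s : ℝ) (j : Fin (k + 2 + 1))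
    (w : Fin n) :
    outputPts k v u X r s j w =
      conversionDrawings Γ₁ Γ₂ D (fun i => X (i + 1) u + s • r i) j w := by
  have hX' := fun (i : Fin (k + 1)) (w : Fin n) (hw : w ≠ v) => hX i ⟨w, hw⟩
  have hval : (w : ℕ) = v ↔ w = v := Fin.ext_iff.symm
  rcases Fin.eq_zero_or_eq_succ j with rfl | ⟨j, rfl⟩
  · rw [conversionDrawings_zero]
    simp only [outputPts, Fin.val_zero, if_true, hval]
    split_ifs with hw
    · rw [hw, h0]
    · have := hX' 0 w hw
      rw [hP.contract.fixed] at this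
      simpa using this
  rcases Fin.eq_castSucc_or_eq_last j with ⟨i, rfl⟩ | rfl
  · rw [Fin.succ_castSucc, conversionDrawings_mid]
    have h2 : (i : ℕ) ≠ k + 1 := i.2.ne
    simp only [outputPts, Fin.val_castSucc, Fin.val_succ, hval]
    rw [if_neg (by omega), if_neg (by omega)]
    by_cases hw : w = v
    · subst hw
      rw [if_pos ⟨rfl, by omega⟩, extendDrawing_self]
      rfl
    · rw [if_neg (by tauto), extendDrawing_of_ne _ _ hw, hX' i w hw]
  · rw [Fin.succ_last, conversionDrawings_last]
    simp only [outputPts, Fin.val_last, hval]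
    rw [if_neg (by omega), if_pos trivial]
    split_ifs with hw
    · rw [hw, hk]
    · have := hX' (Fin.last k) w hw
      rw [hP.uncontract.fixed] at this
      simpa using this

/-- The machine computes exactly the numbers of `isConversion_of_list`, applied to the input memory,
so no separate geometric argument is needed. -/
theorem program_spec (h₁ : IsTriangulation G Γ₁) (hP : IsPseudomorph G Γ₁ Γ₂ v u D)
    (hN : (G.neighborSet v).ncard ≤ 5)
    (hl : IsShortLink G v σ) (hσ : ∀ x, G.Adj v x → IsCcwFace G Γ₁ v x (σ x))
    (hσ₂ : ∀ x, G.Adj v x → 0 < orient (Γ₂ v) (Γ₂ x) (Γ₂ (σ x)))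
    {b : Fin n} (hb : G.Adj v b) (hbu : σ b = u) {s : State} (hs : IsInput G Γ₁ Γ₂ v u D s) :
    ∃ (M : Fin (k + 2 + 1) → Fin n → ℂ) (s' : State) (t : ℕ),
      IsConversion G Γ₁ Γ₂ v u D M ∧ Exec program s s' t ∧ IsOutput M s' ∧
        t ≤ timeConst * (k + n) := by
  have hu := hP.contract.adj
  have hau := hl.adj_next u hu
  have hf := hσ b hb
  rw [hbu] at hf
  obtain ⟨hn, hg⟩ := hs.graph
  obtain ⟨L, hL, hLv, hlen, hget⟩ := hg v
  have hL5 : L.length ≤ 5 := (length_eq_ncard hL hLv).trans_le hN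
  have hpad : ∀ j, G.Adj v (padded L u j) := fun j => (hLv _).1 (padded_mem ((hLv u).2 hu) j)
  have hvalne : ∀ w : Fin n, w ≠ v → (w : ℕ) ≠ v := fun w hw h => hw (Fin.ext h)
  -- This includes cells about which the input says nothing; their contents do not affect the output
  -- drawings.
  set X : ℕ → ℕ → ℂ := fun j w => readPt s.rmem (2 * (n * j) + 2 * w) with hX
  have hstore : ∀ {j w : ℕ} {z : ℂ}, StoresPoint s n j w z → X j w = z := by
    intro j w z h
    rw [StoresPoint, mul_add] at h
    exact Complex.ext h.1 h.2
  have hXD : ∀ (i : Fin (k + 1)) (w : {w : Fin n // w ≠ v}), X (i + 1) (w : Fin n) = D i w :=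
    fun i w => hstore (hs.drawings i w)
  have h0 : X 0 v = Γ₁ v := hstore hs.initial_position
  have hd : ∀ w : Fin n, w ≠ v → X 1 w = Γ₁ w := by
    intro w hw
    have := hXD 0 ⟨w, hw⟩
    rw [hP.contract.fixed] at this
    simpa using this
  have hXm : MemIs n s.view.rmem X := fun _ _ _ => rfl
  have hcode : ∀ j : Fin 5, (if (j : ℕ) < s.view.nmem (5 + 2 * (v : ℕ)) then
      s.view.nmem (s.view.nmem (4 + 2 * (v : ℕ)) + j) else (u : ℕ)) = (padded L u j : ℕ) := by
    intro j
    change (if (j : ℕ) < s.nmem (5 + 2 * (v : ℕ)) then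
      s.nmem (s.nmem (4 + 2 * (v : ℕ)) + j) else (u : ℕ)) = _
    rw [hlen, padded]
    split_ifs with h
    · exact hget ⟨j, h⟩
    · rfl
  have main := achieves_program (a := (σ u : Fin n)) (b := b) hn hs.steps hs.vertex hs.target
    hcode v.2 u.2 (σ u).2 b.2 (fun j => (padded L u j).2) (hvalne u hu.ne') (hvalne _ hau.ne')
    (hvalne b hb.ne') (fun j => hvalne _ (hpad j).ne') hXm
    (h0 ▸ isNearest_next h₁.planar (hσ u hu) hd hpad (exists_padded_eq u hL5 ((hLv _).2 hau)))
    (h0 ▸ isNearest_prev h₁.planar hf hd hpad (exists_padded_eq u hL5 ((hLv _).2 hb))) rfl rfl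
  obtain ⟨s', t, e, ht, hm⟩ := main s rfl
  refine ⟨_, s', t, isConversion_of_list h₁ hP hN hl hσ hσ₂ hb hbu
    (E := fun i => X (i + 1)) hXD hL hLv rfl rfl, e, ?_, ht⟩
  intro j w
  have hjw := hm j w w.2
  rw [conversionDrawings_eq_outputPts hP hXD h0 (hstore hs.final_position)] at hjw
  rw [StoresPoint, mul_add, ← h0, ← hjw]
  exact ⟨rfl, rfl⟩

end RealRAM

theorem theorem4 :
    ∃ (P : RealRAM.Prog) (C : ℕ),
      ∀ (n k : ℕ) (G : SimpleGraph (Fin n)) (Γ₁ Γ₂ : Fin n → ℂ) (v u : Fin n)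
        (D : Fin (k + 1) → {w : Fin n // w ≠ v} → ℂ),
        IsTriangulation G Γ₁ → IsTriangulation G Γ₂ → TopologicallyEquivalent G Γ₁ Γ₂ →
        (G.neighborSet v).ncard ≤ 5 → IsPseudomorph G Γ₁ Γ₂ v u D →
        (∃ M : Fin (k + 2 + 1) → Fin n → ℂ, IsConversion G Γ₁ Γ₂ v u D M) ∧
        ∀ s : RealRAM.State, RealRAM.IsInput G Γ₁ Γ₂ v u D s →
          ∃ (M : Fin (k + 2 + 1) → Fin n → ℂ) (s' : RealRAM.State) (t : ℕ),
            IsConversion G Γ₁ Γ₂ v u D M ∧ RealRAM.Exec P s s' t ∧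
            RealRAM.IsOutput M s' ∧ t ≤ C * (k + n) := by
  refine ⟨RealRAM.program, RealRAM.timeConst, ?_⟩
  intro n k G Γ₁ Γ₂ v u D h₁ h₂ ht hN hP
  obtain ⟨σ, hl, hσ, hσ₂⟩ := exists_rotation h₁ h₂ ht hN hP
  obtain ⟨b, hb, hbu⟩ := hl.exists_prev hP.contract.adj
  exact ⟨RealRAM.exists_isConversion h₁ hP hN hl hσ hσ₂ hb hbu,
    fun s hs => RealRAM.program_spec h₁ hP hN hl hσ hσ₂ hb hbu hs⟩
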